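/- **Lemma (flux formulation of the discrete Biot problem).** *Setting.* Let $d\ge 1$, $k\ge 1$, and let $\Omega\subset\mathbb R^d$ be a bounded connected open polyhedron with a general polyhedral mesh: finitely many pairwise disjoint nonempty bounded open polyhedral elements $T\in\mathcal T_h$ (each lying on only one side of its boundary) with $\overline\Omega=\bigcup_T\overline T$, and a finite set $\mathcal F_h=\mathcal F_h^{\rm i}\cup\mathcal F_h^{\rm b}$ of faces. Each face is a closed connected subset of a hyperplane with positive $(d-1)$-dimensional measure; it is an interface, $F\subset\partial T_1\cap\partial T_2$ with $T_1\ne T_2$, or a boundary face, $F\subset\partial T\cap\partial\Omega$. Distinct faces overlap in sets of zero $(d-1)$-dimensional measure, and with $\mathcal F_T=\{F\in\mathcal F_h: F\subset\partial T\}$ one has $\partial T=\bigcup_{F\in\mathcal F_T}F$. For $F\in\mathcal F_T$ there is a unit normal $n_{TF}$ to $F$ pointing out of $T$ (for a.e. $x\in F$, $T$ coincides near $x$ with $\{y: n_{TF}\cdot(y-x)<0\}$). The two elements of each interface are ordered as $T_1,T_2$ and $n_F=n_{T_1F}$. The face size $h_F>0$ is the diameter of $F$ (any positive number if $d=1$).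 $(\cdot,\cdot)_X$ denotes the $L^2(X)$ product, also for vectors and tensors; $\pi_T^k,\pi_F^k$ are the $L^2$-orthogonal projectors on $P^k(T)$ and $P^k(F)$, the polynomials of total degree $\le k$; $P^k(\mathcal T_h)$ is the space of broken polynomials; $\nabla_s$ and $\nabla_{ss}$ are the symmetric and skew-symmetric parts of the gradient $(\nabla v)_{ij}=\partial_i v_j$. Let $\mu>0$, $\lambda\ge0$, $c_0\ge0$, $\varsigma>0$, let $\kappa$ take a constant value $\kappa_T>0$ on each $T$, $\tau=t_F/N$ with $t_F>0$ and $N\ge 1$ an integer, $t^n=n\tau$, $\delta_t\varphi^n=(\varphi^n-\varphi^{n-1})/\tau$, and let $f^n=f(t^n)\in L^2(\Omega)^d$, $g^n=g(t^n)\in L^2(\Omega)$. *Displacements.* $\underline U_h=\prod_{T}P^k(T)^d\times\prod_{F}P^k(F)^d$, with elements $\underline v_h=((v_T)_T,(v_F)_F)$ and restrictions $\underline v_T=(v_T,(v_F)_{F\in\mathcal F_T})\in\underline U_T$; $\underline U_{h,D}$ is the subspace where $v_F=0$ for all $F\in\mathcal F_h^{\rm b}$. The reconstruction $r_T\underline v_T\in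 P^{k+1}(T)^d$ is defined by $$(\nabla_s r_T\underline v_T,\nabla_s w)_T=(\nabla_s v_T,\nabla_s w)_T+\sum_{F\in\mathcal F_T}(v_F-v_T,\nabla_s w\,n_{TF})_F\quad\forall w\in P^{k+1}(T)^d,$$ together with $\int_T r_T\underline v_T=\int_T v_T$ and $\int_T\nabla_{ss}r_T\underline v_T=\sum_{F\in\mathcal F_T}\int_F\frac12(n_{TF}\otimes v_F-v_F\otimes n_{TF})$. The divergence $D_T\underline v_T\in P^k(T)$ is defined by $(D_T\underline v_T,q)_T=(\nabla\cdot v_T,q)_T+\sum_{F\in\mathcal F_T}(v_F-v_T,q\,n_{TF})_F$ for all $q\in P^k(T)$. Set $\Delta_{TF}\underline v_T=(\pi_F^k r_T\underline v_T-v_F)-(\pi_T^k r_T\underline v_T-v_T)$, $$a_h(\underline w_h,\underline v_h)=\sum_T\Big\{2\mu\Big[(\nabla_s r_T\underline w_T,\nabla_s r_T\underline v_T)_T+\sum_{F\in\mathcal F_T}h_F^{-1}(\Delta_{TF}\underline w_T,\Delta_{TF}\underline v_T)_F\Big]+\lambda(D_T\underline w_T,D_T\underline v_T)_T\Big\},$$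 and $b_h(\underline v_h,q_h)=-\sum_T(D_T\underline v_T,q_h)_T$. *Pressures.* $P_h=P^k(\mathcal T_h)$ if $c_0>0$, and $P_h=\{q\in P^k(\mathcal T_h):\int_\Omega q=0\}$ if $c_0=0$. On an interface put $[\varphi]=\varphi_{T_1}-\varphi_{T_2}$, $\{\varphi\}_\omega=\frac{\kappa_{T_2}}{\kappa_{T_1}+\kappa_{T_2}}\varphi_{T_1}+\frac{\kappa_{T_1}}{\kappa_{T_1}+\kappa_{T_2}}\varphi_{T_2}$, $\lambda_{\kappa,F}=\frac{2\kappa_{T_1}\kappa_{T_2}}{\kappa_{T_1}+\kappa_{T_2}}$. With the broken gradient $\nabla_h$, $$c_h(r,q)=(\kappa\nabla_h r,\nabla_h q)_\Omega-\sum_{F\in\mathcal F_h^{\rm i}}\big((\{\kappa\nabla_h r\}_\omega\cdot n_F,[q])_F+([r],\{\kappa\nabla_h q\}_\omega\cdot n_F)_F\big)+\sum_{F\in\mathcal F_h^{\rm i}}\frac{\varsigma\lambda_{\kappa,F}}{h_F}([r],[q])_F .$$ The lifting $R_hq\in P^{k-1}(\mathcal T_h)^d$ is defined by $(\kappa R_hq,\xi)_\Omega=\sum_{F\in\mathcal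 F_h^{\rm i}}([q],\{\kappa\xi\}_\omega\cdot n_F)_F$ for all $\xi\in P^{k-1}(\mathcal T_h)^d$. *Discrete problem at step $n$.* $(\underline u_h^n,p_h^n)\in\underline U_{h,D}\times P_h$ satisfies, for all $(\underline v_h,q_h)\in\underline U_{h,D}\times P^k(\mathcal T_h)$, $$a_h(\underline u_h^n,\underline v_h)+b_h(\underline v_h,p_h^n)=\sum_T(f^n,v_T)_T,\qquad (c_0\delta_tp_h^n,q_h)_\Omega-b_h(\delta_t\underline u_h^n,q_h)+c_h(p_h^n,q_h)=(g^n,q_h)_\Omega.\tag{1}$$ *Fluxes.* Let $S_T\underline v_T=2\mu\nabla_s r_T\underline v_T+\lambda I\,D_T\underline v_T$. For $\varphi=(\varphi_F)_{F\in\mathcal F_T}\in\prod_{F\in\mathcal F_T}P^k(F)^d$ put $(L_T\varphi)_F=\pi_F^k(\varphi_F-r_T(0,\varphi)+\pi_T^kr_T(0,\varphi))$, and let $L_T^*$ be the adjoint of $L_T$ for the $L^2(\partial T)$ product. For $F\in\mathcal F_T$, $\underline v_T\in\underline U_T$, $q\in P^k(T)$, $w\in P^k(F)^d$, $q_h\in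 P^k(\mathcal T_h)$ define $$\Phi_{TF}(\underline v_T,q)=(S_T\underline v_T-qI)n_{TF}+2\mu\,\big(L_T^*(h_{F'}^{-1}(L_T(v_{F''}-v_T)_{F''\in\mathcal F_T})_{F'})_{F'\in\mathcal F_T}\big)_F,$$ $$\phi_{TF}(w,q_h)=\begin{cases}(-w+\{\kappa\nabla_hq_h\}_\omega)\cdot n_{TF}-\frac{\varsigma\lambda_{\kappa,F}}{h_F}[q_h](n_{TF}\cdot n_F)&F\in\mathcal F_h^{\rm i},\\0&\text{otherwise.}\end{cases}$$ *Claim.* $\Phi_{TF}(\underline v_T,q)\in P^k(F)^d$ and $\phi_{TF}(w,q_h)\in P^k(F)$ always. Moreover, let $1\le n\le N$, let $\underline u_h^{n-1}\in\underline U_{h,D}$ and $p_h^{n-1}\in P^k(\mathcal T_h)$ be given, and let $(\underline u_h^n,p_h^n)\in\underline U_{h,D}\times P_h$. Then the following are equivalent: (i) $(\underline u_h^n,p_h^n)$ solves (1). (ii) For all $\underline v_h\in\underline U_{h,D}$, $$\sum_{T}\Big[(S_T\underline u_T^n-p_h^nI,\nabla_sv_T)_T+\sum_{F\in\mathcal F_T}(\Phi_{TF}(\underline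 u_T^n,p^n_{h|T}),v_F-v_T)_F\Big]=\sum_T(f^n,v_T)_T,$$ and, for all $T$ and all $q\in P^k(T)$, $$(c_0\delta_tp_h^n,q)_T-(\delta_tu_T^n-\kappa(\nabla_hp_h^n-R_hp_h^n),\nabla q)_T-\sum_{F\in\mathcal F_T}(\phi_{TF}(\delta_tu_F^n,p_h^n),q)_F=(g^n,q)_T.\tag{2}$$ (iii) For all $T$ and all $v_T\in P^k(T)^d$, $$(S_T\underline u_T^n-p_h^nI,\nabla_sv_T)_T-\sum_{F\in\mathcal F_T}(\Phi_{TF}(\underline u_T^n,p^n_{h|T}),v_T)_F=(f^n,v_T)_T;$$ (2) holds for all $T$ and all $q\in P^k(T)$; and, for every interface $F\subset\partial T_1\cap\partial T_2$, $$\Phi_{T_1F}(\underline u_{T_1}^n,p^n_{h|T_1})+\Phi_{T_2F}(\underline u_{T_2}^n,p^n_{h|T_2})=0,\qquad \phi_{T_1F}(\delta_tu_F^n,p_h^n)+\phi_{T_2F}(\delta_tu_F^n,p_h^n)=0.$$ -/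

import Mathlib

open MeasureTheory


noncomputable section

namespace BiotHHO

/-- Points of `ℝ^d`. -/
abbrev Pt (d : ℕ) := EuclideanSpace ℝ (Fin d)

/-! ### Polyhedra, outward normals, meshes -/

/-- A (bounded, open, not necessarily connected) polyhedron: its boundary is contained in a finite
union of hyperplanes, and it lies on only one side of its boundary. -/
structure IsPolyhedron {d : ℕ} (P : Set (Pt d)) : Prop where
  nonempty : P.Nonempty
  isOpen : IsOpen P
  isBounded : Bornology.IsBounded P
  frontier_subset : ∃ H : Finset (Pt d × ℝ), (∀ h ∈ H, h.1 ≠ 0) ∧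
    frontier P ⊆ ⋃ h ∈ H, {x | inner ℝ h.1 x = h.2}
  one_sided : interior (closure P) = P

/-- `n` is the unit normal to the hyperplanar set `F ⊆ ∂P` pointing out of `P`: the set `F` lies in
a hyperplane orthogonal to `n`, and near almost every point `x` of `F` (for the
`(d-1)`-dimensional Hausdorff measure) `P` is the half-space `{y | ⟪n, y - x⟫ < 0}`. -/
structure IsOutwardNormal {d : ℕ} (P F : Set (Pt d)) (n : Pt d) : Prop where
  norm_eq_one : ‖n‖ = 1
  hyperplane : ∃ c : ℝ, ∀ x ∈ F, inner ℝ n x = c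
  outward : ∀ᵐ x ∂((μHE[d - 1] : Measure (Pt d)).restrict F),
    ∃ r > 0, ∀ y ∈ Metric.ball x r, (y ∈ P ↔ inner ℝ n (y - x) < 0)

/-- A general polyhedral mesh of a bounded connected polyhedral domain `Ω ⊆ ℝ^d`, together with
its faces, the outward normals, and a fixed ordering of the two elements sharing an interface. -/
structure PolyMesh (d : ℕ) where
  Ω : Set (Pt d)
  Ω_polyhedron : IsPolyhedron Ω
  Ω_connected : IsConnected Ω
  /-- index set of the elements -/
  Elem : Type
  [elemFintype : Fintype Elem]
  cell : Elem → Set (Pt d)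
  cell_polyhedron : ∀ T, IsPolyhedron (cell T)
  cell_disjoint : ∀ T T', T ≠ T' → Disjoint (cell T) (cell T')
  closure_Ω : closure Ω = ⋃ T, closure (cell T)
  /-- index set of the faces -/
  Face : Type
  [faceFintype : Fintype Face]
  face : Face → Set (Pt d)
  face_closed : ∀ F, IsClosed (face F)
  face_connected : ∀ F, IsConnected (face F)
  face_hyperplane : ∀ F, ∃ (n : Pt d) (c : ℝ), n ≠ 0 ∧ ∀ x ∈ face F, inner ℝ n x = c
  face_pos : ∀ F, 0 < (μHE[d - 1] : Measure (Pt d)) (face F)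
  /-- every face is an interface or a boundary face -/
  face_cases : ∀ F,
    (∃ T₁ T₂, T₁ ≠ T₂ ∧ face F ⊆ frontier (cell T₁) ∩ frontier (cell T₂)) ∨
    (∃ T, face F ⊆ frontier (cell T) ∩ frontier Ω)
  /-- the boundary of each element is covered by the faces it contains -/
  frontier_cell : ∀ T, frontier (cell T) ⊆ ⋃ F : {F : Face // face F ⊆ frontier (cell T)}, face F
  /-- distinct faces overlap at most in a set of zero surface measure -/
  face_overlap : ∀ F F', F ≠ F' → (μHE[d - 1] : Measure (Pt d)) (face F ∩ face F') = 0
  /-- `normal T F` is the outward unit normal `n_{TF}` (relevant only if `F ⊆ ∂T`) -/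
  normal : Elem → Face → Pt d
  normal_spec : ∀ T F, face F ⊆ frontier (cell T) → IsOutwardNormal (cell T) (face F) (normal T F)
  /-- the elements `T₁`, `T₂` of an interface, in the fixed order; for a boundary face the first
  one is the element containing it in its boundary and the second one is irrelevant -/
  side₁ : Face → Elem
  side₂ : Face → Elem
  side₁_spec : ∀ F, face F ⊆ frontier (cell (side₁ F))
  side_spec : ∀ F,
    (∃ T₁ T₂, T₁ ≠ T₂ ∧ face F ⊆ frontier (cell T₁) ∩ frontier (cell T₂)) →
    side₁ F ≠ side₂ F ∧ face F ⊆ frontier (cell (side₂ F))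
  /-- the face size `h_F`: the diameter of the face if `d ≥ 2`; if `d = 1` (where faces are points)
  any positive number is allowed -/
  faceSize : Face → ℝ
  faceSize_pos : ∀ F, 0 < faceSize F
  faceSize_eq : 2 ≤ d → ∀ F, faceSize F = Metric.diam (face F)

attribute [instance] PolyMesh.elemFintype PolyMesh.faceFintype

/-! ### Polynomial spaces and `L²` products -/

/-- Polynomials in `d` variables of total degree at most `k`. Since mesh elements are nonempty and
open, this is (for each element `T`) the space `P^k(T)` of polynomial functions on `T`. -/
abbrev Poly (d k : ℕ) := MvPolynomial.restrictTotalDegree (Fin d) ℝ k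

/-- The value of a polynomial at a point. -/
def ev {d : ℕ} (q : MvPolynomial (Fin d) ℝ) (x : Pt d) : ℝ := MvPolynomial.eval (fun i => x i) q

/-- The restriction of polynomials to a set. -/
def traceOn {d : ℕ} (X : Set (Pt d)) : MvPolynomial (Fin d) ℝ →ₗ[ℝ] (X → ℝ) where
  toFun q := fun x => ev q x
  map_add' p q := by funext x; simp [ev]
  map_smul' c q := by funext x; simp [ev]

namespace PolyMesh

variable {d : ℕ} (M : PolyMesh d)

/-- The faces contained in the boundary of `T`. -/
abbrev FaceOf (T : M.Elem) := {F : M.Face // M.face F ⊆ frontier (M.cell T)}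

instance (T : M.Elem) : Fintype (M.FaceOf T) := Fintype.ofFinite _

/-- `F` is an interface. -/
def IsInterface (F : M.Face) : Prop :=
  ∃ T₁ T₂, T₁ ≠ T₂ ∧ M.face F ⊆ frontier (M.cell T₁) ∩ frontier (M.cell T₂)

/-- `F` is a boundary face. -/
def IsBoundaryFace (F : M.Face) : Prop :=
  ∃ T, M.face F ⊆ frontier (M.cell T) ∩ frontier M.Ω

abbrev Interface := {F : M.Face // M.IsInterface F}

instance : Fintype M.Interface := Fintype.ofFinite _

/-- `n_F`. -/
def faceNormal (F : M.Face) : Pt d := M.normal (M.side₁ F) F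

/-- `(p, q)_T` for functions on `ℝ^d`. -/
def cellInner (T : M.Elem) (p q : Pt d → ℝ) : ℝ := ∫ x in M.cell T, p x * q x

/-- `(φ, ψ)_F` for functions on the face `F`. -/
def faceInner (F : M.Face) (φ ψ : M.face F → ℝ) : ℝ :=
  ∫ x, φ x * ψ x ∂((μHE[d - 1] : Measure (Pt d)).comap Subtype.val)

/-- `P^k_{d-1}(F)`: the restrictions to the hyperplanar set `F` of polynomials of total degree at
most `k`. -/
def FacePoly (k : ℕ) (F : M.Face) : Submodule ℝ (M.face F → ℝ) :=
  (Poly d k).map (traceOn (M.face F))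

/-- The restriction to `F` of a polynomial of degree at most `k`. -/
def tr {k : ℕ} (F : M.Face) (q : Poly d k) : M.FacePoly k F :=
  ⟨traceOn (M.face F) q, Submodule.mem_map_of_mem q.2⟩

/-- The `L²(T)`-orthogonal projection on `P^k(T)`. -/
def projT (k : ℕ) (T : M.Elem) (v : Pt d → ℝ) : Poly d k :=
  Classical.epsilon fun w : Poly d k =>
    ∀ q : Poly d k, M.cellInner T (ev w) (ev q) = M.cellInner T v (ev q)

/-- The `L²(F)`-orthogonal projection on `P^k_{d-1}(F)`. -/
def projF (k : ℕ) (F : M.Face) (v : M.face F → ℝ) : M.FacePoly k F :=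
  Classical.epsilon fun w : M.FacePoly k F =>
    ∀ q : M.FacePoly k F, M.faceInner F w q = M.faceInner F v q

end PolyMesh

/-- The symmetric gradient `½ (∂ᵢ vⱼ + ∂ⱼ vᵢ)` of a vector-valued polynomial. -/
def symGrad {d : ℕ} (v : Fin d → MvPolynomial (Fin d) ℝ) :
    Matrix (Fin d) (Fin d) (MvPolynomial (Fin d) ℝ) :=
  fun i j => (1 / 2 : ℝ) • (MvPolynomial.pderiv i (v j) + MvPolynomial.pderiv j (v i))

/-- The skew-symmetric gradient `½ (∂ᵢ vⱼ - ∂ⱼ vᵢ)` of a vector-valued polynomial. -/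
def skewGrad {d : ℕ} (v : Fin d → MvPolynomial (Fin d) ℝ) :
    Matrix (Fin d) (Fin d) (MvPolynomial (Fin d) ℝ) :=
  fun i j => (1 / 2 : ℝ) • (MvPolynomial.pderiv i (v j) - MvPolynomial.pderiv j (v i))

/-- The divergence of a vector-valued polynomial. -/
def div {d : ℕ} (v : Fin d → MvPolynomial (Fin d) ℝ) : MvPolynomial (Fin d) ℝ :=
  ∑ i, MvPolynomial.pderiv i (v i)

/-- Forget the degree bound. -/
abbrev raw {d k : ℕ} (v : Fin d → Poly d k) : Fin d → MvPolynomial (Fin d) ℝ :=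
  fun i => (v i : MvPolynomial (Fin d) ℝ)

namespace PolyMesh

variable {d : ℕ} (M : PolyMesh d)

/-- `(σ, η)_T` for matrix-valued polynomials. -/
def cellInnerMat (T : M.Elem) (σ η : Matrix (Fin d) (Fin d) (MvPolynomial (Fin d) ℝ)) : ℝ :=
  ∑ i, ∑ j, M.cellInner T (ev (σ i j)) (ev (η i j))

/-- `(φ, ψ)_F` for vector-valued functions on a face. -/
def faceInnerVec (F : M.Face) (φ ψ : Fin d → M.face F → ℝ) : ℝ :=
  ∑ i, M.faceInner F (φ i) (ψ i)

/-- The restriction to `F` of `σ n`, for a matrix-valued polynomial `σ` and a vector `n`. -/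
def normalTrace (F : M.Face) (σ : Matrix (Fin d) (Fin d) (MvPolynomial (Fin d) ℝ)) (n : Pt d) :
    Fin d → M.face F → ℝ :=
  fun i x => ∑ j, ev (σ i j) x * n j

/-! ### Degrees of freedom -/

/-- `U_h^k`: element-based and face-based displacement unknowns. -/
abbrev Hybrid (k : ℕ) := (M.Elem → Fin d → Poly d k) × ((F : M.Face) → Fin d → M.FacePoly k F)

/-- `U_{∂T}^k = P^k_{d-1}(F_T)^d`. -/
abbrev BdryDof (k : ℕ) (T : M.Elem) := (F : M.FaceOf T) → Fin d → M.FacePoly k F.1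

/-- `U_T^k`. -/
abbrev LocalDof (k : ℕ) (T : M.Elem) := (Fin d → Poly d k) × M.BdryDof k T

/-- The restriction of a collection of unknowns to an element. -/
def toLocal {k : ℕ} (T : M.Elem) (v : M.Hybrid k) : M.LocalDof k T := (v.1 T, fun F => v.2 F.1)

/-- `U_{h,D}^k`: the displacement unknowns vanish on the boundary faces. -/
def HybridD (k : ℕ) : Submodule ℝ (M.Hybrid k) where
  carrier := {v | ∀ F, M.IsBoundaryFace F → v.2 F = 0}
  add_mem' {v w} hv hw F hF := by simp [hv F hF, hw F hF]
  zero_mem' _ _ := rfl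
  smul_mem' c v hv F hF := by simp [hv F hF]

/-- `P^k(T_h)`: broken polynomials. -/
abbrev Broken (k : ℕ) := M.Elem → Poly d k

/-- `P_h^k`: the pressure space, which consists of the broken polynomials, with zero average over
`Ω` if `c₀ = 0`. -/
def pressureSpace (k : ℕ) (c₀ : ℝ) : Set (M.Broken k) :=
  {q | c₀ = 0 → ∑ T, ∫ x in M.cell T, ev (q T) x = 0}

/-! ### Elasticity operator -/

section Local

variable {M} {k : ℕ} {T : M.Elem}

/-- The function `v_F - v_T` on the face `F`. -/
def diffF (v : M.LocalDof k T) (F : M.FaceOf T) : Fin d → M.face F.1 → ℝ :=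
  fun i x => (v.2 F i : M.face F.1 → ℝ) x - ev (d := d) (v.1 i) x

/-- The characterization of the displacement reconstruction `r_T v ∈ P^{k+1}(T)^d`. -/
def IsReconstruction (v : M.LocalDof k T) (r : Fin d → Poly d (k + 1)) : Prop :=
  (∀ w : Fin d → Poly d (k + 1),
    M.cellInnerMat T (symGrad (raw r)) (symGrad (raw w)) =
      M.cellInnerMat T (symGrad (raw v.1)) (symGrad (raw w)) +
      ∑ F : M.FaceOf T,
        M.faceInnerVec F.1 (diffF v F) (M.normalTrace F.1 (symGrad (raw w)) (M.normal T F.1))) ∧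
  (∀ i, ∫ x in M.cell T, ev (r i) x = ∫ x in M.cell T, ev (v.1 i) x) ∧
  (∀ i j, ∫ x in M.cell T, ev (skewGrad (raw r) i j) x =
    ∑ F : M.FaceOf T,
      ∫ x, (1 / 2 : ℝ) * (M.normal T F.1 i * (v.2 F j : M.face F.1 → ℝ) x
        - (v.2 F i : M.face F.1 → ℝ) x * M.normal T F.1 j)
        ∂((μHE[d - 1] : Measure (Pt d)).comap Subtype.val))

/-- The displacement reconstruction `r_T^k`. -/
def recT (v : M.LocalDof k T) : Fin d → Poly d (k + 1) := Classical.epsilon (IsReconstruction v)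

/-- The discrete divergence `D_T^k`. -/
def divT (v : M.LocalDof k T) : Poly d k :=
  Classical.epsilon fun D : Poly d k => ∀ q : Poly d k,
    M.cellInner T (ev D) (ev q) = M.cellInner T (ev (div (raw v.1))) (ev q) +
      ∑ F : M.FaceOf T,
        M.faceInnerVec F.1 (diffF v F) (fun i x => ev (d := d) q x
          * M.normal T F.1 i)

/-- The face residual `Δ_{TF}^k v = (π_F r_T v - v_F) - (π_T r_T v - v_T)`. -/
def resid (v : M.LocalDof k T) (F : M.FaceOf T) : Fin d → M.face F.1 → ℝ :=
  fun i x =>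
    ((M.projF k F.1 (traceOn (M.face F.1) (recT v i)) : M.face F.1 → ℝ) x
      - (v.2 F i : M.face F.1 → ℝ) x)
    - (ev (d := d) (M.projT k T (ev (recT v i))) x - ev (d := d) (v.1 i) x)

/-- The stabilization bilinear form `s_T`. -/
def stab (w v : M.LocalDof k T) : ℝ :=
  ∑ F : M.FaceOf T, (M.faceSize F.1)⁻¹ * M.faceInnerVec F.1 (resid w F) (resid v F)

/-- The local elasticity bilinear form `a_T`. -/
def aT (mu lam : ℝ) (w v : M.LocalDof k T) : ℝ :=
  2 * mu * (M.cellInnerMat T (symGrad (raw (recT w))) (symGrad (raw (recT v))) + stab w v)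
    + lam * M.cellInner T (ev (divT w)) (ev (divT v))

/-- The local coupling bilinear form `b_T`. -/
def bT (v : M.LocalDof k T) (q : Poly d k) : ℝ := - M.cellInner T (ev (divT v)) (ev q)

end Local

/-- The elasticity bilinear form `a_h`. -/
def ah {k : ℕ} (mu lam : ℝ) (w v : M.Hybrid k) : ℝ :=
  ∑ T, aT mu lam (M.toLocal T w) (M.toLocal T v)

/-- The hydro-mechanical coupling bilinear form `b_h`. -/
def bh {k : ℕ} (v : M.Hybrid k) (q : M.Broken k) : ℝ := ∑ T, bT (M.toLocal T v) (q T)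

/-! ### Darcy operator -/

/-- The jump on a face of a broken polynomial. -/
def jump (F : M.Face) (q : M.Elem → MvPolynomial (Fin d) ℝ) : M.face F → ℝ :=
  fun x => ev (q (M.side₁ F)) x - ev (q (M.side₂ F)) x

/-- The weighted average on a face of a broken polynomial. -/
def wavg (κ : M.Elem → ℝ) (F : M.Face) (q : M.Elem → MvPolynomial (Fin d) ℝ) : M.face F → ℝ :=
  fun x =>
    κ (M.side₂ F) / (κ (M.side₁ F) + κ (M.side₂ F)) * ev (q (M.side₁ F)) x +
    κ (M.side₁ F) / (κ (M.side₁ F) + κ (M.side₂ F)) * ev (q (M.side₂ F)) x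

/-- `{κ ξ}_ω · n` for a broken vector-valued polynomial `ξ`. -/
def wavgFlux (κ : M.Elem → ℝ) (F : M.Face) (ξ : M.Elem → Fin d → MvPolynomial (Fin d) ℝ)
    (n : Pt d) : M.face F → ℝ :=
  fun x => ∑ i, M.wavg κ F (fun T => κ T • ξ T i) x * n i

/-- `λ_{κ,F}`. -/
def lamF (κ : M.Elem → ℝ) (F : M.Face) : ℝ :=
  2 * κ (M.side₁ F) * κ (M.side₂ F) / (κ (M.side₁ F) + κ (M.side₂ F))

/-- The underlying family of polynomials of a broken polynomial. -/
abbrev rawB {k : ℕ} (q : M.Broken k) : M.Elem → MvPolynomial (Fin d) ℝ :=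
  fun T => (q T : MvPolynomial (Fin d) ℝ)

/-- The broken gradient. -/
def gradh {k : ℕ} (q : M.Broken k) : M.Elem → Fin d → MvPolynomial (Fin d) ℝ :=
  fun T i => MvPolynomial.pderiv i (q T : MvPolynomial (Fin d) ℝ)

/-- The Symmetric Weighted Interior Penalty bilinear form `c_h`. -/
def ch {k : ℕ} (κ : M.Elem → ℝ) (ς : ℝ) (r q : M.Broken k) : ℝ :=
  ∑ T, κ T * ∑ i, M.cellInner T (ev (M.gradh r T i)) (ev (M.gradh q T i))
  - ∑ F : M.Interface,
      (M.faceInner F.1 (M.wavgFlux κ F.1 (M.gradh r) (M.faceNormal F.1)) (M.jump F.1 (M.rawB q))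
      + M.faceInner F.1 (M.jump F.1 (M.rawB r)) (M.wavgFlux κ F.1 (M.gradh q) (M.faceNormal F.1)))
  + ∑ F : M.Interface, ς * M.lamF κ F.1 / M.faceSize F.1 *
      M.faceInner F.1 (M.jump F.1 (M.rawB r)) (M.jump F.1 (M.rawB q))

/-- The lifting `R_h q ∈ P^{k-1}(T_h)^d` of the jumps of `q`, defined through the `κ`-weighted
`L²` product. -/
def lift {k : ℕ} (κ : M.Elem → ℝ) (q : M.Broken k) : M.Elem → Fin d → Poly d (k - 1) :=
  Classical.epsilon fun R : M.Elem → Fin d → Poly d (k - 1) =>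
    ∀ ξ : M.Elem → Fin d → Poly d (k - 1),
      ∑ T, κ T * ∑ i, M.cellInner T (ev (R T i)) (ev (ξ T i)) =
      ∑ F : M.Interface, M.faceInner F.1 (M.jump F.1 (M.rawB q))
        (M.wavgFlux κ F.1 (fun T => raw (ξ T)) (M.faceNormal F.1))

/-! ### Operators of the flux formulation -/

section Flux

variable {M} {k : ℕ} {T : M.Elem}

/-- The boundary operator `L_T^k`. -/
def LT (φ : M.BdryDof k T) : M.BdryDof k T :=
  let r : Fin d → Poly d (k + 1) := recT ((0 : Fin d → Poly d k), φ)
  fun F i => M.projF k F.1 fun x =>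
    (φ F i : M.face F.1 → ℝ) x - ev (d := d) (r i) x + ev (d := d) (M.projT k T (ev (r i))) x

/-- `(φ, ψ)_{∂T}` on `U_{∂T}^k`. -/
def bdryInner (φ ψ : M.BdryDof k T) : ℝ :=
  ∑ F : M.FaceOf T, M.faceInnerVec F.1 (fun i => φ F i) (fun i => ψ F i)

/-- The adjoint `L_T^{k,*}` of `L_T^k`. -/
def LTstar (ψ : M.BdryDof k T) : M.BdryDof k T :=
  Classical.epsilon fun χ : M.BdryDof k T => ∀ φ : M.BdryDof k T,
    bdryInner (LT φ) ψ = bdryInner φ χ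

/-- The discrete stress operator `S_T^k v = 2μ ∇_s r_T v + λ I D_T v`. -/
def stress (mu lam : ℝ) (v : M.LocalDof k T) :
    Matrix (Fin d) (Fin d) (MvPolynomial (Fin d) ℝ) :=
  (2 * mu) • symGrad (raw (recT v)) +
    lam • Matrix.diagonal (fun _ => (divT v : MvPolynomial (Fin d) ℝ))

/-- `S_T^k v - q I`. -/
def totalStress (mu lam : ℝ) (v : M.LocalDof k T) (q : Poly d k) :
    Matrix (Fin d) (Fin d) (MvPolynomial (Fin d) ℝ) :=
  stress mu lam v - Matrix.diagonal (fun _ => (q : MvPolynomial (Fin d) ℝ))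

/-- The function `v_{∂T} - v_T` on the boundary of `T`, as an element of `U_{∂T}^k`. -/
def bdryDiff (v : M.LocalDof k T) : M.BdryDof k T := fun F i => v.2 F i - M.tr F.1 (v.1 i)

/-- The numerical traction `Φ_{TF}(v, q)`. -/
def traction (mu lam : ℝ) (v : M.LocalDof k T) (q : Poly d k) (F : M.FaceOf T) :
    Fin d → M.face F.1 → ℝ :=
  fun i x =>
    M.normalTrace F.1 (totalStress mu lam v q) (M.normal T F.1) i x
    + 2 * mu * (LTstar (fun F' i' => (M.faceSize F'.1)⁻¹ • LT (bdryDiff v) F' i') F i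
        : M.face F.1 → ℝ) x

open Classical in
/-- The numerical mass flux `φ_{TF}(v_F, q_h)`. -/
def massFlux (κ : M.Elem → ℝ) (ς : ℝ) (F : M.FaceOf T) (vF : Fin d → M.FacePoly k F.1)
    (q : M.Broken k) : M.face F.1 → ℝ :=
  if M.IsInterface F.1 then
    fun x =>
      (- ∑ i, (vF i : M.face F.1 → ℝ) x * M.normal T F.1 i)
      + M.wavgFlux κ F.1 (M.gradh q) (M.normal T F.1) x
      - ς * M.lamF κ F.1 / M.faceSize F.1 * M.jump F.1 (M.rawB q) x
        * inner ℝ (M.normal T F.1) (M.faceNormal F.1)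
  else 0

end Flux

end PolyMesh

/-! ### The discrete problem and its flux formulations -/

/-- The data of the discrete Biot problem on a given mesh. The permeability is constant on each
element. -/
structure BiotData {d : ℕ} (M : PolyMesh d) where
  mu : ℝ
  mu_pos : 0 < mu
  lam : ℝ
  lam_nonneg : 0 ≤ lam
  c₀ : ℝ
  c₀_nonneg : 0 ≤ c₀
  /-- permeability -/
  κ : M.Elem → ℝ
  κ_pos : ∀ T, 0 < κ T
  /-- penalty parameter -/
  ς : ℝ
  ς_pos : 0 < ς
  /-- final time -/
  tF : ℝ
  tF_pos : 0 < tF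
  /-- number of time steps -/
  N : ℕ
  N_pos : 0 < N
  /-- volumetric load -/
  f : ℝ → Pt d → Pt d
  /-- fluid source -/
  g : ℝ → Pt d → ℝ
  f_memLp : ∀ t ∈ Set.Icc 0 tF, MemLp (f t) 2 (volume.restrict M.Ω)
  g_memLp : ∀ t ∈ Set.Icc 0 tF, MemLp (g t) 2 (volume.restrict M.Ω)

namespace BiotData

open PolyMesh

variable {d : ℕ} {M : PolyMesh d} (B : BiotData M) {k : ℕ}

/-- The time step. -/
def τ : ℝ := B.tF / B.N

/-- The load at the discrete time `t^n = n τ`. -/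
def fn (n : ℕ) : Pt d → Pt d := B.f (n * B.τ)

/-- The source at the discrete time `t^n = n τ`. -/
def gn (n : ℕ) : Pt d → ℝ := B.g (n * B.τ)

/-- Backward differencing, for `n ≥ 1`. -/
def ddt {V : Type*} [AddCommGroup V] [Module ℝ V] (φ : ℕ → V) (n : ℕ) : V :=
  B.τ⁻¹ • (φ n - φ (n - 1))

/-- `(f^n, v_T)_T`. -/
def load (n : ℕ) (T : M.Elem) (v : Fin d → Poly d k) : ℝ :=
  ∑ i, M.cellInner T (fun x => B.fn n x i) (ev (v i))

/-- `(u^n, p^n)` solves the discrete Biot problem at the time step `n`. -/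
def IsSchemeSolution (u : ℕ → M.Hybrid k) (p : ℕ → M.Broken k) (n : ℕ) : Prop :=
  u n ∈ M.HybridD k ∧ p n ∈ M.pressureSpace k B.c₀ ∧
  (∀ v ∈ M.HybridD k,
    M.ah B.mu B.lam (u n) v + M.bh v (p n) = ∑ T, B.load n T (v.1 T)) ∧
  (∀ q : M.Broken k,
    ∑ T, B.c₀ * M.cellInner T (ev (B.ddt p n T)) (ev (q T)) - M.bh (B.ddt u n) q
      + M.ch B.κ B.ς (p n) q = ∑ T, M.cellInner T (B.gn n) (ev (q T)))

/-- The left-hand side of the mass balance in the element `T`, with test function `q`. -/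
def flowLhs (u : ℕ → M.Hybrid k) (p : ℕ → M.Broken k) (n : ℕ) (T : M.Elem) (q : Poly d k) : ℝ :=
  B.c₀ * M.cellInner T (ev (B.ddt p n T)) (ev q)
  - ∑ i, M.cellInner T
      (fun x => ev ((B.ddt u n).1 T i) x
        - B.κ T * (ev (M.gradh (p n) T i) x - ev (M.lift B.κ (p n) T i) x))
      (ev (MvPolynomial.pderiv i (q : MvPolynomial (Fin d) ℝ)))
  - ∑ F : M.FaceOf T,
      M.faceInner F.1 (massFlux B.κ B.ς F ((B.ddt u n).2 F.1) (p n)) (traceOn (M.face F.1) q)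

/-- The left-hand side of the mechanical balance in the element `T`, with test function `v`. -/
def mechLhs (u : ℕ → M.Hybrid k) (p : ℕ → M.Broken k) (n : ℕ) (T : M.Elem)
    (v : M.LocalDof k T) : ℝ :=
  M.cellInnerMat T (totalStress B.mu B.lam (M.toLocal T (u n)) (p n T)) (symGrad (raw v.1))
  + ∑ F : M.FaceOf T,
      M.faceInnerVec F.1 (traction B.mu B.lam (M.toLocal T (u n)) (p n T) F) (diffF v F)

/-- The mass balance holds in every element. -/
def LocalMassBalance (u : ℕ → M.Hybrid k) (p : ℕ → M.Broken k) (n : ℕ) : Prop :=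
  ∀ (T : M.Elem) (q : Poly d k), B.flowLhs u p n T q = M.cellInner T (B.gn n) (ev q)

/-- Flux formulation at the time step `n`: the mechanical balance is tested with all hybrid
functions that vanish on boundary faces and assembled over the elements, the mass balance holds
element by element. -/
def IsFluxSolution (u : ℕ → M.Hybrid k) (p : ℕ → M.Broken k) (n : ℕ) : Prop :=
  u n ∈ M.HybridD k ∧ p n ∈ M.pressureSpace k B.c₀ ∧
  (∀ v ∈ M.HybridD k, ∑ T, B.mechLhs u p n T (M.toLocal T v) = ∑ T, B.load n T (v.1 T)) ∧
  B.LocalMassBalance u p n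

/-- The mechanical equilibrium holds in every element:
`(S_T u_T - p I, ∇_s v_T)_T - ∑_F (Φ_{TF}, v_T)_F = (f, v_T)_T`. -/
def LocalEquilibrium (u : ℕ → M.Hybrid k) (p : ℕ → M.Broken k) (n : ℕ) : Prop :=
  ∀ (T : M.Elem) (v : Fin d → Poly d k),
    M.cellInnerMat T (totalStress B.mu B.lam (M.toLocal T (u n)) (p n T)) (symGrad (raw v))
    - ∑ F : M.FaceOf T,
        M.faceInnerVec F.1 (traction B.mu B.lam (M.toLocal T (u n)) (p n T) F)
          (fun i => traceOn (M.face F.1) (v i))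
    = B.load n T v

/-- The two numerical tractions sum to zero on every interface. -/
def TractionConservative (u : ℕ → M.Hybrid k) (p : ℕ → M.Broken k) (n : ℕ) : Prop :=
  ∀ (F : M.Face) (T₁ T₂ : M.Elem) (h₁ : M.face F ⊆ frontier (M.cell T₁))
    (h₂ : M.face F ⊆ frontier (M.cell T₂)), T₁ ≠ T₂ →
    traction B.mu B.lam (M.toLocal T₁ (u n)) (p n T₁) ⟨F, h₁⟩
      + traction B.mu B.lam (M.toLocal T₂ (u n)) (p n T₂) ⟨F, h₂⟩ = 0

/-- The two numerical mass fluxes sum to zero on every interface. -/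
def MassFluxConservative (u : ℕ → M.Hybrid k) (p : ℕ → M.Broken k) (n : ℕ) : Prop :=
  ∀ (F : M.Face) (T₁ T₂ : M.Elem) (h₁ : M.face F ⊆ frontier (M.cell T₁))
    (h₂ : M.face F ⊆ frontier (M.cell T₂)), T₁ ≠ T₂ →
    massFlux B.κ B.ς (T := T₁) ⟨F, h₁⟩ ((B.ddt u n).2 F) (p n)
      + massFlux B.κ B.ς (T := T₂) ⟨F, h₂⟩ ((B.ddt u n).2 F) (p n) = 0

/-- Element-wise flux formulation at the time step `n`: local mechanical equilibrium and local
mass balance with conservative numerical tractions and mass fluxes. -/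
def IsLocalFluxSolution (u : ℕ → M.Hybrid k) (p : ℕ → M.Broken k) (n : ℕ) : Prop :=
  u n ∈ M.HybridD k ∧ p n ∈ M.pressureSpace k B.c₀ ∧
  B.LocalEquilibrium u p n ∧ B.LocalMassBalance u p n ∧
  B.TractionConservative u p n ∧ B.MassFluxConservative u p n

end BiotData

end BiotHHO

end

/-!
# Flux formulation of the discrete Biot problem

The equivalence is integration by parts on each element followed by a reordering of face sums.

*Mechanics.* Testing the definitions of `r_T` and `D_T` with `r_T u_T`, `D_T u_T` and `p` turns the
volume part of `a_T` and `b_T` into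
`(S_T u_T - p I, ∇_s v_T)_T + ∑_F ((S_T u_T - p I) n, v_F - v_T)_F`.
The reconstruction is linear and preserves polynomials, so that the residual `Δ_{TF} v` is
`-(L_T (v_F - v_T))_F` (`resid_eq`), and the stabilization is moved onto `v_F - v_T` by the adjoint
of `L_T` (`stab_eq`). The sum of the two is `aT_add_bT`. Element unknowns and face unknowns can then
be tested separately, and the sum of the tractions from the two sides of an interface, being
polynomial on the face and orthogonal to all polynomials there, vanishes (`mechBalance_iff`).

*Flow.* Integrating `D_T` by parts (`divT_by_parts`) and replacing one of the consistency terms of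
`c_h` by the lifting (`lift_spec`), the scheme becomes the sum of the local mass balances once the
face terms of the mass fluxes are gathered interface by interface (`flow_eq_sum_flowLhs`). Pressure
test functions are discontinuous, so that the sum splits into the local balances.

*Ingredients.*
* The divergence theorem on a polyhedron with hyperplanar faces (`integral_lineDeriv_eq_sum_faces`).
  The integral of `x ↦ f (x + s e)` over `P` is differentiated at `s = 0`; it is an integral of `f`
  over a translate of `P`. The variation of the indicator of `P` lives on the sets swept by the
  faces; in oblique coordinates adapted to a face, with Jacobian `|⟪n, e⟫|`, it converges to the sign
  of `⟪n, e⟫` at every point near which `P` is a half-space, and dominated convergence gives the flux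
  through the face.
* A polynomial vanishing almost everywhere on a hyperplanar set of positive surface measure vanishes
  on it (`ev_eq_zero_of_ae_face`), so that the `L²(F)` product is definite on `P^k(F)`. All
  projections, reconstructions, liftings and adjoints then exist by the Riesz representation
  `exists_riesz`.
* The geometry of faces: two elements sharing a face have opposite normals (`normal_eq_neg`), a face
  is shared by at most two elements (`eq_or_eq_of_face_subset`), and an interface is never a boundary
  face (`IsInterface.not_isBoundaryFace`). Hence sums over element faces become sums over interfaces
  (`sum_faceOf_eq_sum_interface`).
-/

namespace BiotHHO

open Module Filter Topology

/-! ### Hyperplanes and oblique coordinates -/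

/-- The oblique coordinates `(y, t) ↦ c n + y + t e` attached to the hyperplane
`{x | ⟪n, x⟫ = c}` (for a unit vector `n`) and a direction `e`. -/
noncomputable def obliqueCoord {d : ℕ} (n : Pt d) (c : ℝ) (e : Pt d) (z : (ℝ ∙ n)ᗮ × ℝ) : Pt d :=
  c • n + (z.1 : Pt d) + z.2 • e

theorem continuous_obliqueCoord {d : ℕ} (n : Pt d) (c : ℝ) (e : Pt d) :
    Continuous (obliqueCoord n c e) := by
  unfold obliqueCoord; fun_prop

theorem inner_obliqueCoord {d : ℕ} {n : Pt d} (hn : ‖n‖ = 1) (c : ℝ) (e : Pt d)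
    (z : (ℝ ∙ n)ᗮ × ℝ) : inner ℝ n (obliqueCoord n c e z) = c + z.2 * inner ℝ n e := by
  have h : inner ℝ n (z.1 : Pt d) = 0 :=
    Submodule.mem_orthogonal_singleton_iff_inner_right.1 z.1.2
  simp [obliqueCoord, inner_add_right, inner_smul_right, h, hn]

theorem finrank_orthogonal_span_unit {d : ℕ} {n : Pt d} (hn : ‖n‖ = 1) :
    finrank ℝ (ℝ ∙ n)ᗮ = d - 1 := by
  have h := Submodule.finrank_add_finrank_orthogonal (ℝ ∙ n)
  rw [finrank_span_singleton (by rintro rfl; simp at hn), finrank_euclideanSpace_fin] at h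
  omega

/-- The surface measure on a hyperplane is the Lebesgue measure in Cartesian coordinates of the
hyperplane. -/
theorem measurePreserving_hyperplane {d : ℕ} {n : Pt d} (hn : ‖n‖ = 1) (c : ℝ) :
    MeasurePreserving (fun y : (ℝ ∙ n)ᗮ => c • n + (y : Pt d)) volume
      ((μHE[d - 1] : Measure (Pt d)).restrict {x | inner ℝ n x = c}) := by
  have hiso : Isometry (fun y : (ℝ ∙ n)ᗮ => c • n + (y : Pt d)) :=
    (isometry_add_left (c • n)).comp isometry_subtype_coe
  refine ⟨hiso.continuous.measurable, ?_⟩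
  have h := InnerProductSpace.euclideanHausdorffMeasure_eq_volume (V := (ℝ ∙ n)ᗮ)
  rw [finrank_orthogonal_span_unit hn] at h
  rw [← h, hiso.map_euclideanHausdorffMeasure]
  congr 1
  ext x
  simp only [Set.mem_range, Set.mem_ofPred_eq]
  constructor
  · rintro ⟨y, rfl⟩
    simpa [obliqueCoord] using inner_obliqueCoord hn c 0 (y, 0)
  · intro hx
    refine ⟨⟨x - c • n, ?_⟩, by simp⟩
    rw [Submodule.mem_orthogonal_singleton_iff_inner_right]
    simp [inner_sub_right, inner_smul_right, hn, hx]

theorem measurePreserving_obliqueCoord_self {d : ℕ} {n : Pt d} (hn : ‖n‖ = 1) (c : ℝ) :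
    MeasurePreserving (obliqueCoord n c n) volume volume := by
  have h1 := ((ℝ ∙ n).measurePreserving_measurableEquivProd (c • n)).symm
  rw [InnerProductSpace.euclideanHausdorffMeasure_eq_volume] at h1
  have h2 := (LinearIsometryEquiv.toSpanUnitSingleton (𝕜 := ℝ) n hn).measurePreserving
  have h3 := h2.prod (MeasurePreserving.id (volume : Measure (ℝ ∙ n)ᗮ))
  have h4 := h1.comp (h3.comp (Measure.measurePreserving_swap (μ := (volume : Measure (ℝ ∙ n)ᗮ))
    (ν := (volume : Measure ℝ))))
  have h5 : obliqueCoord n c n = ((ℝ ∙ n).measurableEquivProd (c • n)).symm ∘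
      Prod.map (LinearIsometryEquiv.toSpanUnitSingleton (𝕜 := ℝ) n hn) id ∘ Prod.swap := by
    funext z
    simp [obliqueCoord, Submodule.measurableEquivProd_symm_apply]
    abel
  rw [h5]
  exact h4

/-- The Jacobian of the oblique coordinates is `|⟪n, e⟫|`. -/
theorem map_obliqueCoord {d : ℕ} {n : Pt d} (hn : ‖n‖ = 1) (c : ℝ) {e : Pt d}
    (he : inner ℝ n e ≠ 0) :
    Measure.map (obliqueCoord n c e) volume =
      ENNReal.ofReal |(inner ℝ n e)⁻¹| • (volume : Measure (Pt d)) := by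
  -- the linear map fixing the directions of the hyperplane and sending `n` to `e`
  let f : Pt d →ₗ[ℝ] ℝ := (innerSL ℝ n).toLinearMap
  let A : Pt d →ₗ[ℝ] Pt d := LinearMap.transvection f (e - n)
  have hf : ∀ x, f x = inner ℝ n x := fun _ => rfl
  have hA : ∀ x, A x = x + f x • (e - n) := fun _ => rfl
  have hdet : LinearMap.det A = inner ℝ n e := by
    simp [A, LinearMap.transvection.det, hf, inner_sub_right, hn]
  have h1 := Measure.map_linearMap_addHaar_eq_smul_addHaar (volume : Measure (Pt d))
    (f := A) (by rwa [hdet])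
  have hAm : Measurable A := A.continuous_of_finiteDimensional.measurable
  have h2 : obliqueCoord n c e = (fun x => x + c • (n - e)) ∘ A ∘ obliqueCoord n c n := by
    funext z
    have h := inner_obliqueCoord hn c n z
    rw [real_inner_self_eq_norm_sq, hn] at h
    simp only [Function.comp, hA, hf, h]
    simp only [obliqueCoord]
    module
  rw [h2, ← Measure.map_map (by fun_prop)
    (hAm.comp (continuous_obliqueCoord n c n).measurable), ← Measure.map_map hAm
    (continuous_obliqueCoord n c n).measurable, (measurePreserving_obliqueCoord_self hn c).map_eq,
    h1, hdet, Measure.map_smul, map_add_right_eq_self]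

theorem integral_obliqueCoord {d : ℕ} {n : Pt d} (hn : ‖n‖ = 1) (c : ℝ) {e : Pt d}
    (he : inner ℝ n e ≠ 0) {g : Pt d → ℝ} (hg : Measurable g) :
    ∫ x, g x = |inner ℝ n e| * ∫ z, g (obliqueCoord n c e z) := by
  rw [← integral_map (continuous_obliqueCoord n c e).aemeasurable hg.aestronglyMeasurable,
    map_obliqueCoord hn c he, integral_smul_measure]
  have : |inner ℝ n e| ≠ 0 := by simpa using he
  rw [ENNReal.toReal_ofReal (abs_nonneg _), abs_inv, smul_eq_mul, mul_inv_cancel_left₀ this]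

/-- A segment joining a point of an open set to a point outside of it meets the boundary. -/
theorem exists_mem_frontier_of_segment {d : ℕ} {P : Set (Pt d)} (hP : IsOpen P) {x y : Pt d}
    (h : ¬ (x ∈ P ↔ y ∈ P)) : ∃ z ∈ segment ℝ x y, z ∈ frontier P := by
  by_contra! hcon
  have hcov : segment ℝ x y ⊆ P ∪ (closure P)ᶜ := by
    intro z hz
    have := hcon z hz
    rw [hP.frontier_eq] at this
    by_cases hzP : z ∈ P
    · exact Or.inl hzP
    · exact Or.inr fun hc => this ⟨hc, hzP⟩
  have hout : ∀ z ∈ segment ℝ x y, z ∉ P → z ∈ (closure P)ᶜ := fun z hz hzP =>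
    (hcov hz).resolve_left hzP
  have hpre := (convex_segment (𝕜 := ℝ) x y).isPreconnected P (closure P)ᶜ hP
    isClosed_closure.isOpen_compl hcov
  have hx := left_mem_segment ℝ x y
  have hy := right_mem_segment ℝ x y
  have hne : (segment ℝ x y ∩ P).Nonempty ∧ (segment ℝ x y ∩ (closure P)ᶜ).Nonempty := by
    by_cases hxP : x ∈ P
    · have hyP : y ∉ P := fun hyP => h ⟨fun _ => hyP, fun _ => hxP⟩
      exact ⟨⟨x, hx, hxP⟩, ⟨y, hy, hout y hy hyP⟩⟩
    · have hyP : y ∈ P := by by_contra hyP; exact h ⟨fun h => absurd h hxP, fun h => absurd h hyP⟩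
      exact ⟨⟨y, hy, hyP⟩, ⟨x, hx, hout x hx hxP⟩⟩
  obtain ⟨z, -, hz1, hz2⟩ := hpre hne.1 hne.2
  exact hz2 (subset_closure hz1)

/-! ### Translating a polyhedron -/

/-- The set swept by `F` when translated along the segment from `0` to `v`. -/
def sweep {d : ℕ} (F : Set (Pt d)) (v : Pt d) : Set (Pt d) :=
  {x | ∃ t ∈ Set.Icc (0 : ℝ) 1, x - t • v ∈ F}

theorem isCompact_sweep {d : ℕ} {F : Set (Pt d)} (hF : IsCompact F) (v : Pt d) :
    IsCompact (sweep F v) := by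
  have h : sweep F v = (fun z : Pt d × ℝ => z.1 + z.2 • v) '' (F ×ˢ Set.Icc 0 1) := by
    ext x
    constructor
    · rintro ⟨t, ht, hx⟩
      exact ⟨(x - t • v, t), ⟨hx, ht⟩, by simp⟩
    · rintro ⟨⟨y, t⟩, ⟨hy, ht⟩, rfl⟩
      exact ⟨t, ht, by simpa using hy⟩
  rw [h]
  exact (hF.prod isCompact_Icc).image (by fun_prop)

theorem volume_hyperplane_eq_zero {d : ℕ} {n : Pt d} (hn : ‖n‖ = 1) (c : ℝ) :
    volume {x : Pt d | inner ℝ n x = c} = 0 := by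
  have hm : MeasurableSet {x : Pt d | inner ℝ n x = c} :=
    (isClosed_eq (by fun_prop) continuous_const).measurableSet
  rw [← (measurePreserving_obliqueCoord_self hn c).measure_preimage hm.nullMeasurableSet]
  have h : obliqueCoord n c n ⁻¹' {x | inner ℝ n x = c} = Set.univ ×ˢ {0} := by
    ext z
    simp [inner_obliqueCoord hn, hn]
  rw [h]
  exact (Measure.prod_prod _ _).trans (by simp)

theorem volume_sweep_eq_zero {d : ℕ} {F : Set (Pt d)} {n : Pt d} (hn : ‖n‖ = 1) {c : ℝ}
    (hF : ∀ x ∈ F, inner ℝ n x = c) {v : Pt d} (hv : inner ℝ n v = 0) :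
    volume (sweep F v) = 0 := by
  refine measure_mono_null ?_ (volume_hyperplane_eq_zero hn c)
  rintro x ⟨t, -, hx⟩
  simpa [inner_sub_right, inner_smul_right, hv] using hF _ hx

/-- The surface measure on a subset of a hyperplane, in Cartesian coordinates of the
hyperplane. -/
theorem measurePreserving_restrict_hyperplane {d : ℕ} {F : Set (Pt d)} (hFm : MeasurableSet F)
    {n : Pt d} (hn : ‖n‖ = 1) {c : ℝ} (hF : ∀ x ∈ F, inner ℝ n x = c) :
    MeasurePreserving (fun y : (ℝ ∙ n)ᗮ => c • n + (y : Pt d))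
      (volume.restrict ((fun y : (ℝ ∙ n)ᗮ => c • n + (y : Pt d)) ⁻¹' F))
      ((μHE[d - 1] : Measure (Pt d)).restrict F) := by
  have h := (measurePreserving_hyperplane hn c).restrict_preimage hFm
  have hsub : F ⊆ {x | inner ℝ n x = c} := hF
  rwa [Measure.restrict_restrict hFm, Set.inter_eq_left.2 hsub] at h

/-- An integral over a swept set, in oblique coordinates: a point `x` of the hyperplane moved by
`t v` is swept by `F` exactly when `x ∈ F` and `0 ≤ t ≤ 1`. -/
theorem setIntegral_sweep {d : ℕ} {F : Set (Pt d)} (hFc : IsCompact F) {n : Pt d} (hn : ‖n‖ = 1)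
    {c : ℝ} (hF : ∀ x ∈ F, inner ℝ n x = c) {v : Pt d} (hv : inner ℝ n v ≠ 0) {g : Pt d → ℝ}
    (hg : Measurable g) :
    ∫ x in sweep F v, g x = |inner ℝ n v| *
      ∫ z in ((fun y : (ℝ ∙ n)ᗮ => c • n + (y : Pt d)) ⁻¹' F) ×ˢ Set.Icc (0 : ℝ) 1,
        g (obliqueCoord n c v z) := by
  have hm : MeasurableSet (sweep F v) := (isCompact_sweep hFc v).isClosed.measurableSet
  have hpre : obliqueCoord n c v ⁻¹' sweep F v =
      ((fun y : (ℝ ∙ n)ᗮ => c • n + (y : Pt d)) ⁻¹' F) ×ˢ Set.Icc (0 : ℝ) 1 := by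
    ext z
    have hz : obliqueCoord n c v z - z.2 • v = c • n + (z.1 : Pt d) := by simp [obliqueCoord]
    constructor
    · rintro ⟨t, ht, hx⟩
      have h1 := hF _ hx
      rw [inner_sub_right, inner_obliqueCoord hn, inner_smul_right] at h1
      have h2 : (z.2 - t) * inner ℝ n v = 0 := by linarith
      obtain rfl : z.2 = t := by
        rcases mul_eq_zero.1 h2 with h | h
        · linarith
        · exact absurd h hv
      rw [hz] at hx
      exact ⟨hx, ht⟩
    · rintro ⟨h1, h2⟩
      refine ⟨z.2, h2, ?_⟩
      rw [hz]
      exact h1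
  rw [← integral_indicator hm, integral_obliqueCoord hn c hv (hg.indicator hm), ← hpre,
    ← integral_indicator (hm.preimage (continuous_obliqueCoord n c v).measurable)]
  rfl

section SweepDensity

variable {d : ℕ} {ι : Type*} [Fintype ι]

/-- The number of members of the family `F` whose sweep along `v` contains `x`. -/
noncomputable def sweepCount (F : ι → Set (Pt d)) (v x : Pt d) : ℝ :=
  ∑ j, (sweep (F j) v).indicator (fun _ => (1 : ℝ)) x

/-- The variation `(1_P(x - v) - 1_P(x)) f(x)` under a translation of `P`, shared equally among the
faces sweeping over `x`. -/
noncomputable def sweepDensity (P : Set (Pt d)) (F : ι → Set (Pt d)) (f : Pt d → ℝ)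
    (v x : Pt d) : ℝ :=
  (P.indicator (fun _ => (1 : ℝ)) (x - v) - P.indicator (fun _ => (1 : ℝ)) x)
    * (sweepCount F v x)⁻¹ * f x

theorem measurable_sweepDensity {P : Set (Pt d)} (hP : IsOpen P) {F : ι → Set (Pt d)}
    (hF : ∀ j, IsCompact (F j)) {f : Pt d → ℝ} (hf : Continuous f) (v : Pt d) :
    Measurable (sweepDensity P F f v) := by
  have h1 : Measurable (P.indicator (fun _ => (1 : ℝ))) :=
    measurable_const.indicator hP.measurableSet
  have h2 : Measurable (sweepCount F v) :=
    Finset.measurable_fun_sum _ fun j _ =>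
      measurable_const.indicator (isCompact_sweep (hF j) v).isClosed.measurableSet
  exact (((h1.comp (measurable_id.sub_const v)).sub h1).mul h2.inv).mul hf.measurable

theorem sweepCount_eq_card (F : ι → Set (Pt d)) (v x : Pt d) :
    ∃ m : ℕ, sweepCount F v x = m ∧ (m = 0 ↔ ∀ j, x ∉ sweep (F j) v) := by
  classical
  refine ⟨(Finset.univ.filter fun j => x ∈ sweep (F j) v).card, ?_, ?_⟩
  · simp [sweepCount, Set.indicator_apply]
  · rw [Finset.card_eq_zero, Finset.filter_eq_empty_iff]
    simp

theorem abs_sweepDensity_le (P : Set (Pt d)) (F : ι → Set (Pt d)) (f : Pt d → ℝ) (v x : Pt d) :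
    |sweepDensity P F f v x| ≤ |f x| := by
  obtain ⟨m, hm, -⟩ := sweepCount_eq_card F v x
  have h1 : |P.indicator (fun _ => (1 : ℝ)) (x - v) - P.indicator (fun _ => (1 : ℝ)) x| ≤ 1 := by
    classical
    simp only [Set.indicator_apply]
    split_ifs <;> norm_num
  have h2 : |(sweepCount F v x)⁻¹| ≤ 1 := by
    rw [hm, abs_inv, Nat.abs_cast]
    exact Nat.cast_inv_le_one m
  rw [sweepDensity, abs_mul, abs_mul]
  have := mul_le_one₀ h1 (abs_nonneg _) h2
  exact mul_le_of_le_one_left (abs_nonneg _) this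

/-- The shares of the faces add up to the variation of `1_P f`: where the indicator of `P` changes,
the segment from `x` to `x - v` crosses the boundary, so that at least one face sweeps over `x`. -/
theorem sum_indicator_sweepDensity {P : Set (Pt d)} (hP : IsOpen P) {F : ι → Set (Pt d)}
    (hcov : frontier P ⊆ ⋃ j, F j) (f : Pt d → ℝ) (v x : Pt d) :
    ∑ j, (sweep (F j) v).indicator (sweepDensity P F f v) x =
      (P.indicator (fun _ => (1 : ℝ)) (x - v) - P.indicator (fun _ => (1 : ℝ)) x) * f x := by
  have h1 : ∑ j, (sweep (F j) v).indicator (sweepDensity P F f v) x =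
      sweepCount F v x * sweepDensity P F f v x := by
    simp only [sweepCount, Finset.sum_mul]
    refine Finset.sum_congr rfl fun j _ => ?_
    by_cases hx : x ∈ sweep (F j) v <;> simp [hx]
  obtain ⟨m, hm, hm0⟩ := sweepCount_eq_card F v x
  rw [h1, sweepDensity]
  by_cases h0 : sweepCount F v x = 0
  · have hnot := hm0.1 (by rw [h0] at hm; exact_mod_cast hm.symm)
    have hiff : x - v ∈ P ↔ x ∈ P := by
      by_contra hne
      obtain ⟨z, hz, hzP⟩ := exists_mem_frontier_of_segment hP hne
      obtain ⟨j, hj⟩ := Set.mem_iUnion.1 (hcov hzP)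
      rw [segment_symm, segment_eq_image'] at hz
      obtain ⟨t, ht, rfl⟩ := hz
      refine hnot j ⟨t, ht, ?_⟩
      have h : x - t • v = x + t • (x - v - x) := by module
      rw [h]
      exact hj
    rw [h0]
    by_cases hx : x ∈ P
    · simp [hx, hiff.2 hx]
    · simp [hx, mt hiff.1 hx]
  · field_simp

end SweepDensity

/-! ### The divergence theorem on polyhedra -/

theorem isCompact_preimage_hyperplane {d : ℕ} {F : Set (Pt d)} (hF : IsCompact F) (n : Pt d)
    (c : ℝ) : IsCompact ((fun y : (ℝ ∙ n)ᗮ => c • n + (y : Pt d)) ⁻¹' F) := by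
  have hiso : Isometry (fun y : (ℝ ∙ n)ᗮ => c • n + (y : Pt d)) :=
    (isometry_add_left (c • n)).comp isometry_subtype_coe
  exact hiso.isClosedEmbedding.isCompact_preimage hF

theorem hausdorff_lt_top_of_isCompact {d : ℕ} {F : Set (Pt d)} (hFc : IsCompact F) {n : Pt d}
    (hn : ‖n‖ = 1) {c : ℝ} (hF : ∀ x ∈ F, inner ℝ n x = c) :
    (μHE[d - 1] : Measure (Pt d)) F < ⊤ := by
  have h := measurePreserving_restrict_hyperplane hFc.isClosed.measurableSet hn hF
  have h1 := h.measure_preimage MeasurableSet.univ.nullMeasurableSet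
  simp only [Set.preimage_univ, Measure.restrict_apply_univ] at h1
  rw [← h1]
  exact (isCompact_preimage_hyperplane hFc n c).measure_lt_top

section Divergence

variable {d : ℕ} {ι : Type*} [Fintype ι]

/-- Near a point `x₀` of the face `F j` around which `P` is a half-space and which lies on no other
face, the translation of `P` along `s e` changes the indicator of `P` by the sign of `⟪n, e⟫` on
the segment from `x₀` to `x₀ + s e`. -/
theorem eventually_sweepDensity_eq {P : Set (Pt d)} {F : ι → Set (Pt d)}
    (hF : ∀ j, IsClosed (F j)) (f : Pt d → ℝ) {n e x₀ : Pt d} (he : inner ℝ n e ≠ 0) {j : ι}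
    (hx₀ : x₀ ∈ F j) (hother : ∀ i ≠ j, x₀ ∉ F i)
    (hhalf : ∃ r > 0, ∀ y ∈ Metric.ball x₀ r, (y ∈ P ↔ inner ℝ n (y - x₀) < 0)) {t : ℝ}
    (ht : t ∈ Set.Ioo (0 : ℝ) 1) :
    ∀ᶠ s in 𝓝[>] (0 : ℝ), sweepDensity P F f (s • e) (x₀ + t • s • e) =
      SignType.sign (inner ℝ n e) * f (x₀ + t • s • e) := by
  classical
  obtain ⟨r, hr, hball⟩ := hhalf
  have hopen : ∀ᶠ y in 𝓝 x₀, ∀ i, i ≠ j → y ∉ F i := by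
    rw [eventually_all]
    intro i
    by_cases hij : i = j
    · simp [hij]
    · filter_upwards [(hF i).isOpen_compl.mem_nhds (hother i hij)] with y hy _ using hy
  obtain ⟨ρ, hρ, hsep⟩ := Metric.eventually_nhds_iff_ball.1 hopen
  have hsmall : ∀ᶠ s in 𝓝[>] (0 : ℝ), s * ‖e‖ < min r ρ := by
    have hcont : Tendsto (fun s : ℝ => s * ‖e‖) (𝓝[>] 0) (𝓝 0) :=
      ((continuous_id.mul continuous_const).tendsto' 0 0 (by simp)).mono_left nhdsWithin_le_nhds
    exact hcont.eventually (gt_mem_nhds (lt_min hr hρ))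
  filter_upwards [hsmall, self_mem_nhdsWithin] with s hs hs0
  have hs0 : 0 < s := hs0
  have hnear : ∀ θ : ℝ, |θ| ≤ 1 → ‖(θ * s) • e‖ < min r ρ := by
    intro θ hθ
    rw [norm_smul, norm_mul, Real.norm_eq_abs, Real.norm_eq_abs, abs_of_pos hs0, mul_assoc]
    exact (mul_le_of_le_one_left (by positivity) hθ).trans_lt hs
  have hP : ∀ θ : ℝ, |θ| ≤ 1 → (x₀ + (θ * s) • e ∈ P ↔ θ * inner ℝ n e < 0) := by
    intro θ hθ
    rw [hball _ (by simpa using (hnear θ hθ).trans_le (min_le_left _ _)), add_sub_cancel_left,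
      inner_smul_right]
    constructor <;> intro h <;> nlinarith
  have hFi : ∀ θ : ℝ, |θ| ≤ 1 → ∀ i, i ≠ j → x₀ + (θ * s) • e ∉ F i := fun θ hθ =>
    hsep _ (by simpa using (hnear θ hθ).trans_le (min_le_right _ _))
  have hcount : sweepCount F (s • e) (x₀ + t • s • e) = 1 := by
    rw [sweepCount, Finset.sum_eq_single j]
    · rw [Set.indicator_of_mem]
      exact ⟨t, ⟨ht.1.le, ht.2.le⟩, by simpa using hx₀⟩
    · intro i _ hij
      rw [Set.indicator_of_notMem]
      rintro ⟨τ, hτ, hmem⟩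
      refine hFi (t - τ) ?_ i hij ?_
      · rw [abs_le]; constructor <;> linarith [hτ.1, hτ.2, ht.1, ht.2]
      · convert hmem using 1
        module
    · simp
  have h1 : x₀ + t • s • e ∈ P ↔ inner ℝ n e < 0 := by
    rw [smul_smul, hP t (by rw [abs_le]; constructor <;> linarith [ht.1, ht.2])]
    have := ht.1
    constructor <;> intro h <;> nlinarith
  have h2 : x₀ + t • s • e - s • e ∈ P ↔ 0 < inner ℝ n e := by
    have hrw : x₀ + t • s • e - s • e = x₀ + ((t - 1) * s) • e := by module
    rw [hrw, hP (t - 1) (by rw [abs_le]; constructor <;> linarith [ht.1, ht.2])]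
    have := ht.2
    constructor <;> intro h <;> nlinarith
  rw [sweepDensity, hcount]
  simp only [Set.indicator_apply, h1, h2]
  rcases lt_or_gt_of_ne he with h | h
  · simp [h, not_lt.2 h.le]
  · simp [h, not_lt.2 h.le]

/-- The contribution of one face to the derivative of the translated integral. -/
theorem tendsto_setIntegral_sweepDensity {P : Set (Pt d)} (hP : IsOpen P) {F : ι → Set (Pt d)}
    (hF : ∀ j, IsCompact (F j)) {f : Pt d → ℝ} (hf : Continuous f) (e : Pt d) {n : Pt d} {j : ι}
    (hn : IsOutwardNormal P (F j) n)
    (hoverlap : ∀ i ≠ j, (μHE[d - 1] : Measure (Pt d)) (F j ∩ F i) = 0) :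
    Tendsto (fun s : ℝ => s⁻¹ * ∫ x in sweep (F j) (s • e), sweepDensity P F f (s • e) x)
      (𝓝[>] 0) (𝓝 (inner ℝ n e * ∫ x in F j, f x ∂μHE[d - 1])) := by
  obtain ⟨hn1, ⟨c, hc⟩, hout⟩ := hn
  have hcm := (hF j).isClosed.measurableSet
  -- a face parallel to `e` sweeps a null set
  by_cases he : inner ℝ n e = 0
  · have h0 : ∀ s : ℝ, ∫ x in sweep (F j) (s • e), sweepDensity P F f (s • e) x = 0 := by
      intro s
      rw [Measure.restrict_eq_zero.2 (volume_sweep_eq_zero hn1 hc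
        (by rw [inner_smul_right, he, mul_zero])), integral_zero_measure]
    simp [h0, he]
  set F' := (fun y : (ℝ ∙ n)ᗮ => c • n + (y : Pt d)) ⁻¹' F j with hF'
  have hF'c : IsCompact F' := isCompact_preimage_hyperplane (hF j) n c
  have hpres := measurePreserving_restrict_hyperplane hcm hn1 hc
  set m : Measure ((ℝ ∙ n)ᗮ × ℝ) := volume.restrict (F' ×ˢ Set.Icc (0 : ℝ) 1) with hm
  have hmprod : m = (volume.restrict F').prod (volume.restrict (Set.Icc (0 : ℝ) 1)) :=
    (Measure.prod_restrict _ _).symm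
  have : IsFiniteMeasure (volume.restrict F') := ⟨by simpa using hF'c.measure_lt_top⟩
  have : IsFiniteMeasure m := by rw [hmprod]; infer_instance
  have hlim : Tendsto (fun s : ℝ => ∫ z, sweepDensity P F f (s • e) (obliqueCoord n c (s • e) z) ∂m)
      (𝓝[>] 0) (𝓝 (∫ z, SignType.sign (inner ℝ n e) * f (c • n + (z.1 : Pt d)) ∂m)) := by
    obtain ⟨C, hC⟩ := ((isCompact_sweep (hF j) e).union
      ((hF j).add ((isCompact_closedBall (0 : Pt d) ‖e‖)))).exists_bound_of_continuousOn
      hf.continuousOn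
    refine tendsto_integral_filter_of_dominated_convergence (fun _ => C) ?_ ?_
      (integrable_const C) ?_
    · exact Eventually.of_forall fun s => ((measurable_sweepDensity hP hF hf _).comp
        (continuous_obliqueCoord n c _).measurable).aestronglyMeasurable
    · have h1 : ∀ᶠ s in 𝓝[>] (0 : ℝ), s < 1 :=
        nhdsWithin_le_nhds (gt_mem_nhds zero_lt_one)
      filter_upwards [h1, self_mem_nhdsWithin] with s hs1 (hs0 : 0 < s)
      filter_upwards [ae_restrict_mem (hF'c.isClosed.measurableSet.prod measurableSet_Icc)]
        with z hz
      refine (abs_sweepDensity_le _ _ _ _ _).trans (hC _ (Or.inr ?_))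
      refine Set.add_mem_add hz.1 ?_
      rw [mem_closedBall_zero_iff, norm_smul, norm_smul, Real.norm_eq_abs, Real.norm_eq_abs,
        abs_of_nonneg hz.2.1, abs_of_pos hs0, ← mul_assoc]
      exact mul_le_of_le_one_left (norm_nonneg _) (mul_le_one₀ hz.2.2 hs0.le hs1.le)
    · have hgood : ∀ᵐ x ∂((μHE[d - 1] : Measure (Pt d)).restrict (F j)),
          (∃ r > 0, ∀ y ∈ Metric.ball x r, (y ∈ P ↔ inner ℝ n (y - x) < 0)) ∧
            ∀ i, i ≠ j → x ∉ F i := by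
        refine hout.and (ae_all_iff.2 fun i => ?_)
        by_cases hij : i = j
        · simp [hij]
        · have h := hoverlap i hij
          rw [Set.inter_comm, ← Measure.restrict_apply (hF i).isClosed.measurableSet] at h
          filter_upwards [measure_eq_zero_iff_ae_notMem.1 h] with x hx _ using hx
      have hgood' : ∀ᵐ z ∂m, (∃ r > 0, ∀ y ∈ Metric.ball (c • n + (z.1 : Pt d)) r,
          (y ∈ P ↔ inner ℝ n (y - (c • n + (z.1 : Pt d))) < 0)) ∧
            ∀ i, i ≠ j → c • n + (z.1 : Pt d) ∉ F i := by
        rw [hmprod]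
        exact Measure.quasiMeasurePreserving_fst.ae (hpres.quasiMeasurePreserving.ae hgood)
      have hIoo : ∀ᵐ z ∂m, z.2 ∈ Set.Ioo (0 : ℝ) 1 := by
        rw [hmprod, ← restrict_Ioo_eq_restrict_Icc]
        exact Measure.quasiMeasurePreserving_snd.ae (ae_restrict_mem measurableSet_Ioo)
      filter_upwards [hgood', hIoo,
        ae_restrict_mem (hF'c.isClosed.measurableSet.prod measurableSet_Icc)] with z hz1 hz2 hz3
      have hev := eventually_sweepDensity_eq (fun i => (hF i).isClosed) f he hz3.1 hz1.2 hz1.1 hz2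
      refine Tendsto.congr' (hev.mono fun s hs => hs.symm) ?_
      refine (Continuous.tendsto' (by fun_prop) 0 _ (by simp)).mono_left nhdsWithin_le_nhds
  have hval : |inner ℝ n e| * ∫ z, SignType.sign (inner ℝ n e) * f (c • n + (z.1 : Pt d)) ∂m =
      inner ℝ n e * ∫ x in F j, f x ∂μHE[d - 1] := by
    have hint : ∫ z, f (c • n + (z.1 : Pt d)) ∂m = ∫ x in F j, f x ∂μHE[d - 1] := by
      rw [hmprod, integral_fun_fst (fun y : (ℝ ∙ n)ᗮ => f (c • n + (y : Pt d)))]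
      rw [← hpres.map_eq, integral_map hpres.measurable.aemeasurable
        hf.measurable.aestronglyMeasurable]
      simp [hF']
    rw [integral_const_mul, ← mul_assoc, abs_mul_sign, hint]
  rw [← hval]
  refine Tendsto.congr' ?_ (hlim.const_mul _)
  filter_upwards [self_mem_nhdsWithin] with s (hs : 0 < s)
  have hse : inner ℝ n (s • e) ≠ 0 := by
    rw [inner_smul_right]; exact mul_ne_zero hs.ne' he
  rw [setIntegral_sweep (hF j) hn1 hc hse (measurable_sweepDensity hP hF hf _), inner_smul_right,
    abs_mul, abs_of_pos hs, mul_assoc, inv_mul_cancel_left₀ hs.ne']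

/-- **Divergence theorem** on a polyhedron, in a fixed direction `e`. -/
theorem integral_lineDeriv_eq_sum_faces {P : Set (Pt d)} (hP : IsOpen P)
    (hPb : Bornology.IsBounded P) {F : ι → Set (Pt d)} (hF : ∀ j, IsCompact (F j))
    (hcov : frontier P ⊆ ⋃ j, F j) {n : ι → Pt d} (hn : ∀ j, IsOutwardNormal P (F j) (n j))
    (hoverlap : ∀ j, ∀ i ≠ j, (μHE[d - 1] : Measure (Pt d)) (F j ∩ F i) = 0)
    {f f' : Pt d → ℝ} {e : Pt d} (hf : Continuous f) (hf' : Continuous f')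
    (hderiv : ∀ x, HasLineDerivAt ℝ f (f' x) x e) :
    ∫ x in P, f' x = ∑ j, inner ℝ (n j) e * ∫ x in F j, f x ∂μHE[d - 1] := by
  have hder : ∀ (x : Pt d) (s : ℝ), HasDerivAt (fun s : ℝ => f (x + s • e)) (f' (x + s • e)) s := by
    intro x s
    have h := hderiv (x + s • e)
    rw [HasLineDerivAt] at h
    have h2 : HasDerivAt (fun t : ℝ => f (x + s • e + (t - s) • e)) (f' (x + s • e)) s :=
      HasDerivAt.comp_sub_const (f := fun t : ℝ => f (x + s • e + t • e)) s s (by simpa using h)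
    have h3 : (fun t : ℝ => f (x + t • e)) = fun t : ℝ => f (x + s • e + (t - s) • e) := by
      funext t
      congr 1
      module
    rwa [h3]
  have hfin : volume P < ⊤ := hPb.measure_lt_top
  have : IsFiniteMeasure (volume.restrict P) := ⟨by simpa using hfin⟩
  obtain ⟨R, hR⟩ := hPb.subset_closedBall 0
  have hintg : ∀ g : Pt d → ℝ, Continuous g → IntegrableOn g P := fun g hg =>
    (hg.continuousOn.integrableOn_compact (isCompact_closedBall 0 R)).mono_set hR
  -- the left-hand side is the derivative at `0` of the integral over the translates of `P`
  have hleft : Tendsto (fun s : ℝ => s⁻¹ * ((∫ x in P, f (x + s • e)) - ∫ x in P, f x))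
      (𝓝[>] 0) (𝓝 (∫ x in P, f' x)) := by
    obtain ⟨C, hC⟩ := ((isCompact_closedBall (0 : Pt d) R).add
      (isCompact_closedBall (0 : Pt d) ‖e‖)).exists_bound_of_continuousOn hf'.continuousOn
    have h := (hasDerivAt_integral_of_dominated_loc_of_deriv_le (μ := volume.restrict P)
      (F := fun s x => f (x + s • e)) (F' := fun s x => f' (x + s • e)) (x₀ := (0 : ℝ))
      (bound := fun _ => C) (Metric.ball_mem_nhds 0 one_pos)
      (Eventually.of_forall fun s =>
        (by fun_prop : Continuous fun x => f (x + s • e)).aestronglyMeasurable)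
      (by simpa [IntegrableOn] using hintg f hf)
      (by fun_prop : Continuous fun x => f' (x + (0 : ℝ) • e)).aestronglyMeasurable
      (by
        filter_upwards [ae_restrict_mem hP.measurableSet] with x hx s hs
        refine hC _ (Set.add_mem_add (hR hx) ?_)
        rw [mem_closedBall_zero_iff, norm_smul]
        exact mul_le_of_le_one_left (norm_nonneg _) (by simpa using (Metric.mem_ball.1 hs).le))
      (integrable_const C)
      (Eventually.of_forall fun x s _ => hder x s)).2
    have h2 := h.hasDerivWithinAt (s := Set.Ioi 0)
    rw [hasDerivWithinAt_iff_tendsto_slope' (by simp)] at h2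
    simpa [slope_fun_def, smul_eq_mul] using h2
  have hright : Tendsto (fun s : ℝ => ∑ j, s⁻¹ * ∫ x in sweep (F j) (s • e),
      sweepDensity P F f (s • e) x) (𝓝[>] 0)
      (𝓝 (∑ j, inner ℝ (n j) e * ∫ x in F j, f x ∂μHE[d - 1])) :=
    tendsto_finsetSum _ fun j _ =>
      tendsto_setIntegral_sweepDensity hP hF hf e (hn j) (hoverlap j)
  refine tendsto_nhds_unique hleft (hright.congr fun s => ?_)
  rw [← Finset.mul_sum]
  congr 1
  have hint : ∀ j, IntegrableOn (sweepDensity P F f (s • e)) (sweep (F j) (s • e)) := by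
    intro j
    refine Integrable.mono' (g := fun x => |f x|) ?_
      (measurable_sweepDensity hP hF hf _).aestronglyMeasurable
      (Eventually.of_forall fun x => abs_sweepDensity_le _ _ _ _ _)
    exact (hf.abs.continuousOn.integrableOn_compact (isCompact_sweep (hF j) _))
  have hsm : ∀ j, MeasurableSet (sweep (F j) (s • e)) := fun j =>
    (isCompact_sweep (hF j) _).isClosed.measurableSet
  have h1 : ∑ j, ∫ x in sweep (F j) (s • e), sweepDensity P F f (s • e) x =
      ∫ x, (P.indicator (fun _ => (1 : ℝ)) (x - s • e) -
        P.indicator (fun _ => (1 : ℝ)) x) * f x := by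
    simp_rw [← integral_indicator (hsm _)]
    rw [← integral_finsetSum _ fun j _ => (hint j).integrable_indicator (hsm j)]
    exact integral_congr_ae (Eventually.of_forall fun x =>
      sum_indicator_sweepDensity hP hcov f (s • e) x)
  have hind : ∀ (g : Pt d → ℝ) x, P.indicator (fun _ => (1 : ℝ)) x * g x = P.indicator g x := by
    intro g x
    by_cases hx : x ∈ P <;> simp [hx]
  have h2 : Integrable (fun x => P.indicator (fun _ => (1 : ℝ)) x * f (x + s • e)) := by
    simp_rw [hind fun x => f (x + s • e)]
    exact (hintg _ (by fun_prop)).integrable_indicator hP.measurableSet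
  have h3 : Integrable (fun x => P.indicator (fun _ => (1 : ℝ)) (x - s • e) * f x) := by
    simpa using h2.comp_sub_right (s • e)
  have h4 : Integrable (fun x => P.indicator (fun _ => (1 : ℝ)) x * f x) := by
    simp_rw [hind f]
    exact (hintg _ hf).integrable_indicator hP.measurableSet
  rw [h1]
  simp_rw [sub_mul]
  rw [integral_sub h3 h4]
  congr 1
  · have h5 := integral_sub_right_eq_self (μ := (volume : Measure (Pt d)))
      (fun x => P.indicator (fun _ => (1 : ℝ)) x * f (x + s • e)) (s • e)
    simp only [sub_add_cancel] at h5
    rw [h5]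
    simp_rw [hind fun x => f (x + s • e)]
    exact integral_indicator hP.measurableSet
  · simp_rw [hind f]
    exact integral_indicator hP.measurableSet

end Divergence

/-! ### Null sets and zeros of polynomials -/

section Zeros

variable {E : Type*} [NormedAddCommGroup E] [NormedSpace ℝ E] [MeasurableSpace E] [BorelSpace E]
  [FiniteDimensional ℝ E]

/-- A set avoiding the origin that meets every ray in a countable set is Lebesgue null (integration
in polar coordinates). -/
theorem measure_eq_zero_of_countable_rays (μ : Measure E) [μ.IsAddHaarMeasure] {Z : Set E}
    (hZ : MeasurableSet Z) (h0 : (0 : E) ∉ Z)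
    (hray : ∀ v : E, v ≠ 0 → {t : ℝ | t • v ∈ Z}.Countable) :
    μ Z = 0 := by
  have hpres := (Measure.measurePreserving_homeomorphUnitSphereProd μ).symm
    (homeomorphUnitSphereProd E).toMeasurableEquiv
  have hm : MeasurableSet ((↑) ⁻¹' Z : Set ({0}ᶜ : Set E)) := hZ.preimage measurable_subtype_coe
  have h1 : μ Z = μ.comap (↑) ((↑) ⁻¹' Z : Set ({0}ᶜ : Set E)) := by
    rw [comap_subtype_coe_apply (measurableSet_singleton _).compl, Subtype.image_preimage_coe,
      Set.inter_eq_right.2]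
    rintro x hx rfl
    exact h0 hx
  rw [h1, ← hpres.measure_preimage hm.nullMeasurableSet,
    Measure.measure_prod_null (hpres.measurable hm)]
  refine Eventually.of_forall fun ω => ?_
  refine withDensity_absolutelyContinuous _ _ ?_
  rw [comap_subtype_coe_apply measurableSet_Ioi]
  refine ((hray ω ?_).mono ?_).measure_zero _
  · intro h
    have := ω.2
    rw [mem_sphere_zero_iff_norm, h, norm_zero] at this
    exact zero_ne_one this
  · rintro _ ⟨r, hr, rfl⟩
    exact hr

/-- A function that is polynomial along all lines through a point where it does not vanish is
nonzero almost everywhere. -/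
theorem measure_zeros_eq_zero_of_polynomial_lines (μ : Measure E) [μ.IsAddHaarMeasure] {g : E → ℝ}
    (hg : Continuous g) {x₀ : E} (hx₀ : g x₀ ≠ 0)
    (hpoly : ∀ v, ∃ Q : Polynomial ℝ, ∀ t : ℝ, g (x₀ + t • v) = Q.eval t) :
    μ {x | g x = 0} = 0 := by
  rw [← measure_preimage_add μ x₀]
  refine measure_eq_zero_of_countable_rays μ
    ((isClosed_eq (hg.comp (continuous_const_add x₀)) continuous_const).measurableSet)
    (by simpa using hx₀) fun v _ => ?_
  obtain ⟨Q, hQ⟩ := hpoly v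
  have hQ0 : Q ≠ 0 := by
    rintro rfl
    exact hx₀ (by simpa using hQ 0)
  refine ((Q.rootSet_finite ℝ).subset fun t ht => ?_).countable
  rw [Polynomial.mem_rootSet]
  refine ⟨hQ0, ?_⟩
  rw [Polynomial.coe_aeval_eq_eval, ← hQ t]
  exact ht

end Zeros

/-! ### Polynomial functions -/

section Ev

variable {d : ℕ}

@[simp] theorem ev_add (p q : MvPolynomial (Fin d) ℝ) (x : Pt d) :
    ev (p + q) x = ev p x + ev q x := by simp [ev]

@[simp] theorem ev_sub (p q : MvPolynomial (Fin d) ℝ) (x : Pt d) :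
    ev (p - q) x = ev p x - ev q x := by simp [ev]

@[simp] theorem ev_mul (p q : MvPolynomial (Fin d) ℝ) (x : Pt d) :
    ev (p * q) x = ev p x * ev q x := by simp [ev]

@[simp] theorem ev_smul (c : ℝ) (q : MvPolynomial (Fin d) ℝ) (x : Pt d) :
    ev (c • q) x = c * ev q x := by simp [ev]

@[simp] theorem ev_zero (x : Pt d) : ev (0 : MvPolynomial (Fin d) ℝ) x = 0 := by simp [ev]

@[simp] theorem ev_one (x : Pt d) : ev (1 : MvPolynomial (Fin d) ℝ) x = 1 := by simp [ev]

@[simp] theorem ev_C (c : ℝ) (x : Pt d) : ev (MvPolynomial.C c) x = c := by simp [ev]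

@[simp] theorem ev_X (i : Fin d) (x : Pt d) : ev (MvPolynomial.X i) x = x i := by simp [ev]

@[simp] theorem ev_sum {ι : Type*} (s : Finset ι) (q : ι → MvPolynomial (Fin d) ℝ) (x : Pt d) :
    ev (∑ j ∈ s, q j) x = ∑ j ∈ s, ev (q j) x := by simp [ev]

theorem continuous_ev (q : MvPolynomial (Fin d) ℝ) : Continuous (ev q) := by
  induction q using MvPolynomial.induction_on with
  | C a => simpa [funext (ev_C a)] using continuous_const
  | add p q hp hq => simpa [funext (ev_add p q)] using hp.fun_add hq
  | mul_X p i hp =>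
    have h : ev (p * MvPolynomial.X i) = fun x => ev p x * x i := by funext x; simp
    rw [h]
    exact hp.mul (by fun_prop)

theorem hasLineDerivAt_ev (q : MvPolynomial (Fin d) ℝ) (i : Fin d) (x : Pt d) :
    HasLineDerivAt ℝ (ev q) (ev (MvPolynomial.pderiv i q) x) x (EuclideanSpace.single i 1) := by
  rw [HasLineDerivAt]
  induction q using MvPolynomial.induction_on with
  | C a => simpa using hasDerivAt_const (0 : ℝ) a
  | add p q hp hq => simpa using hp.fun_add hq
  | mul_X p j hp =>
    have hX : HasDerivAt (fun t : ℝ => ev (MvPolynomial.X j) (x + t • EuclideanSpace.single i 1))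
        (ev (MvPolynomial.pderiv i (MvPolynomial.X j)) x) 0 := by
      by_cases hij : j = i
      · subst hij
        simpa using (hasDerivAt_id (0 : ℝ)).const_add (x j)
      · simpa [hij, MvPolynomial.pderiv_X_of_ne hij] using hasDerivAt_const (0 : ℝ) (x j)
    have h := hp.fun_mul hX
    simp only [← ev_mul] at h
    refine h.congr_deriv ?_
    simp only [Derivation.leibniz, smul_eq_mul, ev_add, ev_mul, zero_smul, add_zero]
    ring

theorem exists_polynomial_ev_line (q : MvPolynomial (Fin d) ℝ) (x v : Pt d) :
    ∃ Q : Polynomial ℝ, ∀ t : ℝ, ev q (x + t • v) = Q.eval t := by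
  induction q using MvPolynomial.induction_on with
  | C a => exact ⟨Polynomial.C a, by simp⟩
  | add p q hp hq =>
    obtain ⟨P, hP⟩ := hp
    obtain ⟨Q, hQ⟩ := hq
    exact ⟨P + Q, fun t => by rw [ev_add, hP, hQ, Polynomial.eval_add]⟩
  | mul_X p i hp =>
    obtain ⟨P, hP⟩ := hp
    refine ⟨P * (Polynomial.C (x i) + Polynomial.X * Polynomial.C (v i)), fun t => ?_⟩
    rw [ev_mul, hP]
    simp [mul_comm t]

/-- A polynomial that vanishes almost everywhere on a hyperplanar set of positive surface measure
vanishes on the whole hyperplane. -/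
theorem ev_eq_zero_of_ae_face {F : Set (Pt d)} (hFm : MeasurableSet F)
    (hpos : 0 < (μHE[d - 1] : Measure (Pt d)) F) {n : Pt d} (hn : ‖n‖ = 1) {c : ℝ}
    (hF : ∀ x ∈ F, inner ℝ n x = c) {q : MvPolynomial (Fin d) ℝ}
    (hq : ∀ᵐ x ∂((μHE[d - 1] : Measure (Pt d)).restrict F), ev q x = 0) :
    ∀ x ∈ F, ev q x = 0 := by
  intro x hx
  have hpres := measurePreserving_restrict_hyperplane hFm hn hF
  set F' := (fun y : (ℝ ∙ n)ᗮ => c • n + (y : Pt d)) ⁻¹' F with hF'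
  have hvol : volume F' ≠ 0 := by
    have h1 := hpres.measure_preimage MeasurableSet.univ.nullMeasurableSet
    simp only [Set.preimage_univ, Measure.restrict_apply_univ] at h1
    rw [h1]
    exact hpos.ne'
  have hae : ∀ᵐ y : (ℝ ∙ n)ᗮ, y ∈ F' → ev q (c • n + (y : Pt d)) = 0 := by
    rw [← ae_restrict_iff' (hpres.measurable hFm)]
    exact hpres.quasiMeasurePreserving.ae hq
  by_contra hne
  have hy : x - c • n ∈ (ℝ ∙ n)ᗮ := by
    rw [Submodule.mem_orthogonal_singleton_iff_inner_right]
    simp [inner_sub_right, inner_smul_right, hn, hF x hx]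
  have hnull := measure_zeros_eq_zero_of_polynomial_lines (volume : Measure (ℝ ∙ n)ᗮ)
    (g := fun y => ev q (c • n + (y : Pt d))) ((continuous_ev q).comp (by fun_prop))
    (x₀ := ⟨x - c • n, hy⟩) (by simpa using hne) fun v => by
      obtain ⟨Q, hQ⟩ := exists_polynomial_ev_line q x v
      refine ⟨Q, fun t => ?_⟩
      rw [← hQ t]
      congr 1
      simp
      abel
  refine hvol (measure_mono_null_ae ?_ hnull)
  filter_upwards [hae] with y hy hyF using hy hyF

/-- A polynomial vanishing on a nonempty open set is zero. -/
theorem eq_zero_of_ev_eq_zero_of_isOpen {U : Set (Pt d)} (hU : IsOpen U) (hne : U.Nonempty)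
    {q : MvPolynomial (Fin d) ℝ} (hq : ∀ x ∈ U, ev q x = 0) : q = 0 := by
  have hall : ∀ x, ev q x = 0 := by
    by_contra! h
    obtain ⟨x₀, hx₀⟩ := h
    have h1 := measure_zeros_eq_zero_of_polynomial_lines (volume : Measure (Pt d))
      (continuous_ev q) hx₀ (exists_polynomial_ev_line q x₀)
    exact (hU.measure_pos volume hne).ne' (measure_mono_null (fun x hx => hq x hx) h1)
  exact MvPolynomial.funext fun x => by simpa [ev] using hall (WithLp.toLp 2 x)

end Ev

/-! ### Riesz representation -/

/-- Riesz representation for a positive semidefinite form on a finite-dimensional space: every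
linear form vanishing on the kernel of the form is represented. -/
theorem exists_riesz {V : Type*} [AddCommGroup V] [Module ℝ V] [FiniteDimensional ℝ V]
    (B : V → V → ℝ) (hcomm : ∀ v w, B v w = B w v) (hadd : ∀ u v w, B u (v + w) = B u v + B u w)
    (hsmul : ∀ (c : ℝ) v w, B v (c • w) = c * B v w) (ℓ : V → ℝ)
    (hℓadd : ∀ v w, ℓ (v + w) = ℓ v + ℓ w) (hℓsmul : ∀ (c : ℝ) v, ℓ (c • v) = c * ℓ v)
    (hker : ∀ v, B v v = 0 → ℓ v = 0) : ∃ w, ∀ v, B w v = ℓ v := by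
  let f : V →ₗ[ℝ] Dual ℝ V := LinearMap.mk₂ ℝ B
    (fun u v w => by rw [hcomm, hadd, hcomm w, hcomm w])
    (fun c v w => by rw [hcomm, hsmul, hcomm w, smul_eq_mul]) hadd hsmul
  let l : Dual ℝ V := ⟨⟨ℓ, hℓadd⟩, hℓsmul⟩
  have hl : l ∈ LinearMap.range f := by
    rw [← Subspace.dualCoannihilator_dualAnnihilator_eq (W := LinearMap.range f),
      Submodule.mem_dualAnnihilator]
    intro v hv
    rw [Submodule.mem_dualCoannihilator] at hv
    exact hker v (hv (f v) ⟨v, rfl⟩)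
  obtain ⟨w, hw⟩ := hl
  exact ⟨w, fun v => LinearMap.congr_fun hw v⟩

namespace PolyMesh

variable {d : ℕ} (M : PolyMesh d)

/-! ### `L²` products on elements -/

theorem integrableOn_cell (T : M.Elem) {g : Pt d → ℝ} (hg : Continuous g) :
    IntegrableOn g (M.cell T) :=
  (hg.continuousOn.integrableOn_compact
    (M.cell_polyhedron T).isBounded.isCompact_closure).mono_set subset_closure

/-- The integral of a polynomial over an element. -/
noncomputable def cellInt (T : M.Elem) : MvPolynomial (Fin d) ℝ →ₗ[ℝ] ℝ where
  toFun q := ∫ x in M.cell T, ev q x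
  map_add' p q := by
    simp_rw [ev_add]
    exact integral_add (M.integrableOn_cell T (continuous_ev p))
      (M.integrableOn_cell T (continuous_ev q))
  map_smul' c q := by
    simp_rw [ev_smul]
    exact integral_const_mul _ _

theorem cellInt_apply (T : M.Elem) (q : MvPolynomial (Fin d) ℝ) :
    M.cellInt T q = ∫ x in M.cell T, ev q x := rfl

theorem cellInner_ev (T : M.Elem) (p q : MvPolynomial (Fin d) ℝ) :
    M.cellInner T (ev p) (ev q) = M.cellInt T (p * q) := by
  simp [cellInner, cellInt_apply]

theorem eq_zero_of_cellInt_mul_self (T : M.Elem) {q : MvPolynomial (Fin d) ℝ}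
    (hq : M.cellInt T (q * q) = 0) : q = 0 := by
  have hP := M.cell_polyhedron T
  refine eq_zero_of_ev_eq_zero_of_isOpen hP.isOpen hP.nonempty ?_
  rw [cellInt_apply, setIntegral_eq_zero_iff_of_nonneg_ae
    (Eventually.of_forall fun x => by simpa using mul_self_nonneg (ev q x))
    (M.integrableOn_cell T (continuous_ev _))] at hq
  have hq' : ev q =ᵐ[volume.restrict (M.cell T)] 0 := by
    filter_upwards [hq] with x hx
    simpa using hx
  exact Measure.eqOn_open_of_ae_eq hq' hP.isOpen (continuous_ev q).continuousOn continuousOn_const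

theorem cellInt_one_pos (T : M.Elem) : 0 < M.cellInt T 1 := by
  have h0 : 0 ≤ M.cellInt T 1 := by
    rw [cellInt_apply]
    exact integral_nonneg fun x => by simp
  refine lt_of_le_of_ne h0 fun h => ?_
  exact one_ne_zero (M.eq_zero_of_cellInt_mul_self T (q := 1) (by rw [mul_one, ← h]))

/-! ### `L²` products on faces -/

theorem isCompact_face (F : M.Face) : IsCompact (M.face F) := by
  refine Metric.isCompact_of_isClosed_isBounded (M.face_closed F) ?_
  exact (M.cell_polyhedron _).isBounded.closure.subset
    ((M.side₁_spec F).trans frontier_subset_closure)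

instance (F : M.Face) : CompactSpace (M.face F) := isCompact_iff_compactSpace.1 (M.isCompact_face F)

/-- The surface measure on a face. -/
noncomputable abbrev surf (F : M.Face) : Measure (M.face F) :=
  (μHE[d - 1] : Measure (Pt d)).comap Subtype.val

instance (F : M.Face) : IsFiniteMeasure (M.surf F) := by
  obtain ⟨hn, ⟨c, hc⟩, -⟩ := M.normal_spec _ F (M.side₁_spec F)
  constructor
  rw [comap_subtype_coe_apply (M.face_closed F).measurableSet, Subtype.coe_image_univ]
  exact hausdorff_lt_top_of_isCompact (M.isCompact_face F) hn hc

theorem integrable_surf (F : M.Face) {φ : M.face F → ℝ} (hφ : Continuous φ) :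
    Integrable φ (M.surf F) :=
  hφ.integrable_of_hasCompactSupport (HasCompactSupport.of_compactSpace _)

theorem continuous_traceOn (X : Set (Pt d)) (q : MvPolynomial (Fin d) ℝ) :
    Continuous (traceOn X q) := (continuous_ev q).comp continuous_subtype_val

theorem continuous_facePoly {k : ℕ} {F : M.Face} (φ : M.FacePoly k F) :
    Continuous (φ : M.face F → ℝ) := by
  obtain ⟨_, q, -, rfl⟩ := φ
  exact continuous_traceOn _ q

section FaceInner

variable {M} {F : M.Face} {φ φ' ψ : M.face F → ℝ}

theorem faceInner_comm (φ ψ : M.face F → ℝ) : M.faceInner F φ ψ = M.faceInner F ψ φ := by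
  simp only [faceInner, mul_comm]

theorem faceInner_add_left (hφ : Continuous φ) (hφ' : Continuous φ') (hψ : Continuous ψ) :
    M.faceInner F (φ + φ') ψ = M.faceInner F φ ψ + M.faceInner F φ' ψ := by
  simp only [faceInner, Pi.add_apply, add_mul]
  exact integral_add (M.integrable_surf F (hφ.mul hψ)) (M.integrable_surf F (hφ'.mul hψ))

theorem faceInner_smul_left (c : ℝ) (φ ψ : M.face F → ℝ) :
    M.faceInner F (c • φ) ψ = c * M.faceInner F φ ψ := by
  simp only [faceInner, Pi.smul_apply, smul_eq_mul, mul_assoc]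
  exact integral_const_mul _ _

theorem faceInner_sub_left (hφ : Continuous φ) (hφ' : Continuous φ') (hψ : Continuous ψ) :
    M.faceInner F (φ - φ') ψ = M.faceInner F φ ψ - M.faceInner F φ' ψ := by
  simp only [faceInner, Pi.sub_apply, sub_mul]
  exact integral_sub (M.integrable_surf F (hφ.mul hψ)) (M.integrable_surf F (hφ'.mul hψ))

theorem faceInner_add_right (hψ : Continuous ψ) (hφ : Continuous φ) (hφ' : Continuous φ') :
    M.faceInner F ψ (φ + φ') = M.faceInner F ψ φ + M.faceInner F ψ φ' := by
  rw [faceInner_comm, faceInner_add_left hφ hφ' hψ, faceInner_comm φ, faceInner_comm φ']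

theorem faceInner_sub_right (hψ : Continuous ψ) (hφ : Continuous φ) (hφ' : Continuous φ') :
    M.faceInner F ψ (φ - φ') = M.faceInner F ψ φ - M.faceInner F ψ φ' := by
  rw [faceInner_comm, faceInner_sub_left hφ hφ' hψ, faceInner_comm φ, faceInner_comm φ']

theorem faceInner_smul_right (c : ℝ) (φ ψ : M.face F → ℝ) :
    M.faceInner F φ (c • ψ) = c * M.faceInner F φ ψ := by
  rw [faceInner_comm, faceInner_smul_left, faceInner_comm]

@[simp] theorem faceInner_zero_left (ψ : M.face F → ℝ) : M.faceInner F 0 ψ = 0 := by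
  simp [faceInner]

@[simp] theorem faceInner_zero_right (ψ : M.face F → ℝ) : M.faceInner F ψ 0 = 0 := by
  simp [faceInner]

theorem faceInner_neg_left (φ ψ : M.face F → ℝ) :
    M.faceInner F (-φ) ψ = - M.faceInner F φ ψ := by
  simp [faceInner, integral_neg]

theorem faceInner_neg_right (φ ψ : M.face F → ℝ) :
    M.faceInner F φ (-ψ) = - M.faceInner F φ ψ := by
  simp [faceInner, integral_neg]

theorem faceInner_self_nonneg (φ : M.face F → ℝ) : 0 ≤ M.faceInner F φ φ :=
  integral_nonneg fun _ => mul_self_nonneg _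

/-- The `L²(F)` product is definite on polynomial functions on a face. -/
theorem eq_zero_of_faceInner_self {k : ℕ} (hφ : φ ∈ M.FacePoly k F)
    (h0 : M.faceInner F φ φ = 0) : φ = 0 := by
  obtain ⟨q, -, rfl⟩ := hφ
  obtain ⟨hn, ⟨c, hc⟩, -⟩ := M.normal_spec _ F (M.side₁_spec F)
  have hm := (M.face_closed F).measurableSet
  have hq := continuous_traceOn (M.face F) q
  rw [faceInner, integral_eq_zero_iff_of_nonneg (fun x => mul_self_nonneg _)
    (M.integrable_surf F (hq.mul hq))] at h0
  have hae : ∀ᵐ x ∂((μHE[d - 1] : Measure (Pt d)).restrict (M.face F)), ev q x = 0 := by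
    rw [← map_comap_subtype_coe hm, (MeasurableEmbedding.subtype_coe hm).ae_map_iff]
    filter_upwards [h0] with x hx
    exact mul_self_eq_zero.1 hx
  funext x
  exact ev_eq_zero_of_ae_face hm (M.face_pos F) hn hc hae x x.2

theorem faceInnerVec_comm (φ ψ : Fin d → M.face F → ℝ) :
    M.faceInnerVec F φ ψ = M.faceInnerVec F ψ φ := by
  simp only [faceInnerVec, faceInner_comm]

theorem faceInnerVec_smul_left (c : ℝ) (φ ψ : Fin d → M.face F → ℝ) :
    M.faceInnerVec F (c • φ) ψ = c * M.faceInnerVec F φ ψ := by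
  simp only [faceInnerVec, Pi.smul_apply, faceInner_smul_left, Finset.mul_sum]

theorem faceInnerVec_smul_right (c : ℝ) (φ ψ : Fin d → M.face F → ℝ) :
    M.faceInnerVec F φ (c • ψ) = c * M.faceInnerVec F φ ψ := by
  rw [faceInnerVec_comm, faceInnerVec_smul_left, faceInnerVec_comm]

section Vec

variable {φ φ' ψ : Fin d → M.face F → ℝ}

theorem faceInnerVec_add_left (hφ : ∀ i, Continuous (φ i)) (hφ' : ∀ i, Continuous (φ' i))
    (hψ : ∀ i, Continuous (ψ i)) :
    M.faceInnerVec F (φ + φ') ψ = M.faceInnerVec F φ ψ + M.faceInnerVec F φ' ψ := by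
  simp only [faceInnerVec, Pi.add_apply, ← Finset.sum_add_distrib]
  exact Finset.sum_congr rfl fun i _ => faceInner_add_left (hφ i) (hφ' i) (hψ i)

theorem faceInnerVec_sub_left (hφ : ∀ i, Continuous (φ i)) (hφ' : ∀ i, Continuous (φ' i))
    (hψ : ∀ i, Continuous (ψ i)) :
    M.faceInnerVec F (φ - φ') ψ = M.faceInnerVec F φ ψ - M.faceInnerVec F φ' ψ := by
  simp only [faceInnerVec, Pi.sub_apply, ← Finset.sum_sub_distrib]
  exact Finset.sum_congr rfl fun i _ => faceInner_sub_left (hφ i) (hφ' i) (hψ i)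

theorem faceInnerVec_add_right (hψ : ∀ i, Continuous (ψ i)) (hφ : ∀ i, Continuous (φ i))
    (hφ' : ∀ i, Continuous (φ' i)) :
    M.faceInnerVec F ψ (φ + φ') = M.faceInnerVec F ψ φ + M.faceInnerVec F ψ φ' := by
  rw [faceInnerVec_comm, faceInnerVec_add_left hφ hφ' hψ, faceInnerVec_comm φ,
    faceInnerVec_comm φ']

theorem faceInnerVec_sub_right (hψ : ∀ i, Continuous (ψ i)) (hφ : ∀ i, Continuous (φ i))
    (hφ' : ∀ i, Continuous (φ' i)) :
    M.faceInnerVec F ψ (φ - φ') = M.faceInnerVec F ψ φ - M.faceInnerVec F ψ φ' := by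
  rw [faceInnerVec_comm, faceInnerVec_sub_left hφ hφ' hψ, faceInnerVec_comm φ,
    faceInnerVec_comm φ']

theorem eq_zero_of_faceInnerVec_self {k : ℕ} (hφ : ∀ i, φ i ∈ M.FacePoly k F)
    (h0 : M.faceInnerVec F φ φ = 0) : φ = 0 := by
  rw [faceInnerVec, Finset.sum_eq_zero_iff_of_nonneg fun i _ => faceInner_self_nonneg _] at h0
  funext i
  exact eq_zero_of_faceInner_self (hφ i) (h0 i (Finset.mem_univ i))

end Vec

end FaceInner

/-! ### Integration by parts -/

/-- The divergence theorem for the product `p q`. -/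
theorem integrate_by_parts (T : M.Elem) (i : Fin d) (p q : MvPolynomial (Fin d) ℝ) :
    M.cellInt T (MvPolynomial.pderiv i p * q) + M.cellInt T (p * MvPolynomial.pderiv i q) =
      ∑ F : M.FaceOf T,
        M.normal T F.1 i * M.faceInner F.1 (traceOn (M.face F.1) p) (traceOn (M.face F.1) q) := by
  have hP := M.cell_polyhedron T
  have h := integral_lineDeriv_eq_sum_faces (ι := M.FaceOf T) hP.isOpen hP.isBounded
    (F := fun F => M.face F.1) (fun F => M.isCompact_face F.1) (M.frontier_cell T)
    (n := fun F => M.normal T F.1) (fun F => M.normal_spec T F.1 F.2)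
    (fun F F' hF => M.face_overlap F.1 F'.1 fun h => hF (Subtype.ext h.symm))
    (continuous_ev (p * q)) (continuous_ev (MvPolynomial.pderiv i (p * q)))
    (hasLineDerivAt_ev (p * q) i)
  rw [← cellInt_apply] at h
  rw [← map_add]
  convert h using 1
  · congr 1
    simp only [Derivation.leibniz, smul_eq_mul]
    ring
  · refine Finset.sum_congr rfl fun F _ => ?_
    congr 1
    · simp [EuclideanSpace.inner_single_right]
    · rw [← integral_subtype_comap (M.face_closed F.1).measurableSet (fun x => ev (p * q) x)]
      simp [faceInner, traceOn]

end PolyMesh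

/-! ### Derivatives of polynomials -/

section Derivatives

variable {d : ℕ}

theorem totalDegree_pderiv_le (i : Fin d) (q : MvPolynomial (Fin d) ℝ) :
    (MvPolynomial.pderiv i q).totalDegree ≤ q.totalDegree - 1 := by
  refine Finset.sup_le fun m hm => ?_
  rw [MvPolynomial.mem_support_iff, MvPolynomial.coeff_pderiv] at hm
  have h1 := MvPolynomial.le_totalDegree (MvPolynomial.mem_support_iff.2 (left_ne_zero_of_mul hm))
  rw [Finsupp.sum_add_index' (by simp) (by simp), Finsupp.sum_single_index rfl] at h1
  omega

theorem pderiv_mem {k : ℕ} (i : Fin d) {q : MvPolynomial (Fin d) ℝ} (hq : q ∈ Poly d k) :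
    MvPolynomial.pderiv i q ∈ Poly d (k - 1) := by
  rw [MvPolynomial.mem_restrictTotalDegree] at *
  exact (totalDegree_pderiv_le i q).trans (by omega)

theorem poly_mono {k l : ℕ} (h : k ≤ l) : Poly d k ≤ Poly d l := fun q hq => by
  rw [MvPolynomial.mem_restrictTotalDegree] at *
  exact hq.trans h

theorem C_mem_poly (k : ℕ) (c : ℝ) : (MvPolynomial.C c : MvPolynomial (Fin d) ℝ) ∈ Poly d k := by
  rw [MvPolynomial.mem_restrictTotalDegree]; simp

theorem X_mem_poly {k : ℕ} (hk : 1 ≤ k) (i : Fin d) :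
    (MvPolynomial.X i : MvPolynomial (Fin d) ℝ) ∈ Poly d k := by
  rw [MvPolynomial.mem_restrictTotalDegree]; simpa using hk

/-- A polynomial with vanishing gradient is constant. -/
theorem eq_C_of_pderiv_eq_zero {q : MvPolynomial (Fin d) ℝ}
    (hq : ∀ i, MvPolynomial.pderiv i q = 0) : ∃ c, q = MvPolynomial.C c := by
  refine ⟨q.coeff 0, ?_⟩
  ext m
  rw [MvPolynomial.coeff_C]
  split_ifs with hm
  · rw [hm]
  · obtain ⟨i, hi⟩ : ∃ i, m i ≠ 0 := by
      by_contra! h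
      exact hm (Finsupp.ext fun i => (h i).symm)
    have h := MvPolynomial.coeff_pderiv (i := i) q (m - Finsupp.single i 1)
    have hle : Finsupp.single i 1 ≤ m := by
      rw [Finsupp.single_le_iff]; omega
    rw [hq i, tsub_add_cancel_of_le hle, MvPolynomial.coeff_zero] at h
    rcases mul_eq_zero.1 h.symm with h | h
    · exact h
    · exact absurd h (by positivity)

theorem pderiv_comm (i j : Fin d) (q : MvPolynomial (Fin d) ℝ) :
    MvPolynomial.pderiv i (MvPolynomial.pderiv j q) =
      MvPolynomial.pderiv j (MvPolynomial.pderiv i q) := by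
  ext m
  simp only [MvPolynomial.coeff_pderiv, Finsupp.add_apply]
  by_cases hij : i = j
  · subst hij; rfl
  · rw [Finsupp.single_eq_of_ne hij, Finsupp.single_eq_of_ne (Ne.symm hij)]
    rw [add_right_comm, add_zero, add_zero]
    ring

theorem symGrad_add (v w : Fin d → MvPolynomial (Fin d) ℝ) :
    symGrad (v + w) = symGrad v + symGrad w := by
  refine Matrix.ext fun i j => ?_
  rw [Matrix.add_apply]
  simp only [symGrad, Pi.add_apply, map_add]
  module

theorem symGrad_smul (c : ℝ) (v : Fin d → MvPolynomial (Fin d) ℝ) :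
    symGrad (c • v) = c • symGrad v := by
  refine Matrix.ext fun i j => ?_
  rw [Matrix.smul_apply]
  simp only [symGrad, Pi.smul_apply, Derivation.map_smul]
  module

theorem skewGrad_add (v w : Fin d → MvPolynomial (Fin d) ℝ) :
    skewGrad (v + w) = skewGrad v + skewGrad w := by
  refine Matrix.ext fun i j => ?_
  rw [Matrix.add_apply]
  simp only [skewGrad, Pi.add_apply, map_add]
  module

theorem skewGrad_smul (c : ℝ) (v : Fin d → MvPolynomial (Fin d) ℝ) :
    skewGrad (c • v) = c • skewGrad v := by
  refine Matrix.ext fun i j => ?_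
  rw [Matrix.smul_apply]
  simp only [skewGrad, Pi.smul_apply, Derivation.map_smul]
  module

/-- A displacement field with vanishing symmetric gradient has a constant gradient: its second
derivatives `∂_l ∂_i w_j` are symmetric in `(l, i)` and antisymmetric in `(i, j)`. -/
theorem pderiv_eq_C_of_symGrad_eq_zero {w : Fin d → MvPolynomial (Fin d) ℝ} (hw : symGrad w = 0)
    (i j : Fin d) : ∃ c, MvPolynomial.pderiv i (w j) = MvPolynomial.C c := by
  have hanti : ∀ i j, MvPolynomial.pderiv i (w j) = - MvPolynomial.pderiv j (w i) := by
    intro i j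
    have h : symGrad w i j = 0 := by rw [hw]; rfl
    rw [symGrad, smul_eq_zero] at h
    exact eq_neg_of_add_eq_zero_left (h.resolve_left (by norm_num))
  refine eq_C_of_pderiv_eq_zero fun l => ?_
  have h1 : ∀ l i j, MvPolynomial.pderiv l (MvPolynomial.pderiv i (w j)) =
      - MvPolynomial.pderiv l (MvPolynomial.pderiv j (w i)) := fun l i j => by
    rw [hanti i j, map_neg]
  have h2 : MvPolynomial.pderiv l (MvPolynomial.pderiv i (w j)) =
      - MvPolynomial.pderiv l (MvPolynomial.pderiv i (w j)) := by
    calc MvPolynomial.pderiv l (MvPolynomial.pderiv i (w j))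
        = - MvPolynomial.pderiv j (MvPolynomial.pderiv l (w i)) := by
          rw [h1, pderiv_comm]
      _ = MvPolynomial.pderiv i (MvPolynomial.pderiv j (w l)) := by
          rw [h1 j l i, neg_neg, pderiv_comm]
      _ = - MvPolynomial.pderiv l (MvPolynomial.pderiv i (w j)) := by
          rw [h1 i j l, pderiv_comm]
  exact self_eq_neg.1 h2

end Derivatives

namespace PolyMesh

variable {d : ℕ} {M : PolyMesh d} {k : ℕ}

/-! ### Orthogonal projections -/

/-- Riesz representation on `P^k(T)`. -/
theorem exists_cellInt_repr (T : M.Elem) (ℓ : Poly d k → ℝ) (hadd : ∀ v w, ℓ (v + w) = ℓ v + ℓ w)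
    (hsmul : ∀ (c : ℝ) v, ℓ (c • v) = c * ℓ v) :
    ∃ w : Poly d k, ∀ q : Poly d k, M.cellInner T (ev w) (ev q) = ℓ q := by
  refine exists_riesz (fun p q : Poly d k => M.cellInner T (ev p) (ev q)) ?_ ?_ ?_ ℓ hadd hsmul ?_
  · intro v w
    simp only [cellInner_ev, mul_comm]
  · intro u v w
    simp [cellInner_ev, mul_add]
  · intro c v w
    simp [cellInner_ev]
  · intro v hv
    have h : v = 0 := Subtype.ext (M.eq_zero_of_cellInt_mul_self T (by rwa [cellInner_ev] at hv))
    simpa [h] using hsmul 0 v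

theorem projT_spec (T : M.Elem) (v : MvPolynomial (Fin d) ℝ) (q : Poly d k) :
    M.cellInt T (M.projT k T (ev v) * q) = M.cellInt T (v * q) := by
  have h := exists_cellInt_repr T (fun q : Poly d k => M.cellInner T (ev v) (ev q))
    (fun p q => by simp [cellInner_ev, mul_add]) (fun c p => by simp [cellInner_ev])
  have h1 := Classical.epsilon_spec h q
  rw [cellInner_ev, cellInner_ev] at h1
  exact h1

theorem projT_eq_of (T : M.Elem) {v : MvPolynomial (Fin d) ℝ} {w : Poly d k}
    (h : ∀ q : Poly d k, M.cellInt T (w * q) = M.cellInt T (v * q)) :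
    M.projT k T (ev v) = w := by
  rw [← sub_eq_zero]
  refine Subtype.ext (M.eq_zero_of_cellInt_mul_self T ?_)
  have h1 := projT_spec T v (M.projT k T (ev v) - w)
  have h2 := h (M.projT k T (ev v) - w)
  rw [Submodule.coe_sub] at *
  rw [sub_mul, map_sub, h1, h2, sub_self]

theorem projT_add (T : M.Elem) (v w : MvPolynomial (Fin d) ℝ) :
    M.projT k T (ev (v + w)) = M.projT k T (ev v) + M.projT k T (ev w) :=
  projT_eq_of T fun q => by simp [add_mul, projT_spec]

theorem projT_smul (T : M.Elem) (c : ℝ) (v : MvPolynomial (Fin d) ℝ) :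
    M.projT k T (ev (c • v)) = c • M.projT k T (ev v) :=
  projT_eq_of T fun q => by simp [projT_spec]

theorem projT_self (T : M.Elem) (v : Poly d k) : M.projT k T (ev v) = v :=
  projT_eq_of T fun _ => rfl

instance (F : M.Face) : FiniteDimensional ℝ (M.FacePoly k F) := by
  unfold FacePoly; infer_instance

theorem projF_spec (F : M.Face) {v : M.face F → ℝ} (hv : Continuous v) (q : M.FacePoly k F) :
    M.faceInner F (M.projF k F v) q = M.faceInner F v q := by
  have h := exists_riesz (fun p q : M.FacePoly k F => M.faceInner F p q)
    (fun _ _ => faceInner_comm _ _)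
    (fun u v w => faceInner_add_right (M.continuous_facePoly u) (M.continuous_facePoly v)
      (M.continuous_facePoly w)) (fun c v w => faceInner_smul_right c _ _)
    (fun q => M.faceInner F v q)
    (fun p q => faceInner_add_right hv (M.continuous_facePoly p) (M.continuous_facePoly q))
    (fun c p => faceInner_smul_right c _ _) (fun p hp => by
      rw [eq_zero_of_faceInner_self p.2 hp, faceInner_zero_right])
  exact Classical.epsilon_spec h q

theorem projF_eq_of (F : M.Face) {v : M.face F → ℝ} (hv : Continuous v) {w : M.FacePoly k F}
    (h : ∀ q : M.FacePoly k F, M.faceInner F w q = M.faceInner F v q) : M.projF k F v = w := by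
  rw [← sub_eq_zero]
  refine Subtype.ext (eq_zero_of_faceInner_self (M.projF k F v - w).2 ?_)
  rw [Submodule.coe_sub, ← Submodule.coe_sub, Submodule.coe_sub,
    faceInner_sub_left (M.continuous_facePoly _) (M.continuous_facePoly _)
      ((M.continuous_facePoly _).sub (M.continuous_facePoly _)), ← Submodule.coe_sub,
    projF_spec F hv, h, sub_self]

theorem projF_add (F : M.Face) {v w : M.face F → ℝ} (hv : Continuous v) (hw : Continuous w) :
    M.projF k F (v + w) = M.projF k F v + M.projF k F w :=
  projF_eq_of F (hv.add hw) fun q => by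
    have hq := M.continuous_facePoly q
    rw [Submodule.coe_add, faceInner_add_left (M.continuous_facePoly _)
      (M.continuous_facePoly _) hq, faceInner_add_left hv hw hq, projF_spec F hv, projF_spec F hw]

theorem projF_smul (F : M.Face) (c : ℝ) {v : M.face F → ℝ} (hv : Continuous v) :
    M.projF k F (c • v) = c • M.projF k F v :=
  projF_eq_of F (hv.const_smul c) fun q => by
    rw [Submodule.coe_smul, faceInner_smul_left, faceInner_smul_left, projF_spec F hv]

theorem projF_self (F : M.Face) (v : M.FacePoly k F) : M.projF k F (v : M.face F → ℝ) = v :=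
  projF_eq_of F (M.continuous_facePoly v) fun _ => rfl

end PolyMesh

namespace PolyMesh

variable {d : ℕ} {M : PolyMesh d} {k : ℕ} {T : M.Elem}

/-! ### The discrete symmetric gradient tested with a tensor field -/

theorem cellInnerMat_eq (T : M.Elem) (σ η : Matrix (Fin d) (Fin d) (MvPolynomial (Fin d) ℝ)) :
    M.cellInnerMat T σ η = ∑ i, ∑ j, M.cellInt T (σ i j * η i j) := by
  simp only [cellInnerMat, cellInner_ev]

theorem cellInnerMat_comm (T : M.Elem) (σ η : Matrix (Fin d) (Fin d) (MvPolynomial (Fin d) ℝ)) :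
    M.cellInnerMat T σ η = M.cellInnerMat T η σ := by
  simp only [cellInnerMat_eq, mul_comm]

theorem cellInnerMat_add_right (T : M.Elem)
    (σ η η' : Matrix (Fin d) (Fin d) (MvPolynomial (Fin d) ℝ)) :
    M.cellInnerMat T σ (η + η') = M.cellInnerMat T σ η + M.cellInnerMat T σ η' := by
  simp only [cellInnerMat_eq, Matrix.add_apply, mul_add, map_add, Finset.sum_add_distrib]

theorem cellInnerMat_smul_right (T : M.Elem) (c : ℝ)
    (σ η : Matrix (Fin d) (Fin d) (MvPolynomial (Fin d) ℝ)) :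
    M.cellInnerMat T σ (c • η) = c * M.cellInnerMat T σ η := by
  simp only [cellInnerMat_eq, Matrix.smul_apply, mul_smul_comm, map_smul, smul_eq_mul,
    Finset.mul_sum]

theorem cellInnerMat_add_left (T : M.Elem)
    (σ σ' η : Matrix (Fin d) (Fin d) (MvPolynomial (Fin d) ℝ)) :
    M.cellInnerMat T (σ + σ') η = M.cellInnerMat T σ η + M.cellInnerMat T σ' η := by
  rw [cellInnerMat_comm, cellInnerMat_add_right, cellInnerMat_comm T η, cellInnerMat_comm T η]

theorem cellInnerMat_smul_left (T : M.Elem) (c : ℝ)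
    (σ η : Matrix (Fin d) (Fin d) (MvPolynomial (Fin d) ℝ)) :
    M.cellInnerMat T (c • σ) η = c * M.cellInnerMat T σ η := by
  rw [cellInnerMat_comm, cellInnerMat_smul_right, cellInnerMat_comm]

theorem eq_zero_of_cellInnerMat_self {σ : Matrix (Fin d) (Fin d) (MvPolynomial (Fin d) ℝ)}
    (h : M.cellInnerMat T σ σ = 0) : σ = 0 := by
  have hnn : ∀ q : MvPolynomial (Fin d) ℝ, 0 ≤ M.cellInt T (q * q) := fun q => by
    rw [cellInt_apply]
    exact integral_nonneg fun x => by simpa using mul_self_nonneg (ev q x)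
  rw [cellInnerMat_eq] at h
  refine Matrix.ext fun i j => ?_
  have h1 := (Finset.sum_eq_zero_iff_of_nonneg fun i _ =>
    Finset.sum_nonneg fun j _ => hnn (σ i j)).1 h i (Finset.mem_univ i)
  have h2 := (Finset.sum_eq_zero_iff_of_nonneg fun j _ => hnn (σ i j)).1 h1 j (Finset.mem_univ j)
  exact M.eq_zero_of_cellInt_mul_self T h2

theorem normalTrace_eq_traceOn (F : M.Face) (σ : Matrix (Fin d) (Fin d) (MvPolynomial (Fin d) ℝ))
    (n : Pt d) (i : Fin d) :
    M.normalTrace F σ n i = traceOn (M.face F) (∑ j, n j • σ i j) := by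
  funext x
  simp [normalTrace, traceOn, mul_comm]

theorem continuous_normalTrace (F : M.Face)
    (σ : Matrix (Fin d) (Fin d) (MvPolynomial (Fin d) ℝ)) (n : Pt d) (i : Fin d) :
    Continuous (M.normalTrace F σ n i) := by
  rw [normalTrace_eq_traceOn]
  exact continuous_traceOn _ _

theorem normalTrace_add (F : M.Face) (σ η : Matrix (Fin d) (Fin d) (MvPolynomial (Fin d) ℝ))
    (n : Pt d) : M.normalTrace F (σ + η) n = M.normalTrace F σ n + M.normalTrace F η n := by
  funext i x
  simp [normalTrace, add_mul, Finset.sum_add_distrib]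

theorem normalTrace_smul (F : M.Face) (c : ℝ)
    (σ : Matrix (Fin d) (Fin d) (MvPolynomial (Fin d) ℝ)) (n : Pt d) :
    M.normalTrace F (c • σ) n = c • M.normalTrace F σ n := by
  funext i x
  simp [normalTrace, Finset.mul_sum, mul_assoc]

theorem continuous_diffF (v : M.LocalDof k T) (F : M.FaceOf T) (i : Fin d) :
    Continuous (diffF v F i) :=
  (M.continuous_facePoly (v.2 F i)).sub ((continuous_ev _).comp continuous_subtype_val)

theorem diffF_add (v w : M.LocalDof k T) (F : M.FaceOf T) :
    diffF (v + w) F = diffF v F + diffF w F := by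
  funext i x
  simp [diffF]
  ring

theorem diffF_smul (c : ℝ) (v : M.LocalDof k T) (F : M.FaceOf T) :
    diffF (c • v) F = c • diffF v F := by
  funext i x
  simp [diffF]
  ring

theorem raw_add {l : ℕ} (v w : Fin d → Poly d l) : raw (v + w) = raw v + raw w := rfl

theorem raw_smul {l : ℕ} (c : ℝ) (v : Fin d → Poly d l) : raw (c • v) = c • raw v := rfl

/-- The discrete symmetric gradient of the hybrid unknowns `v`, tested with the tensor field `σ`:
`(∇_s v_T, σ)_T + ∑_F (v_F - v_T, σ n_{TF})_F`. -/
noncomputable def discStrain (v : M.LocalDof k T)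
    (σ : Matrix (Fin d) (Fin d) (MvPolynomial (Fin d) ℝ)) : ℝ :=
  M.cellInnerMat T (symGrad (raw v.1)) σ +
    ∑ F : M.FaceOf T, M.faceInnerVec F.1 (diffF v F) (M.normalTrace F.1 σ (M.normal T F.1))

theorem discStrain_add_right (v : M.LocalDof k T)
    (σ η : Matrix (Fin d) (Fin d) (MvPolynomial (Fin d) ℝ)) :
    discStrain v (σ + η) = discStrain v σ + discStrain v η := by
  have h : ∀ F : M.FaceOf T,
      M.faceInnerVec F.1 (diffF v F) (M.normalTrace F.1 (σ + η) (M.normal T F.1)) =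
      M.faceInnerVec F.1 (diffF v F) (M.normalTrace F.1 σ (M.normal T F.1)) +
      M.faceInnerVec F.1 (diffF v F) (M.normalTrace F.1 η (M.normal T F.1)) := fun F => by
    rw [normalTrace_add, faceInnerVec_add_right (continuous_diffF v F)
      (continuous_normalTrace _ _ _) (continuous_normalTrace _ _ _)]
  simp only [discStrain, cellInnerMat_add_right, h, Finset.sum_add_distrib]
  ring

theorem discStrain_smul_right (v : M.LocalDof k T) (c : ℝ)
    (σ : Matrix (Fin d) (Fin d) (MvPolynomial (Fin d) ℝ)) :
    discStrain v (c • σ) = c * discStrain v σ := by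
  simp only [discStrain, cellInnerMat_smul_right, normalTrace_smul, faceInnerVec_smul_right,
    Finset.mul_sum, mul_add]

theorem discStrain_add_left (v w : M.LocalDof k T)
    (σ : Matrix (Fin d) (Fin d) (MvPolynomial (Fin d) ℝ)) :
    discStrain (v + w) σ = discStrain v σ + discStrain w σ := by
  have h : ∀ F : M.FaceOf T,
      M.faceInnerVec F.1 (diffF (v + w) F) (M.normalTrace F.1 σ (M.normal T F.1)) =
      M.faceInnerVec F.1 (diffF v F) (M.normalTrace F.1 σ (M.normal T F.1)) +
      M.faceInnerVec F.1 (diffF w F) (M.normalTrace F.1 σ (M.normal T F.1)) := fun F => by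
    rw [diffF_add, faceInnerVec_add_left (continuous_diffF v F) (continuous_diffF w F)
      (continuous_normalTrace _ _ _)]
  simp only [discStrain, Prod.fst_add, raw_add, symGrad_add, cellInnerMat_add_left, h,
    Finset.sum_add_distrib]
  ring

theorem discStrain_smul_left (c : ℝ) (v : M.LocalDof k T)
    (σ : Matrix (Fin d) (Fin d) (MvPolynomial (Fin d) ℝ)) :
    discStrain (c • v) σ = c * discStrain v σ := by
  simp only [discStrain, Prod.smul_fst, raw_smul, symGrad_smul, cellInnerMat_smul_left,
    diffF_smul, faceInnerVec_smul_left, Finset.mul_sum, mul_add]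

/-! ### Discrete divergence -/

/-- Tested with `q I`, the discrete symmetric gradient is the discrete divergence tested with `q`. -/
theorem discStrain_diagonal (v : M.LocalDof k T) (q : MvPolynomial (Fin d) ℝ) :
    discStrain v (Matrix.diagonal fun _ => q) =
      M.cellInner T (ev (div (raw v.1))) (ev q) +
      ∑ F : M.FaceOf T,
        M.faceInnerVec F.1 (diffF v F) (fun i x => ev q x * M.normal T F.1 i) := by
  have h1 : ∀ F : M.FaceOf T, M.normalTrace F.1 (Matrix.diagonal fun _ => q) (M.normal T F.1) =
      fun i (x : M.face F.1) => ev q x * M.normal T F.1 i := fun F => by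
    funext i x
    rw [normalTrace, Finset.sum_eq_single i]
    · rw [Matrix.diagonal_apply_eq]
    · intro j _ hj
      rw [Matrix.diagonal_apply_ne _ hj.symm, ev_zero, zero_mul]
    · simp
  have h2 : M.cellInnerMat T (symGrad (raw v.1)) (Matrix.diagonal fun _ => q) =
      M.cellInner T (ev (div (raw v.1))) (ev q) := by
    rw [cellInnerMat_eq, cellInner_ev, div, Finset.sum_mul, map_sum]
    refine Finset.sum_congr rfl fun i _ => ?_
    rw [Finset.sum_eq_single i]
    · rw [Matrix.diagonal_apply_eq, symGrad, ← two_smul ℝ, smul_smul]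
      norm_num
    · intro j _ hj
      rw [Matrix.diagonal_apply_ne _ hj.symm, mul_zero, map_zero]
    · simp
  rw [discStrain, h2]
  simp only [h1]

theorem diagonal_add (p q : MvPolynomial (Fin d) ℝ) :
    (Matrix.diagonal fun _ : Fin d => p + q) =
      (Matrix.diagonal fun _ => p) + Matrix.diagonal fun _ => q :=
  (Matrix.diagonal_add _ _).symm

theorem divT_spec (v : M.LocalDof k T) (q : Poly d k) :
    M.cellInner T (ev (divT v)) (ev q) =
      discStrain v (Matrix.diagonal fun _ => (q : MvPolynomial (Fin d) ℝ)) := by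
  have h := exists_cellInt_repr T
    (fun q : Poly d k => discStrain v (Matrix.diagonal fun _ => (q : MvPolynomial (Fin d) ℝ)))
    (fun p q => by rw [Submodule.coe_add, diagonal_add, discStrain_add_right])
    (fun c p => by
      rw [Submodule.coe_smul, ← discStrain_smul_right]
      congr 1
      exact (Matrix.diagonal_smul c fun _ => (p : MvPolynomial (Fin d) ℝ)))
  simp only [discStrain_diagonal] at h
  rw [discStrain_diagonal]
  exact Classical.epsilon_spec h q

/-! ### Displacement reconstruction -/

/-- The affine field `x ↦ b + A x`. -/
noncomputable def affineField (l : ℕ) (A : Matrix (Fin d) (Fin d) ℝ) (b : Fin d → ℝ) :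
    Fin d → Poly d (l + 1) := fun i =>
  ⟨MvPolynomial.C (b i) + ∑ j, A i j • MvPolynomial.X j,
    Submodule.add_mem _ (C_mem_poly _ _)
      (Submodule.sum_mem _ fun j _ => Submodule.smul_mem _ _ (X_mem_poly (by omega) j))⟩

theorem pderiv_affineField (l : ℕ) (A : Matrix (Fin d) (Fin d) ℝ) (b : Fin d → ℝ) (i j : Fin d) :
    MvPolynomial.pderiv i (raw (affineField l A b) j) = MvPolynomial.C (A j i) := by
  simp only [raw, affineField, map_add, MvPolynomial.pderiv_C, zero_add, map_sum,
    Derivation.map_smul, MvPolynomial.pderiv_X]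
  rw [Finset.sum_eq_single i]
  · simp [MvPolynomial.smul_eq_C_mul]
  · intro m _ hm
    simp [hm]
  · simp

theorem IsReconstruction.add {v w : M.LocalDof k T} {r s : Fin d → Poly d (k + 1)}
    (hr : IsReconstruction v r) (hs : IsReconstruction w s) : IsReconstruction (v + w) (r + s) := by
  refine ⟨fun w' => ?_, fun i => ?_, fun i j => ?_⟩
  · have h1 := hr.1 w'
    have h2 := hs.1 w'
    change _ = discStrain _ _ at h1 h2 ⊢
    rw [raw_add, symGrad_add, cellInnerMat_add_left, h1, h2, discStrain_add_left]
  · have h1 := hr.2.1 i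
    have h2 := hs.2.1 i
    simp only [← cellInt_apply] at h1 h2 ⊢
    simp only [Pi.add_apply, Prod.fst_add, Submodule.coe_add, map_add, h1, h2]
  · have h1 := hr.2.2 i j
    have h2 := hs.2.2 i j
    simp only [← cellInt_apply] at h1 h2 ⊢
    rw [raw_add, skewGrad_add, Matrix.add_apply, map_add, h1, h2, ← Finset.sum_add_distrib]
    refine Finset.sum_congr rfl fun F _ => ?_
    have hc : ∀ (v : M.LocalDof k T), Integrable (fun x : M.face F.1 => (1 / 2 : ℝ) *
        (M.normal T F.1 i * (v.2 F j : M.face F.1 → ℝ) x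
        - (v.2 F i : M.face F.1 → ℝ) x * M.normal T F.1 j)) (M.surf F.1) := fun v => by
      refine M.integrable_surf F.1 ?_
      have := M.continuous_facePoly (v.2 F j)
      have := M.continuous_facePoly (v.2 F i)
      fun_prop
    rw [← integral_add (hc v) (hc w)]
    congr 1
    funext x
    simp
    ring

theorem IsReconstruction.smul {v : M.LocalDof k T} {r : Fin d → Poly d (k + 1)} (c : ℝ)
    (hr : IsReconstruction v r) : IsReconstruction (c • v) (c • r) := by
  refine ⟨fun w' => ?_, fun i => ?_, fun i j => ?_⟩
  · have h1 := hr.1 w'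
    change _ = discStrain _ _ at h1 ⊢
    rw [raw_smul, symGrad_smul, cellInnerMat_smul_left, h1, discStrain_smul_left]
  · have h1 := hr.2.1 i
    simp only [← cellInt_apply] at h1 ⊢
    simp only [Pi.smul_apply, Prod.smul_fst, Submodule.coe_smul, map_smul, h1]
  · have h1 := hr.2.2 i j
    simp only [← cellInt_apply] at h1 ⊢
    rw [raw_smul, skewGrad_smul, Matrix.smul_apply, map_smul, h1, Finset.smul_sum]
    refine Finset.sum_congr rfl fun F _ => ?_
    rw [← integral_smul]
    congr 1
    funext x
    simp
    ring

/-- The right-hand side of the equation for the reconstruction sees the test function only through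
its symmetric gradient, so that it is solvable up to rigid motions; a rigid motion then adjusts the
mean value and the mean rotation. -/
theorem exists_isReconstruction (v : M.LocalDof k T) : ∃ r, IsReconstruction v r := by
  obtain ⟨r₀, hr₀⟩ := exists_riesz
    (fun r w : Fin d → Poly d (k + 1) => M.cellInnerMat T (symGrad (raw r)) (symGrad (raw w)))
    (fun _ _ => cellInnerMat_comm _ _ _)
    (fun u v w => by rw [raw_add, symGrad_add, cellInnerMat_add_right])
    (fun c v w => by rw [raw_smul, symGrad_smul, cellInnerMat_smul_right])
    (fun w => discStrain v (symGrad (raw w)))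
    (fun v w => by rw [raw_add, symGrad_add, discStrain_add_right])
    (fun c w => by rw [raw_smul, symGrad_smul, discStrain_smul_right])
    (fun w hw => by
      rw [eq_zero_of_cellInnerMat_self hw, ← zero_smul ℝ (0 : Matrix _ _ _),
        discStrain_smul_right, zero_mul])
  have hpos := M.cellInt_one_pos T
  have hC : ∀ c, M.cellInt T (MvPolynomial.C c) = c * M.cellInt T 1 := fun c => by
    rw [← smul_eq_mul, ← map_smul, MvPolynomial.smul_eq_C_mul, mul_one]
  -- the rigid motion that corrects the mean value and the mean rotation of `r₀`
  let W : Fin d → Fin d → ℝ := fun i j => ∑ F : M.FaceOf T,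
      ∫ x, (1 / 2 : ℝ) * (M.normal T F.1 i * (v.2 F j : M.face F.1 → ℝ) x
        - (v.2 F i : M.face F.1 → ℝ) x * M.normal T F.1 j) ∂(M.surf F.1)
  let A : Matrix (Fin d) (Fin d) ℝ := fun j i =>
    (W i j - M.cellInt T (skewGrad (raw r₀) i j)) / M.cellInt T 1
  have hA : ∀ i j, A i j = - A j i := by
    intro i j
    have h1 : W j i = - W i j := by
      simp only [W, ← Finset.sum_neg_distrib, ← integral_neg]
      refine Finset.sum_congr rfl fun F _ => ?_
      congr 1
      funext x
      ring
    have h2 : skewGrad (raw r₀) j i = - skewGrad (raw r₀) i j := by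
      simp only [skewGrad, ← smul_neg, neg_sub]
    simp only [A, h1, h2, map_neg]
    ring
  let b : Fin d → ℝ := fun i => (M.cellInt T (raw v.1 i) -
    M.cellInt T (raw r₀ i + raw (affineField k A 0) i)) / M.cellInt T 1
  have hsym : symGrad (raw (affineField k A b)) = 0 := by
    refine Matrix.ext fun i j => ?_
    rw [symGrad, pderiv_affineField, pderiv_affineField, hA j i, ← map_add]
    simp
  refine ⟨r₀ + affineField k A b, fun w => ?_, fun i => ?_, fun i j => ?_⟩
  · rw [raw_add, symGrad_add, hsym, add_zero]
    exact hr₀ w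
  · have h1 : raw (r₀ + affineField k A b) i =
        (raw r₀ i + raw (affineField k A 0) i) + MvPolynomial.C (b i) := by
      simp [raw, affineField]
      ring
    change M.cellInt T (raw (r₀ + affineField k A b) i) = M.cellInt T (raw v.1 i)
    rw [h1, map_add, hC, div_mul_cancel₀ _ hpos.ne']
    ring
  · change M.cellInt T _ = W i j
    have h1 : skewGrad (raw (affineField k A b)) i j = MvPolynomial.C (A j i) := by
      rw [skewGrad, pderiv_affineField, pderiv_affineField, hA i j, ← map_sub,
        MvPolynomial.smul_eq_C_mul, ← map_mul]
      congr 1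
      ring
    rw [raw_add, skewGrad_add, Matrix.add_apply, map_add, h1, hC, div_mul_cancel₀ _ hpos.ne']
    ring

/-- A displacement with zero strain, zero mean and zero mean rotation vanishes. -/
theorem eq_zero_of_isReconstruction_zero {r : Fin d → Poly d (k + 1)}
    (hr : IsReconstruction (0 : M.LocalDof k T) r) : r = 0 := by
  have hpos := M.cellInt_one_pos T
  have hC : ∀ c, M.cellInt T (MvPolynomial.C c) = c * M.cellInt T 1 := fun c => by
    rw [← smul_eq_mul, ← map_smul, MvPolynomial.smul_eq_C_mul, mul_one]
  have hsym : symGrad (raw r) = 0 := by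
    have h := hr.1 r
    change _ = discStrain _ _ at h
    rw [← zero_smul ℝ (0 : M.LocalDof k T), discStrain_smul_left, zero_mul] at h
    exact eq_zero_of_cellInnerMat_self h
  have hgrad : ∀ i j, MvPolynomial.pderiv i (raw r j) = 0 := by
    intro i j
    have h1 : skewGrad (raw r) i j = MvPolynomial.pderiv i (raw r j) := by
      have h2 : MvPolynomial.pderiv i (raw r j) + MvPolynomial.pderiv j (raw r i) = 0 := by
        have h3 : symGrad (raw r) i j = 0 := by rw [hsym]; rfl
        rw [symGrad, smul_eq_zero] at h3
        exact h3.resolve_left (by norm_num)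
      rw [skewGrad, eq_neg_of_add_eq_zero_right h2, sub_neg_eq_add, ← two_smul ℝ, smul_smul]
      norm_num
    obtain ⟨c, hc⟩ := pderiv_eq_C_of_symGrad_eq_zero hsym i j
    have h2 := hr.2.2 i j
    rw [← cellInt_apply, h1, hc, hC] at h2
    have h3 : c * M.cellInt T 1 = 0 := by rw [h2]; simp
    rw [hc, (mul_eq_zero.1 h3).resolve_right hpos.ne', map_zero]
  funext j
  obtain ⟨c, hc⟩ := eq_C_of_pderiv_eq_zero fun i => hgrad i j
  have h1 : M.cellInt T (raw r j) = 0 := by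
    have h2 := hr.2.1 j
    rw [← cellInt_apply] at h2
    rw [h2]
    simp
  rw [hc, hC] at h1
  refine Subtype.ext ?_
  change raw r j = 0
  rw [hc, (mul_eq_zero.1 h1).resolve_right hpos.ne', map_zero]

theorem recT_spec (v : M.LocalDof k T) : IsReconstruction v (recT v) :=
  Classical.epsilon_spec (exists_isReconstruction v)

theorem recT_eq_of {v : M.LocalDof k T} {r : Fin d → Poly d (k + 1)} (hr : IsReconstruction v r) :
    recT v = r := by
  have h := (recT_spec v).add (hr.smul (-1))
  have h1 : v + (-1 : ℝ) • v = 0 := by module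
  have h2 : recT v + (-1 : ℝ) • r = recT v + -r := by module
  rw [h1, h2] at h
  exact add_neg_eq_zero.1 (eq_zero_of_isReconstruction_zero h)

theorem recT_add (v w : M.LocalDof k T) : recT (v + w) = recT v + recT w :=
  recT_eq_of ((recT_spec v).add (recT_spec w))

theorem recT_smul (c : ℝ) (v : M.LocalDof k T) : recT (c • v) = c • recT v :=
  recT_eq_of ((recT_spec v).smul c)

/-- The reconstruction preserves polynomial displacements. The mean rotation of the displacement
matches its boundary expression by the divergence theorem. -/
theorem isReconstruction_of_polynomial (v : Fin d → Poly d k) :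
    IsReconstruction ((v, fun F i => M.tr F.1 (v i)) : M.LocalDof k T)
      (fun i => ⟨v i, poly_mono (Nat.le_succ k) (v i).2⟩) := by
  refine ⟨fun w => ?_, fun i => rfl, fun i j => ?_⟩
  · have h : ∀ F : M.FaceOf T,
        diffF ((v, fun F i => M.tr F.1 (v i)) : M.LocalDof k T) F = 0 := fun F => by
      funext i x
      simp [diffF, tr, traceOn]
    simp [h, faceInnerVec]
  · rw [← cellInt_apply]
    have hibp : ∀ i j, M.cellInt T (MvPolynomial.pderiv i (raw v j)) = ∑ F : M.FaceOf T,
        M.normal T F.1 i * M.faceInner F.1 (traceOn (M.face F.1) (raw v j)) 1 := fun i j => by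
      have h := M.integrate_by_parts T i (raw v j) 1
      have h1 : ∀ F : M.FaceOf T, traceOn (M.face F.1) 1 = 1 := fun F => by
        funext x; simp [traceOn]
      simpa [h1] using h
    change M.cellInt T (skewGrad (raw v) i j) = _
    rw [skewGrad, map_smul, map_sub, hibp, hibp, ← Finset.sum_sub_distrib, Finset.smul_sum]
    refine Finset.sum_congr rfl fun F _ => ?_
    have hc := fun i => M.integrable_surf F.1 (continuous_traceOn (M.face F.1) (raw v i))
    simp only [faceInner, Pi.one_apply, mul_one, smul_eq_mul]
    rw [← integral_const_mul, ← integral_const_mul, ← integral_sub ((hc j).const_mul _)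
      ((hc i).const_mul _), ← integral_const_mul]
    congr 1
    funext x
    simp only [tr]
    ring

end PolyMesh

namespace PolyMesh

variable {d : ℕ} {M : PolyMesh d} {k : ℕ} {T : M.Elem}

/-! ### Boundary operator and stabilization -/

/-- The projection in the definition of `L_T` acts only on the reconstruction, the other terms being
polynomial on the face. -/
theorem LT_apply (φ : M.BdryDof k T) (F : M.FaceOf T) (i : Fin d) :
    LT φ F i = φ F i + M.tr F.1 (M.projT k T (ev (raw (recT ((0 : Fin d → Poly d k), φ)) i)))
      - M.projF k F.1 (traceOn (M.face F.1) (raw (recT ((0 : Fin d → Poly d k), φ)) i)) := by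
  set r := recT ((0 : Fin d → Poly d k), φ) with hr
  have h1 : LT φ F i = M.projF k F.1
      (((φ F i + M.tr F.1 (M.projT k T (ev (raw r i))) : M.FacePoly k F.1) : M.face F.1 → ℝ)
        + (-1 : ℝ) • traceOn (M.face F.1) (raw r i)) := by
    change M.projF k F.1 _ = _
    congr 1
    funext x
    simp [tr, traceOn, ← hr]
    ring
  have hc := continuous_traceOn (M.face F.1) (raw r i)
  rw [h1, projF_add _ (M.continuous_facePoly _) (hc.const_smul _), projF_self, projF_smul _ _ hc]
  module

theorem tr_add (F : M.Face) (p q : Poly d k) : M.tr F (p + q) = M.tr F p + M.tr F q :=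
  Subtype.ext (map_add _ _ _)

theorem tr_smul (F : M.Face) (c : ℝ) (p : Poly d k) : M.tr F (c • p) = c • M.tr F p :=
  Subtype.ext (map_smul _ _ _)

theorem LT_add (φ ψ : M.BdryDof k T) : LT (φ + ψ) = LT φ + LT ψ := by
  have h : recT ((0 : Fin d → Poly d k), φ + ψ) =
      recT ((0 : Fin d → Poly d k), φ) + recT ((0 : Fin d → Poly d k), ψ) := by
    rw [← recT_add]
    simp
  funext F i
  have hi : raw (recT ((0 : Fin d → Poly d k), φ + ψ)) i =
      raw (recT ((0 : Fin d → Poly d k), φ)) i + raw (recT ((0 : Fin d → Poly d k), ψ)) i := by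
    rw [h]; rfl
  simp only [Pi.add_apply]
  rw [LT_apply, LT_apply, LT_apply, hi, projT_add, tr_add, map_add,
    projF_add _ (continuous_traceOn _ _) (continuous_traceOn _ _)]
  simp only [Pi.add_apply]
  abel

theorem LT_smul (c : ℝ) (φ : M.BdryDof k T) : LT (c • φ) = c • LT φ := by
  have h : recT ((0 : Fin d → Poly d k), c • φ) = c • recT ((0 : Fin d → Poly d k), φ) := by
    rw [← recT_smul]
    simp
  funext F i
  have hi : raw (recT ((0 : Fin d → Poly d k), c • φ)) i =
      c • raw (recT ((0 : Fin d → Poly d k), φ)) i := by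
    rw [h]; rfl
  simp only [Pi.smul_apply]
  rw [LT_apply, LT_apply, hi, projT_smul, tr_smul, map_smul,
    projF_smul _ _ (continuous_traceOn _ _)]
  simp only [Pi.smul_apply]
  module

theorem bdryInner_comm (φ ψ : M.BdryDof k T) : bdryInner φ ψ = bdryInner ψ φ := by
  simp only [bdryInner]
  exact Finset.sum_congr rfl fun F _ => faceInnerVec_comm _ _

theorem bdryInner_add_right (χ φ ψ : M.BdryDof k T) :
    bdryInner χ (φ + ψ) = bdryInner χ φ + bdryInner χ ψ := by
  simp only [bdryInner, ← Finset.sum_add_distrib]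
  refine Finset.sum_congr rfl fun F _ => ?_
  exact faceInnerVec_add_right (fun i => M.continuous_facePoly (χ F i))
    (fun i => M.continuous_facePoly (φ F i)) (fun i => M.continuous_facePoly (ψ F i))

theorem bdryInner_smul_right (c : ℝ) (φ ψ : M.BdryDof k T) :
    bdryInner φ (c • ψ) = c * bdryInner φ ψ := by
  simp only [bdryInner, Finset.mul_sum]
  exact Finset.sum_congr rfl fun F _ => faceInnerVec_smul_right c _ _

theorem eq_zero_of_bdryInner_self {φ : M.BdryDof k T} (h : bdryInner φ φ = 0) : φ = 0 := by
  have h1 := (Finset.sum_eq_zero_iff_of_nonneg fun (F : M.FaceOf T) _ =>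
    Finset.sum_nonneg fun i _ => faceInner_self_nonneg (φ F i : M.face F.1 → ℝ)).1 h
  funext F i
  exact Subtype.ext (congrFun (eq_zero_of_faceInnerVec_self (fun i => (φ F i).2)
    (h1 F (Finset.mem_univ F))) i)

theorem LTstar_spec (ψ φ : M.BdryDof k T) : bdryInner (LT φ) ψ = bdryInner φ (LTstar ψ) := by
  obtain ⟨χ, hχ⟩ := exists_riesz (fun φ ψ : M.BdryDof k T => bdryInner φ ψ) bdryInner_comm
    bdryInner_add_right bdryInner_smul_right (fun φ => bdryInner (LT φ) ψ)
    (fun φ φ' => by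
      rw [LT_add, bdryInner_comm, bdryInner_add_right, bdryInner_comm ψ, bdryInner_comm ψ])
    (fun c φ => by rw [LT_smul, bdryInner_comm, bdryInner_smul_right, bdryInner_comm ψ])
    (fun φ hφ => by
      rw [eq_zero_of_bdryInner_self hφ, ← zero_smul ℝ (0 : M.BdryDof k T), LT_smul,
        bdryInner_comm, bdryInner_smul_right, zero_mul])
  have h : ∃ χ : M.BdryDof k T, ∀ φ : M.BdryDof k T, bdryInner (LT φ) ψ = bdryInner φ χ :=
    ⟨χ, fun φ => by rw [← hχ φ, bdryInner_comm]⟩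
  exact Classical.epsilon_spec h φ

theorem diffF_eq_bdryDiff (v : M.LocalDof k T) (F : M.FaceOf T) :
    diffF v F = fun i => (bdryDiff v F i : M.face F.1 → ℝ) := by
  funext i x
  simp [diffF, bdryDiff, tr, traceOn]

/-- The face residuals depend on the unknowns only through `v_F - v_T`, since the reconstruction
preserves the polynomial `v_T`. -/
theorem resid_eq (v : M.LocalDof k T) (F : M.FaceOf T) :
    resid v F = fun i => ((-LT (bdryDiff v) F i : M.FacePoly k F.1) : M.face F.1 → ℝ) := by
  set r := recT ((0 : Fin d → Poly d k), bdryDiff v) with hr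
  have hrec : ∀ i, raw (recT v) i = raw r i + raw v.1 i := by
    have hsplit : v = ((0 : Fin d → Poly d k), bdryDiff v)
        + ((v.1, fun F i => M.tr F.1 (v.1 i)) : M.LocalDof k T) := by
      refine Prod.ext (by simp) ?_
      funext F i
      simp [bdryDiff]
    intro i
    conv_lhs => rw [hsplit, recT_add, recT_eq_of (isReconstruction_of_polynomial v.1)]
    rfl
  funext i
  have h1 : resid v F i =
      ((M.projF k F.1 (traceOn (M.face F.1) (raw (recT v) i)) - v.2 F i
        - (M.tr F.1 (M.projT k T (ev (raw (recT v) i))) - M.tr F.1 (v.1 i)) :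
          M.FacePoly k F.1) : M.face F.1 → ℝ) := by
    funext x
    simp [resid, tr, traceOn]
  have htr : M.projF k F.1 (traceOn (M.face F.1) (raw v.1 i)) = M.tr F.1 (v.1 i) :=
    projF_self F.1 (M.tr F.1 (v.1 i))
  have hpr : M.projT k T (ev (raw v.1 i)) = v.1 i := projT_self T (v.1 i)
  rw [h1, LT_apply, hrec, map_add, projF_add _ (continuous_traceOn _ _)
    (continuous_traceOn _ _), projT_add, tr_add, htr, hpr, ← hr]
  congr 1
  simp only [bdryDiff]
  abel

/-- The stabilization as the action of the adjoint of `L_T` on `v_F - v_T`. -/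
theorem stab_eq (w v : M.LocalDof k T) :
    stab w v = ∑ F : M.FaceOf T, M.faceInnerVec F.1
      (fun i => (LTstar (fun F' i' => (M.faceSize F'.1)⁻¹ • LT (bdryDiff w) F' i') F i
        : M.face F.1 → ℝ)) (diffF v F) := by
  have h := LTstar_spec (fun F' i' => (M.faceSize F'.1)⁻¹ • LT (bdryDiff w) F' i') (bdryDiff v)
  rw [bdryInner_comm (bdryDiff v)] at h
  simp only [diffF_eq_bdryDiff]
  refine Eq.trans ?_ h
  rw [stab, bdryInner]
  refine Finset.sum_congr rfl fun F _ => ?_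
  rw [resid_eq, resid_eq, faceInnerVec_comm]
  simp only [faceInnerVec, Submodule.coe_neg, Submodule.coe_smul, faceInner_neg_left,
    faceInner_neg_right, neg_neg, faceInner_smul_right, Finset.mul_sum]

/-! ### Tractions -/

theorem symGrad_mem {r : Fin d → Poly d (k + 1)} (i j : Fin d) :
    symGrad (raw r) i j ∈ Poly d k :=
  Submodule.smul_mem _ _ (Submodule.add_mem _ (pderiv_mem i (r j).2) (pderiv_mem j (r i).2))

theorem totalStress_mem (mu lam : ℝ) (v : M.LocalDof k T) (q : Poly d k) (i j : Fin d) :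
    totalStress mu lam v q i j ∈ Poly d k := by
  have hdiag : ∀ p : Poly d k, Matrix.diagonal (fun _ : Fin d => (p : MvPolynomial (Fin d) ℝ)) i j
      ∈ Poly d k := fun p => by
    rw [Matrix.diagonal_apply]
    split_ifs
    · exact p.2
    · exact Submodule.zero_mem _
  rw [totalStress, stress, Matrix.sub_apply, Matrix.add_apply, Matrix.smul_apply,
    Matrix.smul_apply]
  exact Submodule.sub_mem _ (Submodule.add_mem _ (Submodule.smul_mem _ _ (symGrad_mem i j))
    (Submodule.smul_mem _ _ (hdiag _))) (hdiag q)

theorem traction_eq (mu lam : ℝ) (v : M.LocalDof k T) (q : Poly d k) (F : M.FaceOf T) :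
    traction mu lam v q F = M.normalTrace F.1 (totalStress mu lam v q) (M.normal T F.1) +
      (2 * mu) • fun i =>
        (LTstar (fun F' i' => (M.faceSize F'.1)⁻¹ • LT (bdryDiff v) F' i') F i
          : M.face F.1 → ℝ) := rfl

theorem traction_mem (mu lam : ℝ) (v : M.LocalDof k T) (q : Poly d k) (F : M.FaceOf T)
    (i : Fin d) : traction mu lam v q F i ∈ M.FacePoly k F.1 := by
  rw [traction_eq, Pi.add_apply, normalTrace_eq_traceOn]
  refine Submodule.add_mem _ (Submodule.mem_map_of_mem (Submodule.sum_mem _ fun j _ =>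
    Submodule.smul_mem _ _ (totalStress_mem mu lam v q i j))) ?_
  exact Submodule.smul_mem _ _ (Subtype.prop _)

/-- The elasticity and coupling forms, tested with `v`, are the work of the total stress and of the
tractions. -/
theorem aT_add_bT (mu lam : ℝ) (u v : M.LocalDof k T) (p : Poly d k) :
    aT mu lam u v + bT v p =
      M.cellInnerMat T (totalStress mu lam u p) (symGrad (raw v.1)) +
      ∑ F : M.FaceOf T, M.faceInnerVec F.1 (traction mu lam u p F) (diffF v F) := by
  have h1 : discStrain v (totalStress mu lam u p) =
      2 * mu * M.cellInnerMat T (symGrad (raw (recT u))) (symGrad (raw (recT v)))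
      + lam * M.cellInner T (ev (divT u)) (ev (divT v)) - M.cellInner T (ev (divT v)) (ev p) := by
    have hr : discStrain v (symGrad (raw (recT u))) =
        M.cellInnerMat T (symGrad (raw (recT u))) (symGrad (raw (recT v))) := by
      rw [cellInnerMat_comm]
      exact ((recT_spec v).1 (recT u)).symm
    have hsub : totalStress mu lam u p = (2 * mu) • symGrad (raw (recT u)) +
        lam • Matrix.diagonal (fun _ => (divT u : MvPolynomial (Fin d) ℝ)) +
        (-1 : ℝ) • Matrix.diagonal (fun _ => (p : MvPolynomial (Fin d) ℝ)) := by
      rw [totalStress, stress]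
      module
    rw [hsub, discStrain_add_right, discStrain_add_right, discStrain_smul_right,
      discStrain_smul_right, discStrain_smul_right, hr, ← divT_spec, ← divT_spec]
    simp only [cellInner_ev, mul_comm (divT v : MvPolynomial (Fin d) ℝ)]
    ring
  have h2 : ∀ F : M.FaceOf T, M.faceInnerVec F.1 (traction mu lam u p F) (diffF v F) =
      M.faceInnerVec F.1 (diffF v F)
        (M.normalTrace F.1 (totalStress mu lam u p) (M.normal T F.1)) +
      2 * mu * M.faceInnerVec F.1
        (fun i => (LTstar (fun F' i' => (M.faceSize F'.1)⁻¹ • LT (bdryDiff u) F' i') F i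
          : M.face F.1 → ℝ)) (diffF v F) := fun F => by
    have hc : ∀ i, Continuous (((2 * mu) • fun i =>
        (LTstar (fun F' i' => (M.faceSize F'.1)⁻¹ • LT (bdryDiff u) F' i') F i
          : M.face F.1 → ℝ)) i) := fun i => (M.continuous_facePoly
        (LTstar (fun F' i' => (M.faceSize F'.1)⁻¹ • LT (bdryDiff u) F' i') F i)).const_smul (2 * mu)
    rw [traction_eq, faceInnerVec_add_left (continuous_normalTrace _ _ _) hc
      (continuous_diffF v F),
      faceInnerVec_smul_left, faceInnerVec_comm (M.normalTrace _ _ _)]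
  simp only [h2, Finset.sum_add_distrib, ← Finset.mul_sum, ← stab_eq]
  rw [cellInnerMat_comm, ← add_assoc, ← discStrain, h1, aT, bT]
  ring

/-! ### Discrete divergence by parts -/

/-- Integrating by parts, the trace of the element unknown drops out of the discrete divergence. -/
theorem divT_by_parts (v : M.LocalDof k T) (q : Poly d k) :
    M.cellInner T (ev (divT v)) (ev q) =
      ∑ F : M.FaceOf T, ∑ i, M.normal T F.1 i *
        M.faceInner F.1 (v.2 F i) (traceOn (M.face F.1) q)
      - ∑ i, M.cellInt T (v.1 i * MvPolynomial.pderiv i (q : MvPolynomial (Fin d) ℝ)) := by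
  have h1 : ∀ (F : M.FaceOf T) i, M.faceInner F.1 (diffF v F i)
      (fun x => ev (d := d) q x * M.normal T F.1 i) = M.normal T F.1 i *
        M.faceInner F.1 (v.2 F i) (traceOn (M.face F.1) q) - M.normal T F.1 i *
        M.faceInner F.1 (traceOn (M.face F.1) (v.1 i)) (traceOn (M.face F.1) q) := by
    intro F i
    have h2 : (fun x : M.face F.1 => ev (d := d) q x * M.normal T F.1 i) =
        M.normal T F.1 i • traceOn (M.face F.1) q := by
      funext x; simp [traceOn, mul_comm]
    have h3 : diffF v F i = (v.2 F i : M.face F.1 → ℝ) - traceOn (M.face F.1) (v.1 i) := rfl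
    rw [h2, h3, faceInner_smul_right, faceInner_sub_left (M.continuous_facePoly _)
      (continuous_traceOn _ _) (continuous_traceOn _ _), mul_sub]
  have h2 : M.cellInner T (ev (div (raw v.1))) (ev q) =
      ∑ F : M.FaceOf T, ∑ i, M.normal T F.1 i *
        M.faceInner F.1 (traceOn (M.face F.1) (v.1 i)) (traceOn (M.face F.1) q)
      - ∑ i, M.cellInt T (v.1 i * MvPolynomial.pderiv i (q : MvPolynomial (Fin d) ℝ)) := by
    rw [cellInner_ev, div, Finset.sum_mul, map_sum, Finset.sum_comm, ← Finset.sum_sub_distrib]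
    refine Finset.sum_congr rfl fun i _ => ?_
    rw [← M.integrate_by_parts T i (v.1 i) q]
    ring
  rw [divT_spec, discStrain_diagonal, h2]
  simp only [faceInnerVec, h1, Finset.sum_sub_distrib]
  ring

/-! ### Interfaces -/

/-- Some point of a face lies in the flat part of the boundary of two given elements sharing the
face. -/
theorem exists_common_flat_point {F : M.Face} {T₁ T₂ : M.Elem}
    (h₁ : M.face F ⊆ frontier (M.cell T₁)) (h₂ : M.face F ⊆ frontier (M.cell T₂)) :
    ∃ x ∈ M.face F, ∃ r > 0, ∀ y ∈ Metric.ball x r,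
      (y ∈ M.cell T₁ ↔ inner ℝ (M.normal T₁ F) (y - x) < 0) ∧
      (y ∈ M.cell T₂ ↔ inner ℝ (M.normal T₂ F) (y - x) < 0) := by
  have hne : (ae ((μHE[d - 1] : Measure (Pt d)).restrict (M.face F))).NeBot := by
    rw [ae_neBot, Ne, Measure.restrict_eq_zero]
    exact (M.face_pos F).ne'
  obtain ⟨x, ⟨⟨r₁, hr₁, hx₁⟩, r₂, hr₂, hx₂⟩, hx⟩ :=
    (((M.normal_spec T₁ F h₁).outward.and (M.normal_spec T₂ F h₂).outward).and
      (ae_restrict_mem (M.face_closed F).measurableSet)).exists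
  refine ⟨x, hx, min r₁ r₂, lt_min hr₁ hr₂, fun y hy => ⟨hx₁ y ?_, hx₂ y ?_⟩⟩
  · exact Metric.ball_subset_ball (min_le_left _ _) hy
  · exact Metric.ball_subset_ball (min_le_right _ _) hy

/-- The outward normals of two elements sharing a face are opposite: otherwise the two half-spaces
that the elements fill near a common flat point would overlap. -/
theorem normal_eq_neg {F : M.Face} {T₁ T₂ : M.Elem} (hne : T₁ ≠ T₂)
    (h₁ : M.face F ⊆ frontier (M.cell T₁)) (h₂ : M.face F ⊆ frontier (M.cell T₂)) :
    M.normal T₂ F = - M.normal T₁ F := by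
  obtain ⟨x, -, r, hr, hx⟩ := exists_common_flat_point h₁ h₂
  have hn₁ := (M.normal_spec T₁ F h₁).norm_eq_one
  have hn₂ := (M.normal_spec T₂ F h₂).norm_eq_one
  set n := M.normal T₁ F
  set m := M.normal T₂ F
  by_contra hcon
  -- `-(n + m)` then points into both half-spaces
  have hlt : -1 < inner ℝ n m := by
    refine lt_of_le_of_ne ?_ fun h => hcon ?_
    · have := neg_le_of_abs_le (abs_real_inner_le_norm n m)
      rwa [hn₁, hn₂, mul_one] at this
    · have h' : inner ℝ m n = (-1 : ℝ) := by rw [real_inner_comm]; exact h.symm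
      exact (inner_eq_neg_one_iff_of_norm_eq_one hn₂ hn₁).1 h'
  have hsmall : ∀ᶠ s in 𝓝[>] (0 : ℝ), x + s • -(n + m) ∈ Metric.ball x r := by
    have hc : Tendsto (fun s : ℝ => x + s • -(n + m)) (𝓝[>] 0) (𝓝 x) :=
      (Continuous.tendsto' (by fun_prop) 0 x (by simp)).mono_left nhdsWithin_le_nhds
    exact hc.eventually (Metric.ball_mem_nhds x hr)
  obtain ⟨s, hs, hs0 : 0 < s⟩ := (hsmall.and self_mem_nhdsWithin).exists
  obtain ⟨hx₁, hx₂⟩ := hx _ hs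
  rw [add_sub_cancel_left, inner_smul_right, inner_neg_right, inner_add_right,
    real_inner_self_eq_norm_sq] at hx₁ hx₂
  refine Set.disjoint_left.1 (M.cell_disjoint T₁ T₂ hne) (hx₁.2 ?_) (hx₂.2 ?_)
  · rw [hn₁]; nlinarith
  · rw [hn₂, real_inner_comm]; nlinarith

/-- A face is shared by at most two elements. -/
theorem eq_or_eq_of_face_subset {F : M.Face} {T₁ T₂ T₃ : M.Elem} (hne : T₁ ≠ T₂)
    (h₁ : M.face F ⊆ frontier (M.cell T₁)) (h₂ : M.face F ⊆ frontier (M.cell T₂))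
    (h₃ : M.face F ⊆ frontier (M.cell T₃)) : T₃ = T₁ ∨ T₃ = T₂ := by
  by_contra! hcon
  have h12 := normal_eq_neg hne h₁ h₂
  have h13 := normal_eq_neg hcon.1.symm h₁ h₃
  have h23 := normal_eq_neg hcon.2.symm h₂ h₃
  rw [h12, neg_neg] at h23
  have hn := (M.normal_spec T₁ F h₁).norm_eq_one
  have h := congrArg (inner ℝ (M.normal T₁ F)) (h23.symm.trans h13)
  rw [inner_neg_right, real_inner_self_eq_norm_sq, hn] at h
  norm_num at h

/-- An interface is not a boundary face: near a flat point of it the two adjacent elements fill a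
neighbourhood up to the face, and the domain lies on only one side of its boundary. -/
theorem IsInterface.not_isBoundaryFace {F : M.Face} (hF : M.IsInterface F) :
    ¬ M.IsBoundaryFace F := by
  rintro ⟨T, hT⟩
  obtain ⟨T₁, T₂, hne, h12⟩ := hF
  have h₁ := h12.trans Set.inter_subset_left
  have h₂ := h12.trans Set.inter_subset_right
  obtain ⟨x, hxF, r, hr, hx⟩ := exists_common_flat_point h₁ h₂
  have hn := (M.normal_spec T₁ F h₁).norm_eq_one
  rw [normal_eq_neg hne h₁ h₂] at hx
  set n := M.normal T₁ F
  have hcl : ∀ T, closure (M.cell T) ⊆ closure M.Ω := fun T => by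
    rw [M.closure_Ω]; exact Set.subset_iUnion (fun T => closure (M.cell T)) T
  have hball : Metric.ball x r ⊆ closure M.Ω := by
    intro y hy
    rcases le_or_gt (inner ℝ n (y - x)) 0 with hle | hgt
    · refine hcl T₁ ?_
      have hc : Tendsto (fun s : ℝ => y - s • n) (𝓝[>] 0) (𝓝 y) :=
        (Continuous.tendsto' (by fun_prop) 0 y (by simp)).mono_left nhdsWithin_le_nhds
      refine mem_closure_of_tendsto hc ?_
      filter_upwards [hc.eventually (Metric.isOpen_ball.mem_nhds hy), self_mem_nhdsWithin]
        with s hs (hs0 : 0 < s)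
      rw [(hx _ hs).1, sub_right_comm, inner_sub_right, inner_smul_right,
        real_inner_self_eq_norm_sq, hn]
      linarith
    · refine hcl T₂ (subset_closure ((hx y hy).2.2 ?_))
      rw [inner_neg_left]
      linarith
  have hint : x ∈ interior (closure M.Ω) :=
    mem_interior.2 ⟨_, hball, Metric.isOpen_ball, Metric.mem_ball_self hr⟩
  rw [M.Ω_polyhedron.one_sided] at hint
  have hfr := (hT hxF).2
  rw [M.Ω_polyhedron.isOpen.frontier_eq] at hfr
  exact hfr.2 hint

theorem isBoundaryFace_of_not_isInterface {F : M.Face} (hF : ¬ M.IsInterface F) :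
    M.IsBoundaryFace F := (M.face_cases F).resolve_left hF

theorem side₂_subset {F : M.Face} (hF : M.IsInterface F) :
    M.face F ⊆ frontier (M.cell (M.side₂ F)) := (M.side_spec F hF).2

theorem normal_side₂ {F : M.Face} (hF : M.IsInterface F) :
    M.normal (M.side₂ F) F = - M.faceNormal F :=
  normal_eq_neg (M.side_spec F hF).1 (M.side₁_spec F) (side₂_subset hF)

/-- Two distinct elements sharing a face are the two sides of an interface. -/
theorem sides_of_ne {F : M.Face} {T₁ T₂ : M.Elem} (hne : T₁ ≠ T₂)
    (h₁ : M.face F ⊆ frontier (M.cell T₁)) (h₂ : M.face F ⊆ frontier (M.cell T₂)) :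
    M.IsInterface F ∧
      (T₁ = M.side₁ F ∧ T₂ = M.side₂ F ∨ T₁ = M.side₂ F ∧ T₂ = M.side₁ F) := by
  have hF : M.IsInterface F := ⟨T₁, T₂, hne, Set.subset_inter h₁ h₂⟩
  refine ⟨hF, ?_⟩
  obtain ⟨hs, -⟩ := M.side_spec F hF
  rcases eq_or_eq_of_face_subset hs (M.side₁_spec F) (side₂_subset hF) h₁ with h | h <;>
  rcases eq_or_eq_of_face_subset hs (M.side₁_spec F) (side₂_subset hF) h₂ with h' | h'
  · exact absurd (h.trans h'.symm) hne
  · exact Or.inl ⟨h, h'⟩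
  · exact Or.inr ⟨h, h'⟩
  · exact absurd (h.trans h'.symm) hne

/-- A sum over elements and their faces, of quantities vanishing on boundary faces, is a sum over
interfaces. -/
theorem sum_faceOf_eq_sum_interface (G : ∀ T, M.FaceOf T → ℝ)
    (hG : ∀ T (F : M.FaceOf T), ¬ M.IsInterface F.1 → G T F = 0) :
    ∑ T, ∑ F, G T F = ∑ F : M.Interface,
      (G (M.side₁ F.1) ⟨F.1, M.side₁_spec F.1⟩ + G (M.side₂ F.1) ⟨F.1, side₂_subset F.2⟩) := by
  classical
  let g : M.Elem → M.Face → ℝ := fun T F =>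
    if h : M.face F ⊆ frontier (M.cell T) then G T ⟨F, h⟩ else 0
  have hg : ∀ T (F : M.FaceOf T), g T F.1 = G T F := fun T F => dif_pos F.2
  have h1 : ∀ T, ∑ F, G T F = ∑ F, g T F := fun T => by
    have h2 := Finset.sum_subtype (Finset.univ.filter fun F => M.face F ⊆ frontier (M.cell T))
      (p := fun F => M.face F ⊆ frontier (M.cell T)) (F := (inferInstance : Fintype (M.FaceOf T)))
      (by simp) (g T)
    rw [Finset.sum_filter_of_ne] at h2
    · rw [h2]
      exact Finset.sum_congr rfl fun F _ => (hg T F).symm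
    · intro F _ hF
      by_contra hcon
      exact hF (dif_neg hcon)
  have h3 := Finset.sum_subtype (Finset.univ.filter fun F => M.IsInterface F)
    (p := fun F => M.IsInterface F) (F := (inferInstance : Fintype M.Interface)) (by simp)
    (fun F => ∑ T, g T F)
  rw [Finset.sum_filter_of_ne] at h3
  · simp only [h1]
    rw [Finset.sum_comm, h3]
    refine Finset.sum_congr rfl fun F _ => ?_
    have hs := (M.side_spec F.1 F.2).1
    rw [Finset.sum_eq_add (M.side₁ F.1) (M.side₂ F.1) hs]
    · exact congrArg₂ _ (hg _ ⟨F.1, M.side₁_spec F.1⟩) (hg _ ⟨F.1, side₂_subset F.2⟩)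
    · rintro T - ⟨hT₁, hT₂⟩
      refine dif_neg fun hT => ?_
      rcases eq_or_eq_of_face_subset hs (M.side₁_spec F.1) (side₂_subset F.2) hT with h | h
      · exact hT₁ h
      · exact hT₂ h
    · simp
    · simp
  · intro F _ hF
    by_contra hcon
    refine hF (Finset.sum_eq_zero fun T _ => ?_)
    by_cases h : M.face F ⊆ frontier (M.cell T)
    · exact (dif_pos h).trans (hG T ⟨F, h⟩ hcon)
    · exact dif_neg h

/-! ### Jumps, averages and mass fluxes -/

theorem jump_eq_traceOn (F : M.Face) (q : M.Elem → MvPolynomial (Fin d) ℝ) :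
    M.jump F q = traceOn (M.face F) (q (M.side₁ F)) - traceOn (M.face F) (q (M.side₂ F)) := rfl

theorem continuous_jump (F : M.Face) (q : M.Elem → MvPolynomial (Fin d) ℝ) :
    Continuous (M.jump F q) := (continuous_traceOn _ _).sub (continuous_traceOn _ _)

/-- The polynomial whose trace is the weighted average `{κ ξ}_ω · n`. -/
noncomputable def wavgFluxPoly (κ : M.Elem → ℝ) (F : M.Face)
    (ξ : M.Elem → Fin d → MvPolynomial (Fin d) ℝ) (n : Pt d) : MvPolynomial (Fin d) ℝ :=
  ∑ i, n i •
    ((κ (M.side₂ F) / (κ (M.side₁ F) + κ (M.side₂ F))) • κ (M.side₁ F) • ξ (M.side₁ F) i +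
    (κ (M.side₁ F) / (κ (M.side₁ F) + κ (M.side₂ F))) • κ (M.side₂ F) • ξ (M.side₂ F) i)

theorem wavgFlux_eq_traceOn (κ : M.Elem → ℝ) (F : M.Face)
    (ξ : M.Elem → Fin d → MvPolynomial (Fin d) ℝ) (n : Pt d) :
    M.wavgFlux κ F ξ n = traceOn (M.face F) (wavgFluxPoly κ F ξ n) := by
  funext x
  simp [wavgFlux, wavg, wavgFluxPoly, traceOn, mul_comm (n _), add_mul]

theorem continuous_wavgFlux (κ : M.Elem → ℝ) (F : M.Face)
    (ξ : M.Elem → Fin d → MvPolynomial (Fin d) ℝ) (n : Pt d) : Continuous (M.wavgFlux κ F ξ n) := by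
  rw [wavgFlux_eq_traceOn]
  exact continuous_traceOn _ _

theorem wavgFlux_neg (κ : M.Elem → ℝ) (F : M.Face)
    (ξ : M.Elem → Fin d → MvPolynomial (Fin d) ℝ) (n : Pt d) :
    M.wavgFlux κ F ξ (-n) = - M.wavgFlux κ F ξ n := by
  funext x
  simp [wavgFlux]

theorem wavgFlux_add (κ : M.Elem → ℝ) (F : M.Face)
    (ξ η : M.Elem → Fin d → MvPolynomial (Fin d) ℝ) (n : Pt d) :
    M.wavgFlux κ F (ξ + η) n = M.wavgFlux κ F ξ n + M.wavgFlux κ F η n := by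
  have h : wavgFluxPoly κ F (ξ + η) n = wavgFluxPoly κ F ξ n + wavgFluxPoly κ F η n := by
    simp only [wavgFluxPoly, ← Finset.sum_add_distrib, Pi.add_apply]
    exact Finset.sum_congr rfl fun i _ => by module
  rw [wavgFlux_eq_traceOn, wavgFlux_eq_traceOn, wavgFlux_eq_traceOn, h, map_add]

theorem wavgFlux_smul (κ : M.Elem → ℝ) (F : M.Face) (c : ℝ)
    (ξ : M.Elem → Fin d → MvPolynomial (Fin d) ℝ) (n : Pt d) :
    M.wavgFlux κ F (c • ξ) n = c • M.wavgFlux κ F ξ n := by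
  have h : wavgFluxPoly κ F (c • ξ) n = c • wavgFluxPoly κ F ξ n := by
    simp only [wavgFluxPoly, Finset.smul_sum, Pi.smul_apply]
    exact Finset.sum_congr rfl fun i _ => by module
  rw [wavgFlux_eq_traceOn, wavgFlux_eq_traceOn, h, map_smul]

theorem massFlux_eq {T : M.Elem} (κ : M.Elem → ℝ) (ς : ℝ) (F : M.FaceOf T)
    (hF : M.IsInterface F.1) (w : Fin d → M.FacePoly k F.1) (q : M.Broken k) :
    massFlux κ ς F w q = - ∑ i, M.normal T F.1 i • (w i : M.face F.1 → ℝ)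
      + M.wavgFlux κ F.1 (M.gradh q) (M.normal T F.1)
      - (ς * M.lamF κ F.1 / M.faceSize F.1 * inner ℝ (M.normal T F.1) (M.faceNormal F.1)) •
        M.jump F.1 (M.rawB q) := by
  rw [massFlux, if_pos hF]
  funext x
  simp only [Pi.add_apply, Pi.sub_apply, Pi.neg_apply, Finset.sum_apply, Pi.smul_apply,
    smul_eq_mul, mul_comm (M.normal T F.1 _)]
  ring

theorem massFlux_mem {T : M.Elem} (κ : M.Elem → ℝ) (ς : ℝ) (F : M.FaceOf T)
    (w : Fin d → M.FacePoly k F.1) (q : M.Broken k) : massFlux κ ς F w q ∈ M.FacePoly k F.1 := by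
  by_cases hF : M.IsInterface F.1
  · rw [massFlux_eq κ ς F hF, wavgFlux_eq_traceOn, jump_eq_traceOn]
    have hgrad : ∀ T i, M.gradh q T i ∈ Poly d k := fun T i =>
      poly_mono (Nat.sub_le k 1) (pderiv_mem i (q T).2)
    refine Submodule.sub_mem _ (Submodule.add_mem _ (Submodule.neg_mem _
      (Submodule.sum_mem _ fun i _ => Submodule.smul_mem _ _ (w i).2))
      (Submodule.mem_map_of_mem (Submodule.sum_mem _ fun i _ => ?_)))
      (Submodule.smul_mem _ _ (Submodule.sub_mem _ (Submodule.mem_map_of_mem (q _).2)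
        (Submodule.mem_map_of_mem (q _).2)))
    exact Submodule.smul_mem _ _ (Submodule.add_mem _
      (Submodule.smul_mem _ _ (Submodule.smul_mem _ _ (hgrad _ i)))
      (Submodule.smul_mem _ _ (Submodule.smul_mem _ _ (hgrad _ i))))
  · rw [massFlux, if_neg hF]
    exact Submodule.zero_mem _

/-- The mass fluxes seen from the two sides of a face are opposite, being odd in the normal. -/
theorem massFlux_add_massFlux {F : M.Face} {T₁ T₂ : M.Elem} (hne : T₁ ≠ T₂)
    (h₁ : M.face F ⊆ frontier (M.cell T₁)) (h₂ : M.face F ⊆ frontier (M.cell T₂))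
    (κ : M.Elem → ℝ) (ς : ℝ) (w : Fin d → M.FacePoly k F) (q : M.Broken k) :
    massFlux κ ς (T := T₁) ⟨F, h₁⟩ w q + massFlux κ ς (T := T₂) ⟨F, h₂⟩ w q = 0 := by
  have hF : M.IsInterface F := (sides_of_ne hne h₁ h₂).1
  rw [massFlux_eq κ ς _ hF, massFlux_eq κ ς _ hF]
  simp only [normal_eq_neg hne h₁ h₂, wavgFlux_neg, inner_neg_left, PiLp.neg_apply, neg_smul,
    Finset.sum_neg_distrib, mul_neg]
  abel

/-! ### Lifting of the jumps -/

/-- The lifting exists, the permeability being positive. -/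
theorem lift_spec {κ : M.Elem → ℝ} (hκ : ∀ T, 0 < κ T) (q : M.Broken k)
    (ξ : M.Elem → Fin d → Poly d (k - 1)) :
    ∑ T, κ T * ∑ i, M.cellInner T (ev (M.lift κ q T i)) (ev (ξ T i)) =
      ∑ F : M.Interface, M.faceInner F.1 (M.jump F.1 (M.rawB q))
        (M.wavgFlux κ F.1 (fun T => raw (ξ T)) (M.faceNormal F.1)) := by
  have hnn : ∀ T (q : MvPolynomial (Fin d) ℝ), 0 ≤ M.cellInt T (q * q) := fun T q => by
    rw [cellInt_apply]
    exact integral_nonneg fun x => by simpa using mul_self_nonneg (ev q x)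
  have h := exists_riesz (fun R ξ : M.Elem → Fin d → Poly d (k - 1) =>
      ∑ T, κ T * ∑ i, M.cellInner T (ev (R T i)) (ev (ξ T i)))
    (fun v w => by simp only [cellInner_ev, mul_comm])
    (fun u v w => by
      simp only [cellInner_ev, Pi.add_apply, Submodule.coe_add, mul_add, map_add,
        Finset.sum_add_distrib])
    (fun c v w => by
      simp only [cellInner_ev, Pi.smul_apply, Submodule.coe_smul, mul_smul_comm, map_smul,
        smul_eq_mul, ← Finset.mul_sum, mul_left_comm _ c])
    (fun ξ => ∑ F : M.Interface, M.faceInner F.1 (M.jump F.1 (M.rawB q))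
        (M.wavgFlux κ F.1 (fun T => raw (ξ T)) (M.faceNormal F.1)))
    (fun v w => by
      rw [← Finset.sum_add_distrib]
      refine Finset.sum_congr rfl fun F _ => ?_
      rw [← faceInner_add_right (continuous_jump _ _) (continuous_wavgFlux _ _ _ _)
        (continuous_wavgFlux _ _ _ _), ← wavgFlux_add]
      rfl)
    (fun c v => by
      rw [Finset.mul_sum]
      refine Finset.sum_congr rfl fun F _ => ?_
      rw [← faceInner_smul_right, ← wavgFlux_smul]
      rfl)
    (fun v hv => by
      have hv0 : v = 0 := by
        simp only [cellInner_ev] at hv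
        have h1 := fun T => (Finset.sum_eq_zero_iff_of_nonneg fun T _ =>
          mul_nonneg (hκ T).le (Finset.sum_nonneg fun i _ => hnn T (v T i))).1 hv T
            (Finset.mem_univ T)
        funext T i
        have h2 := (mul_eq_zero.1 (h1 T)).resolve_left (hκ T).ne'
        have h3 := (Finset.sum_eq_zero_iff_of_nonneg fun i _ => hnn T (v T i)).1 h2 i
          (Finset.mem_univ i)
        exact Subtype.ext (M.eq_zero_of_cellInt_mul_self T h3)
      refine Finset.sum_eq_zero fun F _ => ?_
      have h4 : (fun T => raw (v T)) = (0 : ℝ) • (0 : M.Elem → Fin d → MvPolynomial (Fin d) ℝ) := by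
        rw [hv0, zero_smul]; rfl
      rw [h4, wavgFlux_smul, faceInner_smul_right, zero_mul])
  exact Classical.epsilon_spec h ξ

/-- On an interface the velocity part of the mass flux cancels. -/
theorem faceInner_massFlux {T : M.Elem} (κ : M.Elem → ℝ) (ς : ℝ) (F : M.FaceOf T)
    (hF : M.IsInterface F.1) (w : Fin d → M.FacePoly k F.1) (p : M.Broken k)
    {ψ : M.face F.1 → ℝ} (hψ : Continuous ψ) :
    ∑ i, M.normal T F.1 i * M.faceInner F.1 (w i) ψ + M.faceInner F.1 (massFlux κ ς F w p) ψ =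
      M.faceInner F.1 (M.wavgFlux κ F.1 (M.gradh p) (M.normal T F.1)) ψ
      - ς * M.lamF κ F.1 / M.faceSize F.1 * inner ℝ (M.normal T F.1) (M.faceNormal F.1) *
        M.faceInner F.1 (M.jump F.1 (M.rawB p)) ψ := by
  have hw : ∀ i, Continuous (M.normal T F.1 i • (w i : M.face F.1 → ℝ)) := fun i =>
    (M.continuous_facePoly (w i)).const_smul _
  have hsum : ∀ s : Finset (Fin d), Continuous (∑ i ∈ s, M.normal T F.1 i •
      (w i : M.face F.1 → ℝ)) ∧ M.faceInner F.1 (∑ i ∈ s, M.normal T F.1 i •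
      (w i : M.face F.1 → ℝ)) ψ = ∑ i ∈ s, M.normal T F.1 i * M.faceInner F.1 (w i) ψ := by
    classical
    intro s
    induction s using Finset.induction_on with
    | empty => simpa using continuous_zero
    | insert i s hi ih =>
      rw [Finset.sum_insert hi, Finset.sum_insert hi, faceInner_add_left (hw i) ih.1 hψ, ih.2,
        faceInner_smul_left]
      exact ⟨(hw i).add ih.1, rfl⟩
  obtain ⟨hc, hs⟩ := hsum Finset.univ
  have hW := continuous_wavgFlux κ F.1 (M.gradh p) (M.normal T F.1)
  rw [massFlux_eq κ ς F hF, faceInner_sub_left (hc.neg.add hW)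
    ((continuous_jump _ _).const_smul _) hψ, faceInner_add_left hc.neg hW hψ, faceInner_neg_left,
    faceInner_smul_left, hs]
  ring

/-- Assembling the mass fluxes, face unknowns vanishing on the boundary, yields the consistency and
penalty terms of the interior penalty form. -/
theorem sum_massFlux (κ : M.Elem → ℝ) (ς : ℝ) {w : M.Hybrid k} (hw : w ∈ M.HybridD k)
    (p q : M.Broken k) :
    ∑ T, ∑ F : M.FaceOf T, (∑ i, M.normal T F.1 i *
        M.faceInner F.1 (w.2 F.1 i) (traceOn (M.face F.1) (q T)) +
      M.faceInner F.1 (massFlux κ ς F (w.2 F.1) p) (traceOn (M.face F.1) (q T))) =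
    ∑ F : M.Interface,
      (M.faceInner F.1 (M.wavgFlux κ F.1 (M.gradh p) (M.faceNormal F.1)) (M.jump F.1 (M.rawB q))
        - ς * M.lamF κ F.1 / M.faceSize F.1 *
          M.faceInner F.1 (M.jump F.1 (M.rawB p)) (M.jump F.1 (M.rawB q))) := by
  rw [sum_faceOf_eq_sum_interface]
  · refine Finset.sum_congr rfl fun F _ => ?_
    have hn : inner ℝ (M.faceNormal F.1) (M.faceNormal F.1) = (1 : ℝ) := by
      rw [real_inner_self_eq_norm_sq, faceNormal,
        (M.normal_spec _ F.1 (M.side₁_spec F.1)).norm_eq_one, one_pow]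
    have hW := continuous_wavgFlux κ F.1 (M.gradh p) (M.faceNormal F.1)
    have h1 := continuous_traceOn (M.face F.1) (q (M.side₁ F.1))
    have h2 := continuous_traceOn (M.face F.1) (q (M.side₂ F.1))
    rw [faceInner_massFlux κ ς _ F.2 _ _ h1, faceInner_massFlux κ ς _ F.2 _ _ h2,
      normal_side₂ F.2, wavgFlux_neg, inner_neg_left, faceInner_neg_left,
      jump_eq_traceOn F.1 (M.rawB q), faceInner_sub_right hW h1 h2,
      faceInner_sub_right (continuous_jump _ _) h1 h2, ← faceNormal, hn]
    ring
  · intro T F hF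
    have h0 : w.2 F.1 = 0 := hw F.1 (isBoundaryFace_of_not_isInterface hF)
    rw [h0, massFlux, if_neg hF]
    simp

end PolyMesh

namespace BiotData

open PolyMesh

variable {d : ℕ} {M : PolyMesh d} (B : BiotData M) {k : ℕ}

/-! ### Mass balance -/

/-- The left-hand side of the discrete mass balance is the sum of the local mass balances. -/
theorem flow_eq_sum_flowLhs {u : ℕ → M.Hybrid k} {n : ℕ} (hu : B.ddt u n ∈ M.HybridD k)
    (p : ℕ → M.Broken k) (q : M.Broken k) :
    ∑ T, B.c₀ * M.cellInner T (ev (B.ddt p n T)) (ev (q T)) - M.bh (B.ddt u n) q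
      + M.ch B.κ B.ς (p n) q = ∑ T, B.flowLhs u p n T (q T) := by
  set w := B.ddt u n with hw
  have hlift := lift_spec B.κ_pos (p n)
    (fun T i => ⟨M.gradh q T i, pderiv_mem i (q T).2⟩)
  have hflow : ∀ T, B.flowLhs u p n T (q T) =
      B.c₀ * M.cellInner T (ev (B.ddt p n T)) (ev (q T))
      - ∑ i, M.cellInt T (w.1 T i * MvPolynomial.pderiv i (q T : MvPolynomial (Fin d) ℝ))
      + B.κ T * ∑ i, M.cellInner T (ev (M.gradh (p n) T i)) (ev (M.gradh q T i))
      - B.κ T * ∑ i, M.cellInner T (ev (M.lift B.κ (p n) T i)) (ev (M.gradh q T i))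
      - ∑ F : M.FaceOf T, M.faceInner F.1 (massFlux B.κ B.ς F (w.2 F.1) (p n))
          (traceOn (M.face F.1) (q T)) := by
    intro T
    have hcell : ∀ i, M.cellInner T
        (fun x => ev (w.1 T i) x - B.κ T * (ev (M.gradh (p n) T i) x
          - ev (M.lift B.κ (p n) T i) x))
        (ev (MvPolynomial.pderiv i (q T : MvPolynomial (Fin d) ℝ))) =
        M.cellInt T (w.1 T i * MvPolynomial.pderiv i (q T : MvPolynomial (Fin d) ℝ))
        - B.κ T * M.cellInner T (ev (M.gradh (p n) T i)) (ev (M.gradh q T i))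
        + B.κ T * M.cellInner T (ev (M.lift B.κ (p n) T i)) (ev (M.gradh q T i)) := by
      intro i
      have h1 : (fun x => ev (w.1 T i) x - B.κ T * (ev (M.gradh (p n) T i) x
          - ev (M.lift B.κ (p n) T i) x)) =
          ev ((w.1 T i : MvPolynomial (Fin d) ℝ) - B.κ T • (M.gradh (p n) T i
            - (M.lift B.κ (p n) T i : MvPolynomial (Fin d) ℝ))) := by
        funext x; simp
      rw [h1]
      simp only [cellInner_ev, sub_mul, smul_mul_assoc, map_sub, map_smul, smul_eq_mul, mul_sub,
        gradh]
      ring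
    rw [flowLhs, ← hw]
    simp only [hcell, Finset.sum_add_distrib, Finset.sum_sub_distrib, ← Finset.mul_sum]
    ring
  have hb : M.bh w q = - ∑ T, ∑ F : M.FaceOf T, ∑ i, M.normal T F.1 i *
        M.faceInner F.1 (w.2 F.1 i) (traceOn (M.face F.1) (q T))
      + ∑ T, ∑ i, M.cellInt T (w.1 T i *
        MvPolynomial.pderiv i (q T : MvPolynomial (Fin d) ℝ)) := by
    simp only [bh, bT, divT_by_parts, Finset.sum_neg_distrib, Finset.sum_sub_distrib]
    simp only [toLocal]
    ring
  have hface := sum_massFlux B.κ B.ς hu (p n) q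
  simp only [hflow, hb, ch]
  simp only [Finset.sum_add_distrib, Finset.sum_sub_distrib] at hface ⊢
  have hjump : ∑ F : M.Interface, M.faceInner F.1 (M.jump F.1 (M.rawB (p n)))
      (M.wavgFlux B.κ F.1 (M.gradh q) (M.faceNormal F.1)) =
      ∑ T, B.κ T * ∑ i, M.cellInner T (ev (M.lift B.κ (p n) T i)) (ev (M.gradh q T i)) :=
    hlift.symm
  rw [hjump]
  linarith

theorem flowLhs_zero (u : ℕ → M.Hybrid k) (p : ℕ → M.Broken k) (n : ℕ) (T : M.Elem) :
    B.flowLhs u p n T 0 = 0 := by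
  simp [flowLhs, cellInner]

/-- The mass balance can be tested element by element, since the pressure test functions are
discontinuous. -/
theorem massBalance_iff {u : ℕ → M.Hybrid k} {n : ℕ} (hu : B.ddt u n ∈ M.HybridD k)
    (p : ℕ → M.Broken k) :
    (∀ q : M.Broken k,
      ∑ T, B.c₀ * M.cellInner T (ev (B.ddt p n T)) (ev (q T)) - M.bh (B.ddt u n) q
        + M.ch B.κ B.ς (p n) q = ∑ T, M.cellInner T (B.gn n) (ev (q T))) ↔
      B.LocalMassBalance u p n := by
  classical
  simp only [B.flow_eq_sum_flowLhs hu]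
  constructor
  · intro h T q
    have h1 := h (Pi.single T q)
    rw [Finset.sum_eq_single T, Finset.sum_eq_single T, Pi.single_eq_same] at h1
    · exact h1
    · intro T' _ hT'
      rw [Pi.single_eq_of_ne hT']
      simp [cellInner]
    · simp
    · intro T' _ hT'
      rw [Pi.single_eq_of_ne hT', flowLhs_zero]
    · simp
  · intro h q
    exact Finset.sum_congr rfl fun T _ => h T (q T)

/-! ### Mechanical balance -/

theorem ah_add_bh (u : ℕ → M.Hybrid k) (p : ℕ → M.Broken k) (n : ℕ) (v : M.Hybrid k) :
    M.ah B.mu B.lam (u n) v + M.bh v (p n) = ∑ T, B.mechLhs u p n T (M.toLocal T v) := by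
  rw [ah, bh, ← Finset.sum_add_distrib]
  exact Finset.sum_congr rfl fun T _ => aT_add_bT _ _ _ _ _

/-- The left-hand side of the local equilibrium in the element `T`. -/
noncomputable def equilibriumLhs (u : ℕ → M.Hybrid k) (p : ℕ → M.Broken k) (n : ℕ) (T : M.Elem)
    (v : Fin d → Poly d k) : ℝ :=
  M.cellInnerMat T (totalStress B.mu B.lam (M.toLocal T (u n)) (p n T)) (symGrad (raw v))
    - ∑ F : M.FaceOf T,
        M.faceInnerVec F.1 (traction B.mu B.lam (M.toLocal T (u n)) (p n T) F)
          (fun i => traceOn (M.face F.1) (v i))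

theorem continuous_traction {T : M.Elem} (mu lam : ℝ) (v : M.LocalDof k T) (q : Poly d k)
    (F : M.FaceOf T) (i : Fin d) : Continuous (traction mu lam v q F i) :=
  M.continuous_facePoly ⟨_, traction_mem mu lam v q F i⟩

theorem mechLhs_eq (u : ℕ → M.Hybrid k) (p : ℕ → M.Broken k) (n : ℕ) (T : M.Elem)
    (v : M.LocalDof k T) :
    B.mechLhs u p n T v = B.equilibriumLhs u p n T v.1 + ∑ F : M.FaceOf T,
      M.faceInnerVec F.1 (traction B.mu B.lam (M.toLocal T (u n)) (p n T) F)
        (fun i => (v.2 F i : M.face F.1 → ℝ)) := by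
  have h : ∀ F : M.FaceOf T,
      M.faceInnerVec F.1 (traction B.mu B.lam (M.toLocal T (u n)) (p n T) F) (diffF v F) =
      M.faceInnerVec F.1 (traction B.mu B.lam (M.toLocal T (u n)) (p n T) F)
        (fun i => (v.2 F i : M.face F.1 → ℝ)) -
      M.faceInnerVec F.1 (traction B.mu B.lam (M.toLocal T (u n)) (p n T) F)
        (fun i => traceOn (M.face F.1) (v.1 i)) := fun F => by
    rw [← faceInnerVec_sub_right (continuous_traction _ _ _ _ _)
      (fun i => M.continuous_facePoly _) (fun i => continuous_traceOn _ _)]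
    rfl
  simp only [mechLhs, h, Finset.sum_sub_distrib, equilibriumLhs]
  ring

theorem equilibriumLhs_zero (u : ℕ → M.Hybrid k) (p : ℕ → M.Broken k) (n : ℕ) (T : M.Elem) :
    B.equilibriumLhs u p n T 0 = 0 := by
  have h1 : symGrad (raw (0 : Fin d → Poly d k)) =
      (0 : ℝ) • symGrad (raw (0 : Fin d → Poly d k)) := by
    rw [← symGrad_smul, ← raw_smul, zero_smul]
  rw [equilibriumLhs, h1, cellInnerMat_smul_right, zero_mul]
  simp [faceInnerVec]

theorem load_zero (n : ℕ) (T : M.Elem) : B.load n T (0 : Fin d → Poly d k) = 0 := by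
  simp [load, cellInner]

/-- The sum of the tractions from the two sides of an interface. -/
noncomputable def tractionSum (u : ℕ → M.Hybrid k) (p : ℕ → M.Broken k) (n : ℕ)
    (F : M.Interface) : Fin d → M.face F.1 → ℝ :=
  traction B.mu B.lam (M.toLocal (M.side₁ F.1) (u n)) (p n (M.side₁ F.1))
      ⟨F.1, M.side₁_spec F.1⟩ +
    traction B.mu B.lam (M.toLocal (M.side₂ F.1) (u n)) (p n (M.side₂ F.1))
      ⟨F.1, side₂_subset F.2⟩

/-- The power of the tractions against face unknowns vanishing on the boundary involves only the
sums of the tractions from the two sides of the interfaces. -/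
theorem sum_traction (u : ℕ → M.Hybrid k) (p : ℕ → M.Broken k) (n : ℕ) {v : M.Hybrid k}
    (hv : v ∈ M.HybridD k) :
    ∑ T, ∑ F : M.FaceOf T,
      M.faceInnerVec F.1 (traction B.mu B.lam (M.toLocal T (u n)) (p n T) F)
        (fun i => (v.2 F.1 i : M.face F.1 → ℝ)) =
    ∑ F : M.Interface, M.faceInnerVec F.1
      (B.tractionSum u p n F)
      (fun i => (v.2 F.1 i : M.face F.1 → ℝ)) := by
  rw [sum_faceOf_eq_sum_interface (fun T F =>
      M.faceInnerVec F.1 (traction B.mu B.lam (M.toLocal T (u n)) (p n T) F)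
        (fun i => (v.2 F.1 i : M.face F.1 → ℝ)))]
  · refine Finset.sum_congr rfl fun F _ => ?_
    have h₁ := continuous_traction B.mu B.lam (M.toLocal (M.side₁ F.1) (u n)) (p n (M.side₁ F.1))
      ⟨F.1, M.side₁_spec F.1⟩
    have h₂ := continuous_traction B.mu B.lam (M.toLocal (M.side₂ F.1) (u n)) (p n (M.side₂ F.1))
      ⟨F.1, side₂_subset F.2⟩
    have hv := fun i => M.continuous_facePoly (v.2 F.1 i)
    rw [tractionSum, faceInnerVec_add_left h₁ h₂ hv]
  · intro T F hF
    have h0 : v.2 F.1 = 0 := hv F.1 (isBoundaryFace_of_not_isInterface hF)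
    simp [h0, faceInnerVec]

theorem tractionConservative_iff (u : ℕ → M.Hybrid k) (p : ℕ → M.Broken k) (n : ℕ) :
    B.TractionConservative u p n ↔ ∀ F : M.Interface,
      B.tractionSum u p n F = 0 := by
  constructor
  · intro h F
    exact h F.1 _ _ _ _ (M.side_spec F.1 F.2).1
  · intro h F T₁ T₂ h₁ h₂ hne
    obtain ⟨hF, ⟨rfl, rfl⟩ | ⟨rfl, rfl⟩⟩ := sides_of_ne hne h₁ h₂
    · exact h ⟨F, hF⟩
    · rw [add_comm]
      exact h ⟨F, hF⟩

/-- The mechanical balance tested with element unknowns is the local equilibrium; tested with face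
unknowns it is the continuity of the tractions across interfaces. -/
theorem mechBalance_iff (u : ℕ → M.Hybrid k) (p : ℕ → M.Broken k) (n : ℕ) :
    (∀ v ∈ M.HybridD k, ∑ T, B.mechLhs u p n T (M.toLocal T v) = ∑ T, B.load n T (v.1 T)) ↔
      B.LocalEquilibrium u p n ∧ B.TractionConservative u p n := by
  classical
  have hsplit : ∀ v ∈ M.HybridD k, ∑ T, B.mechLhs u p n T (M.toLocal T v) =
      ∑ T, B.equilibriumLhs u p n T (v.1 T) + ∑ F : M.Interface, M.faceInnerVec F.1
      (B.tractionSum u p n F)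
      (fun i => (v.2 F.1 i : M.face F.1 → ℝ)) := by
    intro v hv
    simp only [mechLhs_eq, Finset.sum_add_distrib]
    rw [← B.sum_traction u p n hv]
    rfl
  constructor
  · intro h
    refine ⟨fun T v => ?_, (B.tractionConservative_iff u p n).2 fun F => ?_⟩
    · have hv : ((Pi.single T v, 0) : M.Hybrid k) ∈ M.HybridD k := fun F _ => rfl
      have h1 := h _ hv
      rw [hsplit _ hv] at h1
      rw [Finset.sum_eq_single T, Finset.sum_eq_single T, Finset.sum_eq_zero, add_zero] at h1
      · simp only [Pi.single_eq_same] at h1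
        exact h1
      · intro F _
        simp [faceInnerVec]
      · intro T' _ hT'
        simp only [Pi.single_eq_of_ne hT', load_zero]
      · simp
      · intro T' _ hT'
        simp only [Pi.single_eq_of_ne hT', equilibriumLhs_zero]
      · simp
    · have hmem : ∀ i, B.tractionSum u p n F i ∈ M.FacePoly k F.1 := fun i =>
        Submodule.add_mem _
          (traction_mem _ _ _ _ (⟨F.1, M.side₁_spec F.1⟩ : M.FaceOf (M.side₁ F.1)) i)
          (traction_mem _ _ _ _ (⟨F.1, side₂_subset F.2⟩ : M.FaceOf (M.side₂ F.1)) i)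
      let w : Fin d → M.FacePoly k F.1 := fun i => ⟨B.tractionSum u p n F i, hmem i⟩
      have hv : ((0, Pi.single F.1 w) : M.Hybrid k) ∈ M.HybridD k := fun F' hF' => by
        have hne : F' ≠ F.1 := by
          rintro rfl
          exact F.2.not_isBoundaryFace hF'
        simp [Pi.single_eq_of_ne hne]
      have h1 := h _ hv
      rw [hsplit _ hv, Finset.sum_eq_zero, zero_add, Finset.sum_eq_single F, Finset.sum_eq_zero]
        at h1
      · refine eq_zero_of_faceInnerVec_self hmem ?_
        simpa [w] using h1
      · intro T _
        exact B.load_zero n T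
      · intro F' _ hF'
        have hne : F'.1 ≠ F.1 := fun h => hF' (Subtype.ext h)
        simp [Pi.single_eq_of_ne hne, faceInnerVec]
      · simp
      · intro T _
        exact B.equilibriumLhs_zero u p n T
  · rintro ⟨hloc, hcons⟩ v hv
    rw [hsplit v hv, Finset.sum_eq_zero (s := (Finset.univ : Finset M.Interface)), add_zero]
    · exact Finset.sum_congr rfl fun T _ => hloc T (v.1 T)
    · intro F _
      rw [(B.tractionConservative_iff u p n).1 hcons F]
      simp [faceInnerVec]

end BiotData

end BiotHHO

theorem mainTheorem8 {d : ℕ} (hd : 1 ≤ d) (M : BiotHHO.PolyMesh d) (B : BiotHHO.BiotData M)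
    (k : ℕ) (hk : 1 ≤ k) :
    -- the numerical tractions and mass fluxes are polynomials of degree at most `k` on the faces
    (∀ (T : M.Elem) (F : M.FaceOf T) (v : M.LocalDof k T) (q : BiotHHO.Poly d k) (i : Fin d),
      BiotHHO.PolyMesh.traction B.mu B.lam v q F i ∈ M.FacePoly k F.1) ∧
    (∀ (T : M.Elem) (F : M.FaceOf T) (vF : Fin d → M.FacePoly k F.1) (q : M.Broken k),
      BiotHHO.PolyMesh.massFlux B.κ B.ς F vF q ∈ M.FacePoly k F.1) ∧
    -- equivalence of the discrete problem with the flux formulations, at each time step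
    (∀ (u : ℕ → M.Hybrid k) (p : ℕ → M.Broken k) (n : ℕ), 1 ≤ n → n ≤ B.N →
      u (n - 1) ∈ M.HybridD k →
      (B.IsSchemeSolution u p n ↔ B.IsFluxSolution u p n) ∧
      (B.IsSchemeSolution u p n ↔ B.IsLocalFluxSolution u p n)) := by
  refine ⟨fun T F v q i => BiotHHO.PolyMesh.traction_mem _ _ v q F i,
    fun T F vF q => BiotHHO.PolyMesh.massFlux_mem _ _ F vF q, fun u p n _ _ hprev => ?_⟩
  have hflux : B.IsSchemeSolution u p n ↔ B.IsFluxSolution u p n := by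
    refine and_congr_right fun hu => and_congr_right fun _ => and_congr ?_ ?_
    · simp only [B.ah_add_bh]
    · exact B.massBalance_iff
        (Submodule.smul_mem _ _ (Submodule.sub_mem _ hu hprev)) p
  refine ⟨hflux, hflux.trans ?_⟩
  refine and_congr_right fun _ => and_congr_right fun _ => ?_
  rw [B.mechBalance_iff u p n]
  constructor
  · rintro ⟨⟨hloc, hcons⟩, hmass⟩
    exact ⟨hloc, hmass, hcons, fun F T₁ T₂ h₁ h₂ hne =>
      BiotHHO.PolyMesh.massFlux_add_massFlux hne h₁ h₂ _ _ _ _⟩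
  · rintro ⟨hloc, hmass, hcons, -⟩
    exact ⟨⟨hloc, hcons⟩, hmass⟩
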